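/- There exist a deterministic word-RAM algorithm (one fixed program) and constants $a, c \in \mathbb{N}$ such that the following holds. Let the input consist of an undirected, unrooted tree $T$ with $n \ge 1$ vertices, given as a list of its $n-1$ edges; of $p \ge 0$ weighted paths $P_1, \dots, P_p$ in $T$, where $P_i$ is the unique path in $T$ between two given vertices $u_i, v_i$ (possibly $u_i = v_i$) and has an integer weight $w_i \in \{0, 1, \dots, C\}$; and of a positive integer $k$. Then the algorithm halts after at most $c\,(nk + p + C)$ steps and returns, for each edge $e$ of $T$, the indices of $k$ paths of lowest weight among the paths containing $e$, ties being broken arbitrarily; if $e$ is contained in fewer than $k$ of the paths, the indices of all paths containing $e$ are returned. Here a word RAM with word length $w$ performs in one step any of the following on $w$-bit words: an arithmetic operation, a bitwise operation, a comparison, or an access to a register or to a memory cell whose address is a word. Each entry of the input is stored in one word, and the statement holds for every word length $w \ge a\,(\lfloor \log_2 (nk+p+C) \rfloor + 1)$; thus words of $O(\log(nk+p+C))$ bits suffice. The bound $C$ itself is not part of the input. -/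

import Mathlib

/-! ### A word RAM with word length `w` and unit cost per operation -/

namespace WordRAM

/-- The binary arithmetic, bitwise and comparison operations on words. -/
inductive Op
  | add | sub | mul | div | mod | and | or | xor | shl | shr | lt | eq

/-- The result of an operation on two `w`-bit words, reduced to a `w`-bit word.
Subtraction wraps around; division by zero gives `0`; comparisons give `1` or `0`. -/
def Op.apply (w : ℕ) (o : Op) (x y : ℕ) : ℕ :=
  (match o with
    | .add => x + y
    | .sub => x + (2 ^ w - y)
    | .mul => x * y
    | .div => x / y
    | .mod => x % y
    | .and => x &&& y
    | .or  => x ||| y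
    | .xor => x ^^^ y
    | .shl => x <<< y
    | .shr => x >>> y
    | .lt  => if x < y then 1 else 0
    | .eq  => if x = y then 1 else 0) % 2 ^ w

/-- Registers and random access memory. Only words (numbers below `2 ^ w`) are ever put there, so
only addresses below `2 ^ w` are ever accessed; a program mentions finitely many registers. -/
structure State where
  reg : ℕ → ℕ
  mem : ℕ → ℕ

/-- Expressions: literals of the program text, registers, memory cells at a computed address, and
operations. -/
inductive Expr
  | lit (c : ℕ)
  | reg (r : ℕ)
  | load (addr : Expr)
  | op (o : Op) (a b : Expr)

/-- The value of an expression on a machine with word length `w`. -/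
def Expr.eval (w : ℕ) (s : State) : Expr → ℕ
  | .lit c => c % 2 ^ w
  | .reg r => s.reg r
  | .load addr => s.mem (addr.eval w s)
  | .op o a b => o.apply w (a.eval w s) (b.eval w s)

/-- The number of steps for evaluating an expression: one for each node. -/
def Expr.cost : Expr → ℕ
  | .lit _ => 1
  | .reg _ => 1
  | .load addr => addr.cost + 1
  | .op _ a b => a.cost + b.cost + 1

/-- Programs. -/
inductive Prog
  | skip
  | assign (r : ℕ) (e : Expr)
  | store (addr e : Expr)
  | seq (P Q : Prog)
  | cond (e : Expr) (P Q : Prog)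
  | loop (e : Expr) (P : Prog)

/-- `Exec w P s s' t`: on a machine with word length `w`, the program `P` started in the state `s`
halts in the state `s'` after `t` steps. A test succeeds if its value is not `0`. -/
inductive Exec (w : ℕ) : Prog → State → State → ℕ → Prop
  | skip (s : State) : Exec w .skip s s 1
  | assign (r : ℕ) (e : Expr) (s : State) :
      Exec w (.assign r e) s
        { reg := Function.update s.reg r (e.eval w s), mem := s.mem } (e.cost + 1)
  | store (addr e : Expr) (s : State) :
      Exec w (.store addr e) s
        { reg := s.reg, mem := Function.update s.mem (addr.eval w s) (e.eval w s) }
        (addr.cost + e.cost + 1)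
  | seq {P Q : Prog} {s₁ s₂ s₃ : State} {t₁ t₂ : ℕ}
      (hP : Exec w P s₁ s₂ t₁) (hQ : Exec w Q s₂ s₃ t₂) : Exec w (.seq P Q) s₁ s₃ (t₁ + t₂)
  | cond_true {e : Expr} {P Q : Prog} {s s' : State} {t : ℕ}
      (he : e.eval w s ≠ 0) (hP : Exec w P s s' t) : Exec w (.cond e P Q) s s' (e.cost + 1 + t)
  | cond_false {e : Expr} {P Q : Prog} {s s' : State} {t : ℕ}
      (he : e.eval w s = 0) (hQ : Exec w Q s s' t) : Exec w (.cond e P Q) s s' (e.cost + 1 + t)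
  | loop_done {e : Expr} {P : Prog} {s : State}
      (he : e.eval w s = 0) : Exec w (.loop e P) s s (e.cost + 1)
  | loop_step {e : Expr} {P : Prog} {s₁ s₂ s₃ : State} {t₁ t₂ : ℕ}
      (he : e.eval w s₁ ≠ 0) (hP : Exec w P s₁ s₂ t₁) (hL : Exec w (.loop e P) s₂ s₃ t₂) :
      Exec w (.loop e P) s₁ s₃ (e.cost + 1 + t₁ + t₂)

/-- The machine is deterministic: final state and number of steps are unique. -/
theorem Exec.deterministic {w : ℕ} {P : Prog} {s s₁ : State} {t₁ : ℕ} (h₁ : Exec w P s s₁ t₁) :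
    ∀ {s₂ : State} {t₂ : ℕ}, Exec w P s s₂ t₂ → s₁ = s₂ ∧ t₁ = t₂ := by
  induction h₁ with
  | skip s => intro s₂ t₂ h; cases h; exact ⟨rfl, rfl⟩
  | assign r e s => intro s₂ t₂ h; cases h; exact ⟨rfl, rfl⟩
  | store addr e s => intro s₂ t₂ h; cases h; exact ⟨rfl, rfl⟩
  | seq _ _ ihP ihQ =>
    intro s₂ t₂ h
    cases h with
    | seq h h' =>
      obtain ⟨rfl, rfl⟩ := ihP h
      obtain ⟨rfl, rfl⟩ := ihQ h'
      exact ⟨rfl, rfl⟩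
  | cond_true he _ ih =>
    intro s₂ t₂ h
    cases h with
    | cond_true _ h => obtain ⟨rfl, rfl⟩ := ih h; exact ⟨rfl, rfl⟩
    | cond_false h _ => exact absurd h he
  | cond_false he _ ih =>
    intro s₂ t₂ h
    cases h with
    | cond_true h _ => exact absurd he h
    | cond_false _ h => obtain ⟨rfl, rfl⟩ := ih h; exact ⟨rfl, rfl⟩
  | loop_done he =>
    intro s₂ t₂ h
    cases h with
    | loop_done _ => exact ⟨rfl, rfl⟩
    | loop_step h _ _ => exact absurd he h
  | loop_step he _ _ ihP ihL =>
    intro s₂ t₂ h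
    cases h with
    | loop_done h => exact absurd h he
    | loop_step _ h h' =>
      obtain ⟨rfl, rfl⟩ := ihP h
      obtain ⟨rfl, rfl⟩ := ihL h'
      exact ⟨rfl, rfl⟩

/-- The initial state: the input is written at the beginning of the memory, one word for each
entry, and all other cells and all registers are `0`. -/
def initState (w : ℕ) (input : List ℕ) : State where
  reg := fun _ => 0
  mem := fun i => input.getD i 0 % 2 ^ w

end WordRAM

/-! ### The problem: for each tree edge, the `k` paths of lowest weight containing it -/

/-- An instance: the `n - 1` edges of a graph on the vertices `0, …, n - 1` in any order, each
given by its two endpoints in any order; `p` paths, each given by its two endpoints and its weight;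
and the number `k`. -/
structure TreePathInput where
  n : ℕ
  p : ℕ
  k : ℕ
  edge : Fin (n - 1) → Fin n × Fin n
  ends : Fin p → Fin n × Fin n
  weight : Fin p → ℕ

namespace TreePathInput

/-- The `j`-th edge as an unordered pair. -/
def edgeSym (I : TreePathInput) (j : Fin (I.n - 1)) : Sym2 (Fin I.n) :=
  s((I.edge j).1, (I.edge j).2)

/-- The undirected graph with the listed edges. If it is a tree on `n` vertices, then the `n - 1`
listed pairs are its edges, each listed exactly once. -/
def tree (I : TreePathInput) : SimpleGraph (Fin I.n) :=
  SimpleGraph.fromEdgeSet (Set.range I.edgeSym)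

/-- The path (unique in a tree) between the two endpoints with index `i` contains the `j`-th
edge. -/
def PathContains (I : TreePathInput) (i : Fin I.p) (j : Fin (I.n - 1)) : Prop :=
  ∃ q : I.tree.Walk (I.ends i).1 (I.ends i).2, q.IsPath ∧ I.edgeSym j ∈ q.edges

/-- The list `R` consists, without repetition, of the indices of `k` paths of lowest weight among
the paths containing the `j`-th edge, ties being broken in any way; or of all paths containing it,
if there are fewer than `k`. -/
def IsAnswer (I : TreePathInput) (j : Fin (I.n - 1)) (R : List ℕ) : Prop :=
  R.Nodup ∧
  (∀ r ∈ R, ∃ i : Fin I.p, (i : ℕ) = r ∧ I.PathContains i j) ∧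
  R.length = min I.k {i : Fin I.p | I.PathContains i j}.ncard ∧
  ∀ i i' : Fin I.p, (i : ℕ) ∈ R → I.PathContains i' j → (i' : ℕ) ∉ R → I.weight i ≤ I.weight i'

/-- The instance as a sequence of words: `n`, `p`, `k`, the first and then the second endpoints of
all edges, the first and then the second endpoints of all paths, and the weights of all paths. -/
def encode (I : TreePathInput) : List ℕ :=
  [I.n, I.p, I.k] ++
    List.ofFn (fun j => ((I.edge j).1 : ℕ)) ++ List.ofFn (fun j => ((I.edge j).2 : ℕ)) ++
    List.ofFn (fun i => ((I.ends i).1 : ℕ)) ++ List.ofFn (fun i => ((I.ends i).2 : ℕ)) ++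
    List.ofFn I.weight

/-- The start of the output block of the `j`-th edge: register `0` holds the address of the output,
which has one block of `k + 1` words for each edge. -/
def blockStart (I : TreePathInput) (s : WordRAM.State) (j : ℕ) : ℕ :=
  s.reg 0 + j * (I.k + 1)

/-- The list returned for the `j`-th edge: the first word of its block is the length of the list,
and the entries follow. -/
def output (I : TreePathInput) (s : WordRAM.State) (j : Fin (I.n - 1)) : List ℕ :=
  (List.range (s.mem (I.blockStart s j))).map fun t => s.mem (I.blockStart s j + 1 + t)

end TreePathInput

/-!
The tree is rooted by stripping off leaves, with the vertices numbered in the order of their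
removal, so that parents have larger numbers than their children. An edge of the tree is identified
with its lower end, and it lies on the path between `a` and `b` if and only if exactly one of `a`
and `b` is below it or equal to its lower end.

The paths are sorted by weight with buckets, in time `O(p + C)`, and processed in this order. A path
is appended to the lists of its edges that have fewer than `k` entries so far; then every list
consists of the first `k` paths over the edge in the order of the weights (`processP_spec`,
`Rooted.isAnswer`). The vertices whose edges have room in their lists are called marked, and so is
the root. From the two ends of a path, the walk visits only marked vertices: the lower one of the
two current vertices is moved to the nearest marked ancestor of its parent, until both are equal.
Each visit adds an entry to a list, so there are at most `(n - 1) k` visits.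

It remains to find nearest marked ancestors in constant amortized time while vertices lose their
marks, which is incremental union-find on a fixed tree. As in the algorithm of Gabow and Tarjan, the
tree is divided into `O(n / b)` clusters of fewer than `2 b` vertices, where `4 ^ b` is about `n`
(`Grouping.card_cluster`, `card_clusters`). Each cluster hangs with all its top vertices from one
vertex, its exit. A set of vertices of one cluster is a mask below `T = 4 ^ b = O(n)`, and a table
of highest bits for all masks finds the nearest marked ancestor within a cluster in constant time
(`Micro.search`). When a search passes from one cluster to the next, the two are merged: the classes
of clusters are lists in which the smaller class is relabelled. All merges together take time
`O((n / b) log n) = O(n)`, which is accounted for by a potential (`potential_merge`, `pot_le`).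

The algorithm is written in a structured language with named arrays and exact arithmetic, in which
each statement and each test takes one step, and verified there by rules for total correctness
(`solveP_spec`). The compilation to the word RAM costs a constant factor (`HExec.sim`): all stored
values are `O(S ^ 2)` for `S = n k + p + C`, and the values of all expressions are bounded by a
fixed power of `S`, so words of `O(log S)` bits do not overflow.
-/

/-! ### A structured language over named arrays -/

namespace KLightest

set_option linter.constructorNameAsVariable false

open WordRAM

/-- Names of the scalar variables. The parameters are `n`, `p`, `k`, `m = n - 1`, the size parameter
`b` of the clusters with `T = 4 ^ b`, and the upper bound `mx` on the weights; the others are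
temporary. -/
inductive V
  | n | p | k | m | i | j | u | v | qt | b | T | h | x | y | c | r | g | d | s | z | t | e | w
  | mx | a | f | q | o | l
  deriving DecidableEq

/-- Names of the arrays: the input, the output, and the working arrays. Of the latter,
`deg`, `es`, `que`, `pv` are used for the removal of leaves, which results in the rooted tree `pos`,
`par`, `eid`; `acc`, `gid`, `gr`, `closed`, `exit`, `nxt` for the computation of the clusters `cl`
with the bits `pw`, `vt`, the masks `anc`, `mark`, and the table `hb`; `lab`, `elem`, `size`, `top`
for merging clusters; and `bcnt`, `bkt` for the buckets of paths. -/
inductive A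
  | inp | out | deg | es | que | pos | pv | par | eid | acc | gid | gr | closed | exit | cl | pw
  | anc | mark | vt | nxt | hb | lab | elem | size | top | bcnt | bkt
  deriving DecidableEq

/-- A state of the structured language: scalars, arrays, and the number of elementary steps made
so far. -/
structure Store where
  reg : V → ℕ
  arr : A → ℕ → ℕ
  tm : ℕ

namespace Store

/-- Assigning to a scalar, in one step. -/
def set (σ : Store) (v : V) (x : ℕ) : Store :=
  ⟨fun v' => if v' = v then x else σ.reg v', σ.arr, σ.tm + 1⟩

/-- Storing into an array, in one step. -/
def put (σ : Store) (a : A) (i x : ℕ) : Store :=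
  ⟨σ.reg, fun a' => if a' = a then Function.update (σ.arr a') i x else σ.arr a', σ.tm + 1⟩

/-- One step without any effect. -/
def tick (σ : Store) : Store := ⟨σ.reg, σ.arr, σ.tm + 1⟩

variable (σ : Store) (v v' : V) (a a' : A) (i x : ℕ)

@[simp] theorem reg_set_self : (σ.set v x).reg v = x := by simp [set]
@[simp] theorem reg_set_of_ne (h : v' ≠ v) : (σ.set v x).reg v' = σ.reg v' := by simp [set, h]
@[simp] theorem arr_set : (σ.set v x).arr = σ.arr := rfl
@[simp] theorem tm_set : (σ.set v x).tm = σ.tm + 1 := rfl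
@[simp] theorem reg_put : (σ.put a i x).reg = σ.reg := rfl
@[simp] theorem arr_put_self : (σ.put a i x).arr a = Function.update (σ.arr a) i x := by simp [put]
@[simp] theorem arr_put_of_ne (h : a' ≠ a) : (σ.put a i x).arr a' = σ.arr a' := by simp [put, h]
@[simp] theorem tm_put : (σ.put a i x).tm = σ.tm + 1 := rfl
@[simp] theorem reg_tick : σ.tick.reg = σ.reg := rfl
@[simp] theorem arr_tick : σ.tick.arr = σ.arr := rfl
@[simp] theorem tm_tick : σ.tick.tm = σ.tm + 1 := rfl

end Store

/-- The numerical parameters of a run: every value kept in a scalar or an array is below `X`, and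
the input and output arrays have `li` and `lo` entries. The working arrays are unbounded. -/
structure Ctx where
  X : ℕ
  li : ℕ
  lo : ℕ

/-- Expressions of the structured language. -/
inductive HE
  | lit (c : ℕ)
  | var (v : V)
  | get (a : A) (e : HE)
  | op (o : Op) (x y : HE)

namespace HE

/-- The exact, unreduced value of an operation. -/
def opVal : Op → ℕ → ℕ → ℕ
  | .add, x, y => x + y
  | .sub, x, y => x - y
  | .mul, x, y => x * y
  | .div, x, y => x / y
  | .mod, x, y => x % y
  | .and, x, y => x &&& y
  | .or, x, y => x ||| y
  | .xor, x, y => x ^^^ y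
  | .shl, x, y => x <<< y
  | .shr, x, y => x >>> y
  | .lt, x, y => if x < y then 1 else 0
  | .eq, x, y => if x = y then 1 else 0

/-- Subtractions must not be truncated; left shifts are excluded, since their results are not
polynomially bounded. -/
def opOk : Op → ℕ → ℕ → Prop
  | .sub, x, y => y ≤ x
  | .shl, _, _ => False
  | _, _, _ => True

/-- The exact value of an expression. -/
def val (σ : Store) : HE → ℕ
  | lit c => c
  | var v => σ.reg v
  | get a e => σ.arr a (e.val σ)
  | op o x y => opVal o (x.val σ) (y.val σ)

/-- An expression is safe in a state if its accesses to input and output are within bounds and its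
subtractions are not truncated. -/
def ok (c : Ctx) (σ : Store) : HE → Prop
  | lit _ => True
  | var _ => True
  | get a e => e.ok c σ ∧ (a = A.inp → e.val σ < c.li) ∧ (a = A.out → e.val σ < c.lo)
  | op o x y => x.ok c σ ∧ y.ok c σ ∧ opOk o (x.val σ) (y.val σ)

/-- A safe expression whose literals and loaded values are at most `X` has a value of at most
`X ^ size`. -/
def size : HE → ℕ
  | lit c => c + 1
  | var _ => 1
  | get _ e => e.size + 2
  | op _ x y => x.size + y.size

instance : Add HE := ⟨op .add⟩
instance : Sub HE := ⟨op .sub⟩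
instance : Mul HE := ⟨op .mul⟩
instance (c : ℕ) : OfNat HE c := ⟨lit c⟩
instance : Coe V HE := ⟨var⟩

/-- Bitwise conjunction. -/
def and' (x y : HE) : HE := op .and x y
/-- Bitwise disjunction. -/
def or' (x y : HE) : HE := op .or x y
/-- Bitwise exclusive disjunction; as a test, it says that the values differ. -/
def xor' (x y : HE) : HE := op .xor x y
/-- The test `x < y`, with value `0` or `1`. -/
def less (x y : HE) : HE := op .lt x y
/-- The test `x = y`, with value `0` or `1`. -/
def equal (x y : HE) : HE := op .eq x y

section simps
variable (σ : Store) (c : Ctx) (x y : HE)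
@[simp] theorem val_add : (x + y).val σ = x.val σ + y.val σ := rfl
@[simp] theorem val_sub : (x - y).val σ = x.val σ - y.val σ := rfl
@[simp] theorem val_mul : (x * y).val σ = x.val σ * y.val σ := rfl
@[simp] theorem val_ofNat (l : ℕ) : (no_index (OfNat.ofNat l : HE)).val σ = l := rfl
@[simp] theorem val_zero : (0 : HE).val σ = 0 := rfl
@[simp] theorem val_one : (1 : HE).val σ = 1 := rfl
@[simp] theorem val_var (v : V) : (var v).val σ = σ.reg v := rfl
@[simp] theorem val_get (a : A) : (get a x).val σ = σ.arr a (x.val σ) := rfl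
@[simp] theorem val_and : (x.and' y).val σ = x.val σ &&& y.val σ := rfl
@[simp] theorem val_or : (x.or' y).val σ = x.val σ ||| y.val σ := rfl
@[simp] theorem val_xor : (x.xor' y).val σ = x.val σ ^^^ y.val σ := rfl
@[simp] theorem val_less : (x.less y).val σ = if x.val σ < y.val σ then 1 else 0 := rfl
@[simp] theorem val_equal : (x.equal y).val σ = if x.val σ = y.val σ then 1 else 0 := rfl
@[simp] theorem ok_add : (x + y).ok c σ ↔ x.ok c σ ∧ y.ok c σ :=
  ⟨fun h => ⟨h.1, h.2.1⟩, fun h => ⟨h.1, h.2, trivial⟩⟩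
@[simp] theorem ok_sub : (x - y).ok c σ ↔ x.ok c σ ∧ y.ok c σ ∧ y.val σ ≤ x.val σ := Iff.rfl
@[simp] theorem ok_mul : (x * y).ok c σ ↔ x.ok c σ ∧ y.ok c σ :=
  ⟨fun h => ⟨h.1, h.2.1⟩, fun h => ⟨h.1, h.2, trivial⟩⟩
@[simp] theorem ok_and : (x.and' y).ok c σ ↔ x.ok c σ ∧ y.ok c σ :=
  ⟨fun h => ⟨h.1, h.2.1⟩, fun h => ⟨h.1, h.2, trivial⟩⟩
@[simp] theorem ok_or : (x.or' y).ok c σ ↔ x.ok c σ ∧ y.ok c σ :=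
  ⟨fun h => ⟨h.1, h.2.1⟩, fun h => ⟨h.1, h.2, trivial⟩⟩
@[simp] theorem ok_xor : (x.xor' y).ok c σ ↔ x.ok c σ ∧ y.ok c σ :=
  ⟨fun h => ⟨h.1, h.2.1⟩, fun h => ⟨h.1, h.2, trivial⟩⟩
@[simp] theorem ok_less : (x.less y).ok c σ ↔ x.ok c σ ∧ y.ok c σ :=
  ⟨fun h => ⟨h.1, h.2.1⟩, fun h => ⟨h.1, h.2, trivial⟩⟩
@[simp] theorem ok_equal : (x.equal y).ok c σ ↔ x.ok c σ ∧ y.ok c σ :=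
  ⟨fun h => ⟨h.1, h.2.1⟩, fun h => ⟨h.1, h.2, trivial⟩⟩
@[simp] theorem ok_ofNat (l : ℕ) : (no_index (OfNat.ofNat l : HE)).ok c σ := trivial
@[simp] theorem ok_zero : (0 : HE).ok c σ := trivial
@[simp] theorem ok_one : (1 : HE).ok c σ := trivial
@[simp] theorem ok_var (v : V) : (var v).ok c σ := trivial
@[simp] theorem ok_get (a : A) : (get a x).ok c σ ↔
    x.ok c σ ∧ (a = A.inp → x.val σ < c.li) ∧ (a = A.out → x.val σ < c.lo) := Iff.rfl
end simps

end HE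

/-- Programs of the structured language. -/
inductive HP
  | skip
  | asg (v : V) (e : HE)
  | sto (a : A) (i e : HE)
  | seq (P Q : HP)
  | ite (e : HE) (P Q : HP)
  | loop (e : HE) (P : HP)

infixr:60 " ;; " => HP.seq

/-- `for v = 0, …, h - 1 do P`, where `P` writes neither `v` nor `h`. -/
def HP.for (v h : V) (P : HP) : HP :=
  .asg v 0 ;; .loop (HE.less (v : HE) (h : HE)) (P ;; .asg v ((v : HE) + 1))

/-- Big-step semantics with exact arithmetic. Each elementary statement and each test counts one
step, and a statement is executed only if it is safe. -/
inductive HExec (c : Ctx) : HP → Store → Store → Prop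
  | skip (σ) : HExec c .skip σ σ.tick
  | asg {v e σ} (h : e.ok c σ) (hX : e.val σ < c.X) : HExec c (.asg v e) σ (σ.set v (e.val σ))
  | sto {a i e σ} (hi : i.ok c σ) (he : e.ok c σ) (hX : e.val σ < c.X) (ha : a ≠ A.inp)
      (hlo : a = A.out → i.val σ < c.lo) : HExec c (.sto a i e) σ (σ.put a (i.val σ) (e.val σ))
  | seq {P Q σ₁ σ₂ σ₃} (hP : HExec c P σ₁ σ₂) (hQ : HExec c Q σ₂ σ₃) : HExec c (.seq P Q) σ₁ σ₃
  | ite_true {e P Q σ σ'} (he : e.ok c σ) (h : e.val σ ≠ 0) (hP : HExec c P σ.tick σ') :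
      HExec c (.ite e P Q) σ σ'
  | ite_false {e P Q σ σ'} (he : e.ok c σ) (h : e.val σ = 0) (hQ : HExec c Q σ.tick σ') :
      HExec c (.ite e P Q) σ σ'
  | while_done {e P σ} (he : e.ok c σ) (h : e.val σ = 0) : HExec c (.loop e P) σ σ.tick
  | while_step {e P σ₁ σ₂ σ₃} (he : e.ok c σ₁) (h : e.val σ₁ ≠ 0) (hP : HExec c P σ₁.tick σ₂)
      (hL : HExec c (.loop e P) σ₂ σ₃) : HExec c (.loop e P) σ₁ σ₃

/-! ### Frames and total correctness -/

/-- Whether a program contains an assignment to the scalar `v`. -/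
def HP.wv (v : V) : HP → Bool
  | skip => false
  | asg v' _ => decide (v = v')
  | sto _ _ _ => false
  | seq P Q => P.wv v || Q.wv v
  | ite _ P Q => P.wv v || Q.wv v
  | loop _ P => P.wv v

/-- Whether a program contains a store to the array `a`. -/
def HP.wa (a : A) : HP → Bool
  | skip => false
  | asg _ _ => false
  | sto a' _ _ => decide (a = a')
  | seq P Q => P.wa a || Q.wa a
  | ite _ P Q => P.wa a || Q.wa a
  | loop _ P => P.wa a

/-- `σ'` differs from `σ` only where `P` writes. -/
structure Frame (P : HP) (σ σ' : Store) : Prop where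
  reg : ∀ v, P.wv v = false → σ'.reg v = σ.reg v
  arr : ∀ a, P.wa a = false → σ'.arr a = σ.arr a

theorem Frame.refl (P : HP) (σ : Store) : Frame P σ σ := ⟨fun _ _ => rfl, fun _ _ => rfl⟩

theorem Frame.trans {P : HP} {σ₁ σ₂ σ₃ : Store} (h : Frame P σ₁ σ₂) (h' : Frame P σ₂ σ₃) :
    Frame P σ₁ σ₃ :=
  ⟨fun v hv => (h'.reg v hv).trans (h.reg v hv), fun a ha => (h'.arr a ha).trans (h.arr a ha)⟩

theorem Frame.mono {P Q : HP} {σ σ' : Store} (h : Frame P σ σ')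
    (hv : ∀ v, Q.wv v = false → P.wv v = false) (ha : ∀ a, Q.wa a = false → P.wa a = false) :
    Frame Q σ σ' :=
  ⟨fun v h1 => h.reg v (hv v h1), fun a h1 => h.arr a (ha a h1)⟩

theorem HExec.frame {c : Ctx} {P : HP} {σ σ' : Store} (h : HExec c P σ σ') : Frame P σ σ' := by
  induction h with
  | skip σ => exact ⟨fun _ _ => rfl, fun _ _ => rfl⟩
  | asg h hX =>
    refine ⟨fun v hv => ?_, fun _ _ => rfl⟩
    simp only [HP.wv, decide_eq_false_iff_not] at hv
    simp [hv]
  | sto hi he hX ha hlo =>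
    refine ⟨fun _ _ => rfl, fun a ha => ?_⟩
    simp only [HP.wa, decide_eq_false_iff_not] at ha
    simp [ha]
  | seq _ _ ih1 ih2 =>
    exact (ih1.mono (by simp +contextual [HP.wv]) (by simp +contextual [HP.wa])).trans
      (ih2.mono (by simp +contextual [HP.wv]) (by simp +contextual [HP.wa]))
  | ite_true _ _ _ ih =>
    exact ⟨fun v hv => ih.reg v (by simp [HP.wv] at hv; simp [hv]),
      fun a ha => ih.arr a (by simp [HP.wa] at ha; simp [ha])⟩
  | ite_false _ _ _ ih =>
    exact ⟨fun v hv => ih.reg v (by simp [HP.wv] at hv; simp [hv]),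
      fun a ha => ih.arr a (by simp [HP.wa] at ha; simp [ha])⟩
  | while_done => exact ⟨fun _ _ => rfl, fun _ _ => rfl⟩
  | while_step _ _ _ _ ih1 ih2 =>
    exact Frame.trans ⟨fun v hv => ih1.reg v hv, fun a ha => ih1.arr a ha⟩ ih2

/-- Total correctness: from `σ`, the program `P` halts in a state satisfying `Q`. -/
def Runs (c : Ctx) (P : HP) (σ : Store) (Q : Store → Prop) : Prop :=
  ∃ σ', HExec c P σ σ' ∧ Q σ'

namespace Runs

variable {c : Ctx} {P R : HP} {σ : Store} {Q Q' : Store → Prop}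

theorem skip_iff : Runs c .skip σ Q ↔ Q σ.tick :=
  ⟨fun ⟨_, h, hq⟩ => by cases h; exact hq, fun h => ⟨_, .skip σ, h⟩⟩

theorem asg_iff {v : V} {e : HE} :
    Runs c (.asg v e) σ Q ↔ e.ok c σ ∧ e.val σ < c.X ∧ Q (σ.set v (e.val σ)) :=
  ⟨fun ⟨_, h, hq⟩ => by cases h with | asg h hX => exact ⟨h, hX, hq⟩,
    fun ⟨h, hX, hq⟩ => ⟨_, .asg h hX, hq⟩⟩

theorem sto_iff {a : A} {i e : HE} :
    Runs c (.sto a i e) σ Q ↔ (i.ok c σ ∧ e.ok c σ) ∧ a ≠ A.inp ∧ (a = A.out → i.val σ < c.lo) ∧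
      e.val σ < c.X ∧ Q (σ.put a (i.val σ) (e.val σ)) :=
  ⟨fun ⟨_, h, hq⟩ => by cases h with | sto hi he hX ha hlo => exact ⟨⟨hi, he⟩, ha, hlo, hX, hq⟩,
    fun ⟨⟨hi, he⟩, ha, hlo, hX, hq⟩ => ⟨_, .sto hi he hX ha hlo, hq⟩⟩

theorem seq_iff : Runs c (P ;; R) σ Q ↔ Runs c P σ (fun σ' => Runs c R σ' Q) :=
  ⟨fun ⟨_, h, hq⟩ => by cases h with | seq hP hQ => exact ⟨_, hP, _, hQ, hq⟩,
    fun ⟨_, hP, _, hQ, hq⟩ => ⟨_, .seq hP hQ, hq⟩⟩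

theorem ite_iff {e : HE} : Runs c (.ite e P R) σ Q ↔
    e.ok c σ ∧ (e.val σ ≠ 0 → Runs c P σ.tick Q) ∧ (e.val σ = 0 → Runs c R σ.tick Q) := by
  constructor
  · rintro ⟨_, h, hq⟩
    cases h with
    | ite_true he h hP => exact ⟨he, fun _ => ⟨_, hP, hq⟩, fun h' => absurd h' h⟩
    | ite_false he h hP => exact ⟨he, fun h' => absurd h h', fun _ => ⟨_, hP, hq⟩⟩
  · rintro ⟨he, h1, h2⟩
    by_cases h : e.val σ = 0
    · obtain ⟨_, hP, hq⟩ := h2 h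
      exact ⟨_, .ite_false he h hP, hq⟩
    · obtain ⟨_, hP, hq⟩ := h1 h
      exact ⟨_, .ite_true he h hP, hq⟩

/-- Weakening the postcondition, which may use that the other variables are unchanged. -/
theorem mono (h : Runs c P σ Q) (hQ : ∀ σ', Frame P σ σ' → Q σ' → Q' σ') : Runs c P σ Q' := by
  obtain ⟨σ', h1, h2⟩ := h
  exact ⟨σ', h1, hQ σ' h1.frame h2⟩

/-- Total correctness of a loop with an invariant indexed by a variant. -/
theorem while_rule {e : HE} (I : ℕ → Store → Prop) (b : ℕ) (h0 : I b σ)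
    (hstep : ∀ b' σ', Frame P σ σ' → I b' σ' → e.ok c σ' ∧
      ((e.val σ' ≠ 0 ∧ Runs c P σ'.tick (fun σ'' => ∃ b'' < b', I b'' σ'')) ∨
        (e.val σ' = 0 ∧ Q σ'.tick))) : Runs c (.loop e P) σ Q := by
  suffices H : ∀ b' σ', Frame P σ σ' → I b' σ' → Runs c (.loop e P) σ' Q from
    H b σ (Frame.refl _ _) h0
  intro b'
  induction b' using Nat.strong_induction_on with
  | _ b' ih =>
    intro σ' hF hI
    obtain ⟨hok, ⟨h1, σ'', hE, b'', hb, hI'⟩ | ⟨h1, h2⟩⟩ := hstep b' σ' hF hI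
    · have hF' : Frame P σ σ'' := hF.trans ⟨hE.frame.reg, hE.frame.arr⟩
      obtain ⟨σ3, hE3, hQ⟩ := ih b'' hb σ'' hF' hI'
      exact ⟨σ3, .while_step hok h1 hE hE3, hQ⟩
    · exact ⟨_, .while_done hok h1, h2⟩

/-- Total correctness of a counting loop with an invariant indexed by the counter. -/
theorem for_rule {v h : V} (hv : P.wv v = false) (hh : P.wv h = false) (hne : h ≠ v) (N : ℕ)
    (hN : σ.reg h = N) (hX : N < c.X) (I : ℕ → Store → Prop) (h0 : I 0 (σ.set v 0))
    (hb : ∀ i σ', i < N → Frame (.for v h P) σ σ' → σ'.reg v = i → I i σ' →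
      Runs c P σ'.tick (fun σ'' => I (i + 1) (σ''.set v (i + 1))))
    (hQ : ∀ σ', Frame (.for v h P) σ σ' → σ'.reg v = N → I N σ' → Q σ'.tick) :
    Runs c (.for v h P) σ Q := by
  unfold HP.for
  rw [seq_iff, asg_iff]
  refine ⟨HE.ok_zero _ _, by simp; omega, ?_⟩
  have hF0 : Frame (.for v h P) σ (σ.set v 0) := by
    refine ⟨fun v' hv' => ?_, fun _ _ => rfl⟩
    simp only [HP.for, HP.wv, Bool.or_eq_false_iff, decide_eq_false_iff_not] at hv'
    simp [hv'.1]
  refine while_rule (fun b' σ' => ∃ i, i + b' = N ∧ σ'.reg v = i ∧ I i σ') N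
    ⟨0, by omega, by simp, h0⟩ ?_
  rintro b' σ' hF ⟨i, hi, hr, hI⟩
  have hF' : Frame (.for v h P) σ σ' :=
    hF0.trans (hF.mono (by simp +contextual [HP.for, HP.wv])
      (by simp +contextual [HP.for, HP.wa]))
  have hhN : σ'.reg h = N := by
    rw [← hN]; apply hF'.reg; simp [HP.for, HP.wv, hh, hne]
  refine ⟨by simp, ?_⟩
  rcases Nat.lt_or_ge i N with hlt | hge
  · left
    refine ⟨by simp [hr, hhN, hlt], ?_⟩
    rw [seq_iff]
    refine (hb i σ' hlt hF' hr hI).mono fun σ'' hF2 hI2 => ?_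
    have : σ''.reg v = i := by rw [hF2.reg v hv]; simpa using hr
    rw [asg_iff]
    refine ⟨by simp, by simp [this]; omega, b' - 1, by omega, i + 1, by omega, ?_, ?_⟩
    · simp [this]
    · simpa [this] using hI2
  · right
    have : i = N := by omega
    subst this
    exact ⟨by simp [hr, hhN], hQ σ' hF' hr hI⟩

end Runs

/-! ### Simulation on the word RAM -/

/-- The address of entry `e` of an array. The input is at the start of the memory, the output
starts at the address in register `0`, and the working arrays are interleaved with stride `32` from
the address in register `1` on. -/
def addr : A → Expr → Expr
  | .inp, e => e
  | .out, e => .op .add (.reg 0) e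
  | a, e => .op .add (.reg 1) (.op .add (.op .mul (.lit 32) e) (.lit a.ctorIdx))

/-- The compilation of expressions. Registers `0` and `1` are reserved for addresses. -/
def HE.comp : HE → Expr
  | lit c => .lit c
  | var v => .reg (v.ctorIdx + 2)
  | get a e => .load (addr a e.comp)
  | op o x y => .op o x.comp y.comp

/-- The compilation of programs. -/
def HP.comp : HP → Prog
  | skip => .skip
  | asg v e => .assign (v.ctorIdx + 2) e.comp
  | sto a i e => .store (addr a i.comp) e.comp
  | seq P Q => .seq P.comp Q.comp
  | ite e P Q => .cond e.comp P.comp Q.comp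
  | loop e P => .loop e.comp P.comp

/-- A bound on the sizes of all expressions of a program. -/
def HP.size : HP → ℕ
  | skip => 0
  | asg _ e => e.size
  | sto _ i e => i.size + 2 + e.size
  | seq P Q => P.size + Q.size
  | ite e P Q => e.size + P.size + Q.size
  | loop e P => e.size + P.size

/-- A bound on the number of machine steps of each elementary step of a program. -/
def HP.cost : HP → ℕ
  | skip => 1
  | asg _ e => e.comp.cost + 1
  | sto a i e => (addr a i.comp).cost + e.comp.cost + 1
  | seq P Q => P.cost + Q.cost
  | ite e P Q => e.comp.cost + 1 + P.cost + Q.cost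
  | loop e P => e.comp.cost + 1 + P.cost

/-- The machine state `s` represents `σ`, with output at `O` and working arrays from `B` on. -/
structure Rep (c : Ctx) (O B : ℕ) (σ : Store) (s : State) : Prop where
  reg0 : s.reg 0 = O
  reg1 : s.reg 1 = B
  reg : ∀ v : V, s.reg (v.ctorIdx + 2) = σ.reg v
  inp : ∀ i < c.li, s.mem i = σ.arr .inp i
  out : ∀ i < c.lo, s.mem (O + i) = σ.arr .out i
  arr : ∀ a : A, a ≠ .inp → a ≠ .out → ∀ i, s.mem (B + (32 * i + a.ctorIdx)) = σ.arr a i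
  reg_lt : ∀ v, σ.reg v < c.X
  arr_lt : ∀ a i, σ.arr a i < c.X

/-- The layout is admissible: input, output and working arrays do not overlap. -/
structure Layout (c : Ctx) (O B : ℕ) : Prop where
  hX : 64 ≤ c.X
  hO : c.li ≤ O
  hB : O + c.lo ≤ B
  hBX : B < c.X

theorem V.ctorIdx_inj {v v' : V} (h : v.ctorIdx = v'.ctorIdx) : v = v' := by
  rw [← V.ofNat_ctorIdx v, h, V.ofNat_ctorIdx]

theorem A.ctorIdx_inj {v v' : A} (h : v.ctorIdx = v'.ctorIdx) : v = v' := by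
  rw [← A.ofNat_ctorIdx v, h, A.ofNat_ctorIdx]

theorem A.ctorIdx_lt (a : A) : a.ctorIdx < 32 := by
  cases a <;> simp [A.ctorIdx]

theorem addr_eval_working {a : A} (h1 : a ≠ .inp) (h2 : a ≠ .out) (e : Expr) :
    addr a e = .op .add (.reg 1) (.op .add (.op .mul (.lit 32) e) (.lit a.ctorIdx)) := by
  cases a <;> first | rfl | contradiction

theorem or_le_add (a b : ℕ) : a ||| b ≤ a + b := by
  induction a using Nat.binaryRec' generalizing b with
  | zero => simp
  | bit x a _ ih =>
    induction b using Nat.binaryRec' with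
    | zero => simp
    | bit y b _ _ =>
      rw [Nat.lor_bit, Nat.bit_val, Nat.bit_val, Nat.bit_val]
      have := ih b
      cases x <;> cases y <;> simp <;> omega

theorem xor_le_add (a b : ℕ) : a ^^^ b ≤ a + b := by
  induction a using Nat.binaryRec' generalizing b with
  | zero => simp
  | bit x a _ ih =>
    induction b using Nat.binaryRec' with
    | zero => simp
    | bit y b _ _ =>
      rw [Nat.xor_bit, Nat.bit_val, Nat.bit_val, Nat.bit_val]
      have := ih b
      cases x <;> cases y <;> simp <;> omega

theorem HE.size_pos (e : HE) : 1 ≤ e.size := by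
  induction e <;> (simp [size]; try omega)

/-- The size of an expression bounds all intermediate values, so no word overflows. -/
theorem HE.val_le {c : Ctx} {O B : ℕ} {σ : Store} {s : State} (hL : Layout c O B)
    (hR : Rep c O B σ s) : ∀ e : HE, e.ok c σ → e.val σ ≤ c.X ^ e.size
  | lit l, _ => by
    have h1 : l ≤ 2 ^ l := Nat.lt_two_pow_self.le
    have h2 : 2 ^ l ≤ c.X ^ l := Nat.pow_le_pow_left (by have := hL.hX; omega) _
    exact h1.trans (h2.trans (Nat.pow_le_pow_right (by have := hL.hX; omega) (by simp [size])))
  | var v, _ => by simpa [val, size] using (hR.reg_lt v).le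
  | get a e, _ =>
    (hR.arr_lt a (e.val σ)).le.trans (Nat.le_self_pow (by simp [size]) _)
  | op o x y, h => by
    obtain ⟨hx, hy, ho⟩ := h
    have h1 := HE.val_le hL hR x hx
    have h2 := HE.val_le hL hR y hy
    have hX := hL.hX
    have p1 : 2 ≤ c.X ^ x.size :=
      le_trans (by omega) (Nat.le_self_pow (by have := x.size_pos; omega) c.X)
    have p2 : 2 ≤ c.X ^ y.size :=
      le_trans (by omega) (Nat.le_self_pow (by have := y.size_pos; omega) c.X)
    simp only [val, size, pow_add]
    set a := x.val σ
    set b := y.val σ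
    set P := c.X ^ x.size
    set R := c.X ^ y.size
    have hsum : P + R ≤ P * R := by nlinarith
    have hP : P ≤ P * R := Nat.le_mul_of_pos_right _ (by omega)
    cases o with
    | add => exact (Nat.add_le_add h1 h2).trans hsum
    | sub => exact (Nat.sub_le _ _).trans (h1.trans hP)
    | mul => exact Nat.mul_le_mul h1 h2
    | div => exact (Nat.div_le_self _ _).trans (h1.trans hP)
    | mod => exact (Nat.mod_le _ _).trans (h1.trans hP)
    | and => exact Nat.and_le_left.trans (h1.trans hP)
    | or =>
      refine le_trans ?_ ((Nat.add_le_add h1 h2).trans hsum)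
      exact or_le_add a b
    | xor =>
      refine le_trans ?_ ((Nat.add_le_add h1 h2).trans hsum)
      exact xor_le_add a b
    | shl => exact absurd ho (by simp [opOk])
    | shr => exact (Nat.shiftRight_le _ _).trans (h1.trans hP)
    | lt => simp only [opVal]; split <;> omega
    | eq => simp only [opVal]; split <;> omega

/-- On operands whose exact result is a word, the machine operation is exact; the wrapped
subtraction is, too, if it is not truncated. -/
theorem opApply_eq {w : ℕ} {o : Op} {x y : ℕ} (hy : y < 2 ^ w) (ho : HE.opOk o x y)
    (h : HE.opVal o x y < 2 ^ w) : o.apply w x y = HE.opVal o x y := by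
  cases o <;> simp only [Op.apply, HE.opVal, HE.opOk] at * <;> try exact Nat.mod_eq_of_lt h
  rw [show x + (2 ^ w - y) = (x - y) + 2 ^ w by omega, Nat.add_mod_right, Nat.mod_eq_of_lt h]

section sim

variable {c : Ctx} {O B w : ℕ} {σ : Store} {s : State}

theorem Rep.addr_eval (hL : Layout c O B) (hR : Rep c O B σ s) {a : A} {e : HE}
    (he : e.comp.eval w s = e.val σ) (hok : e.ok c σ) (hw : c.X ^ (e.size + 2) < 2 ^ w) :
    (addr a e.comp).eval w s = match (generalizing := false) a with
      | .inp => e.val σ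
      | .out => O + e.val σ
      | a => B + (32 * e.val σ + a.ctorIdx) := by
  have hX := hL.hX
  have hle := HE.val_le hL hR e hok
  have hp : 1 ≤ c.X ^ e.size := Nat.one_le_pow _ _ (by omega)
  have hBX := hL.hBX
  have hlt := a.ctorIdx_lt
  have key : B + (32 * e.val σ + 32) < 2 ^ w := by
    refine lt_of_le_of_lt ?_ hw
    have h1 : c.X * c.X ≤ c.X * c.X * c.X ^ e.size := Nat.le_mul_of_pos_right _ hp
    have h2 : 64 * 64 * c.X ^ e.size ≤ c.X * c.X * c.X ^ e.size :=
      Nat.mul_le_mul_right _ (Nat.mul_le_mul hX hX)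
    have h3 : c.X ^ (e.size + 2) = c.X * c.X * c.X ^ e.size := by ring
    have h4 : 64 * c.X ≤ c.X * c.X := Nat.mul_le_mul_right _ hX
    omega
  have hB := hL.hB
  by_cases h1 : a = .inp
  · subst h1; exact he
  by_cases h2 : a = .out
  · subst h2
    simp only [addr, Expr.eval, hR.reg0, he, Op.apply]
    exact Nat.mod_eq_of_lt (by omega)
  · rw [addr_eval_working h1 h2]
    simp only [Expr.eval, hR.reg1, he, Op.apply]
    rw [Nat.mod_eq_of_lt (a := 32) (by omega), Nat.mod_eq_of_lt (a := 32 * _) (by omega),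
      Nat.mod_eq_of_lt (a := a.ctorIdx) (by omega), Nat.mod_eq_of_lt (a := 32 * _ + _) (by omega),
      Nat.mod_eq_of_lt (by omega)]

theorem Rep.eval (hL : Layout c O B) (hR : Rep c O B σ s) :
    ∀ e : HE, e.ok c σ → c.X ^ e.size < 2 ^ w → e.comp.eval w s = e.val σ
  | .lit l, h, hw => by
    have := HE.val_le hL hR (.lit l) h
    simp only [HE.comp, HE.val, Expr.eval] at *
    exact Nat.mod_eq_of_lt (by omega)
  | .var v, _, _ => hR.reg v
  | .get a e, h, hw => by
    obtain ⟨hok, hi, ho⟩ := h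
    have hX := hL.hX
    have hw' : c.X ^ (e.size + 2) < 2 ^ w := hw
    have ih := Rep.eval hL hR e hok
      (lt_of_le_of_lt (Nat.pow_le_pow_right (by omega) (by omega)) hw')
    have := Rep.addr_eval hL hR (a := a) ih hok hw'
    simp only [HE.comp, HE.val, Expr.eval, this]
    by_cases h1 : a = .inp
    · subst h1; exact hR.inp _ (hi rfl)
    by_cases h2 : a = .out
    · subst h2; exact hR.out _ (ho rfl)
    · rw [← hR.arr a h1 h2]
      cases a <;> first | rfl | contradiction
  | .op o x y, h, hw => by
    have hv := HE.val_le hL hR (.op o x y) h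
    obtain ⟨hx, hy, ho⟩ := h
    have hX := hL.hX
    have h1 := lt_of_le_of_lt (Nat.pow_le_pow_right (by omega : 0 < c.X)
      (show y.size ≤ (HE.op o x y).size by simp [HE.size])) hw
    have ihx := Rep.eval hL hR x hx (lt_of_le_of_lt (Nat.pow_le_pow_right (by omega)
      (by simp [HE.size])) hw)
    have ihy := Rep.eval hL hR y hy h1
    simp only [HE.comp, Expr.eval, ihx, ihy]
    exact opApply_eq ((HE.val_le hL hR y hy).trans_lt h1) ho (hv.trans_lt hw)

/-- A run of a structured program is simulated by the compiled program; the number of machine steps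
is at most `K` times the number of structured steps. -/
theorem HExec.sim {K : ℕ} {P : HP} {σ' : Store} (hL : Layout c O B) (h : HExec c P σ σ') :
    ∀ s, Rep c O B σ s → P.cost ≤ K → c.X ^ P.size < 2 ^ w →
      ∃ s' t, Exec w P.comp s s' t ∧ Rep c O B σ' s' ∧ t + K * σ.tm ≤ K * σ'.tm := by
  have hX := hL.hX
  have mono : ∀ {a b : ℕ}, a ≤ b → c.X ^ b < 2 ^ w → c.X ^ a < 2 ^ w := fun hab h =>
    lt_of_le_of_lt (Nat.pow_le_pow_right (by omega) hab) h
  induction h with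
  | skip σ =>
    intro s hR hK hw
    refine ⟨s, 1, .skip s, ⟨hR.1, hR.2, hR.3, hR.4, hR.5, hR.6, hR.7, hR.8⟩, ?_⟩
    simp only [HP.cost] at hK
    simp only [Store.tm_tick, mul_add]; omega
  | @asg v e σ h hv =>
    intro s hR hK hw
    refine ⟨_, _, .assign _ _ _, ⟨?_, ?_, ?_, hR.inp, hR.out, hR.arr, ?_, hR.arr_lt⟩, ?_⟩
    · simp [Function.update, hR.reg0]
    · simp [Function.update, hR.reg1]
    · intro v'
      rw [Rep.eval hL hR e h hw]
      by_cases hvv : v' = v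
      · subst hvv; simp
      · have : v'.ctorIdx ≠ v.ctorIdx := fun h => hvv (V.ctorIdx_inj h)
        simp [Function.update, this, hvv, hR.reg]
    · intro v'
      by_cases hvv : v' = v
      · subst hvv; simpa using hv
      · simpa [hvv] using hR.reg_lt v'
    · simp only [HP.cost] at hK
      simp only [Store.tm_set, mul_add]; omega
  | @sto a i e σ hi he hv ha hlo =>
    intro s hR hK hw
    have hw1 : c.X ^ (i.size + 2) < 2 ^ w := mono (by simp [HP.size]) hw
    have ei := Rep.eval hL hR i hi (mono (by omega) hw1)
    have ee := Rep.eval hL hR e he (mono (by simp [HP.size]) hw)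
    have ea := Rep.addr_eval hL hR (a := a) ei hi hw1
    have hO := hL.hO
    have hB := hL.hB
    refine ⟨_, _, .store _ _ _, ⟨hR.reg0, hR.reg1, hR.reg, ?_, ?_, ?_, hR.reg_lt, ?_⟩, ?_⟩
    · intro j hj
      rw [Store.arr_put_of_ne _ _ _ _ _ (Ne.symm ha), ← hR.inp j hj]
      simp only
      rw [Function.update_of_ne]
      rw [ea]
      split
      · contradiction
      · omega
      · omega
    · intro j hj
      by_cases h2 : a = .out
      · subst h2
        simp only [ea, ee, Store.arr_put_self]
        by_cases hji : j = i.val σ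
        · subst hji; simp
        · rw [Function.update_of_ne (by omega), Function.update_of_ne hji, hR.out j hj]
      · rw [Store.arr_put_of_ne _ _ _ _ _ (Ne.symm h2), ← hR.out j hj]
        simp only
        rw [Function.update_of_ne]
        rw [ea]
        split
        · contradiction
        · contradiction
        · omega
    · intro a' h1' h2' j
      have hlt := a.ctorIdx_lt
      have hlt' := a'.ctorIdx_lt
      by_cases h2 : a = .out
      · subst h2
        rw [Store.arr_put_of_ne _ _ _ _ _ h2', ← hR.arr a' h1' h2']
        simp only [ea]
        have := hlo rfl
        rw [Function.update_of_ne (by omega)]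
      · have ea' : (addr a i.comp).eval w s = B + (32 * i.val σ + a.ctorIdx) := by
          rw [ea]; cases a <;> first | rfl | contradiction
        simp only [ea', ee]
        by_cases haa : a' = a
        · subst haa
          rw [Store.arr_put_self]
          by_cases hji : j = i.val σ
          · subst hji; simp
          · rw [Function.update_of_ne (by omega), Function.update_of_ne hji, hR.arr a' h1' h2']
        · have : a'.ctorIdx ≠ a.ctorIdx := fun h => haa (A.ctorIdx_inj h)
          rw [Function.update_of_ne (by omega), Store.arr_put_of_ne _ _ _ _ _ haa,
            hR.arr a' h1' h2']
    · intro a' j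
      by_cases haa : a' = a
      · subst haa
        rw [Store.arr_put_self]
        by_cases hji : j = i.val σ
        · subst hji; simpa using hv
        · rw [Function.update_of_ne hji]; exact hR.arr_lt _ _
      · rw [Store.arr_put_of_ne _ _ _ _ _ haa]; exact hR.arr_lt _ _
    · simp only [HP.cost] at hK
      simp only [Store.tm_put, mul_add]; omega
  | seq _ _ ih1 ih2 =>
    intro s hR hK hw
    simp only [HP.cost, HP.size] at hK hw
    obtain ⟨s1, t1, e1, r1, l1⟩ := ih1 s hR (by omega) (mono (by omega) hw)
    obtain ⟨s2, t2, e2, r2, l2⟩ := ih2 s1 r1 (by omega) (mono (by omega) hw)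
    exact ⟨s2, _, .seq e1 e2, r2, by omega⟩
  | ite_true he h _ ih =>
    intro s hR hK hw
    simp only [HP.cost, HP.size] at hK hw
    have ee := Rep.eval hL hR _ he (mono (by omega) hw)
    obtain ⟨s1, t1, e1, r1, l1⟩ := ih s ⟨hR.1, hR.2, hR.3, hR.4, hR.5, hR.6, hR.7, hR.8⟩
      (by omega) (mono (by omega) hw)
    refine ⟨s1, _, .cond_true (by rw [ee]; exact h) e1, r1, ?_⟩
    simp only [Store.tm_tick, mul_add] at l1; omega
  | ite_false he h _ ih =>
    intro s hR hK hw
    simp only [HP.cost, HP.size] at hK hw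
    have ee := Rep.eval hL hR _ he (mono (by omega) hw)
    obtain ⟨s1, t1, e1, r1, l1⟩ := ih s ⟨hR.1, hR.2, hR.3, hR.4, hR.5, hR.6, hR.7, hR.8⟩
      (by omega) (mono (by omega) hw)
    refine ⟨s1, _, .cond_false (by rw [ee]; exact h) e1, r1, ?_⟩
    simp only [Store.tm_tick, mul_add] at l1; omega
  | while_done he h =>
    intro s hR hK hw
    simp only [HP.cost, HP.size] at hK hw
    have ee := Rep.eval hL hR _ he (mono (by omega) hw)
    refine ⟨s, _, .loop_done (by rw [ee]; exact h),
      ⟨hR.1, hR.2, hR.3, hR.4, hR.5, hR.6, hR.7, hR.8⟩, ?_⟩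
    simp only [Store.tm_tick, mul_add]; omega
  | while_step he h _ _ ih1 ih2 =>
    intro s hR hK hw
    have hK0 := hK
    have hw0 := hw
    simp only [HP.cost, HP.size] at hK hw
    have ee := Rep.eval hL hR _ he (mono (by omega) hw)
    obtain ⟨s1, t1, e1, r1, l1⟩ := ih1 s ⟨hR.1, hR.2, hR.3, hR.4, hR.5, hR.6, hR.7, hR.8⟩
      (by omega) (mono (by omega) hw)
    obtain ⟨s2, t2, e2, r2, l2⟩ := ih2 s1 r1 hK0 hw0
    refine ⟨s2, _, .loop_step (by rw [ee]; exact h) e1 e2, r2, ?_⟩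
    simp only [Store.tm_tick, mul_add] at l1; omega

end sim


/-! ### Stripping leaves off a tree -/

section strip

variable (e1 e2 : ℕ → ℕ)

/-- The number of ends at `v` of the edges with index in `J`. -/
def incid (J : Finset ℕ) (v : ℕ) : ℕ :=
  ∑ j ∈ J, ((if e1 j = v then 1 else 0) + (if e2 j = v then 1 else 0))

/-- The sum of the indices in `J` of the edges at `v`, which is the index of the only edge if there
is only one. -/
def incidSum (J : Finset ℕ) (v : ℕ) : ℕ :=
  ∑ j ∈ J, ((if e1 j = v then j else 0) + (if e2 j = v then j else 0))

/-- The edges with index in `J` form a tree on the vertex set `R`: there is one edge less than there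
are vertices, and every cut is crossed by an edge. -/
structure Strip (R J : Finset ℕ) : Prop where
  card : R.card = J.card + 1
  ends : ∀ j ∈ J, e1 j ∈ R ∧ e2 j ∈ R
  cut : ∀ S ⊆ R, S.Nonempty → S ≠ R →
    ∃ j ∈ J, (e1 j ∈ S ∧ e2 j ∉ S) ∨ (e2 j ∈ S ∧ e1 j ∉ S)

variable {e1 e2} {R J : Finset ℕ}

theorem sum_incid (h : ∀ j ∈ J, e1 j ∈ R ∧ e2 j ∈ R) : ∑ v ∈ R, incid e1 e2 J v = 2 * J.card := by
  unfold incid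
  rw [Finset.sum_comm]
  rw [Finset.sum_congr rfl (g := fun _ => 2)]
  · simp [mul_comm]
  · intro j hj
    rw [Finset.sum_add_distrib]
    simp [h j hj]

namespace Strip

theorem one_le_incid (h : Strip e1 e2 R J) (hR : 2 ≤ R.card) {v : ℕ} (hv : v ∈ R) :
    1 ≤ incid e1 e2 J v := by
  obtain ⟨j, hj, hc⟩ := h.cut {v} (by simpa) (by simp) (by rintro rfl; simp at hR)
  simp only [Finset.mem_singleton] at hc
  refine le_trans ?_ (Finset.single_le_sum (f := fun j => (if e1 j = v then 1 else 0) +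
    (if e2 j = v then 1 else 0)) (fun _ _ => Nat.zero_le _) hj)
  rcases hc with ⟨h1, _⟩ | ⟨h1, _⟩ <;> simp [h1]

/-- A tree with at least two vertices has a leaf, since its degrees sum up to less than twice the
number of vertices. -/
theorem exists_leaf (h : Strip e1 e2 R J) (hR : 2 ≤ R.card) : ∃ v ∈ R, incid e1 e2 J v = 1 := by
  by_contra! hne
  have h1 : ∀ v ∈ R, 2 ≤ incid e1 e2 J v := fun v hv => by
    have := h.one_le_incid hR hv
    have := hne v hv
    omega
  have h2 := Finset.card_nsmul_le_sum R _ 2 h1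
  rw [sum_incid h.ends, smul_eq_mul, h.card] at h2
  omega

/-- A leaf has exactly one edge, and the index of this edge is the sum of the indices of the edges
at the leaf. -/
theorem leaf_edge {v : ℕ} (hv : incid e1 e2 J v = 1) :
    ∃ j ∈ J, incidSum e1 e2 J v = j ∧ ∃ u, u ≠ v ∧
      ((e1 j = v ∧ e2 j = u) ∨ (e2 j = v ∧ e1 j = u)) ∧
      ∀ j' ∈ J, j' ≠ j → e1 j' ≠ v ∧ e2 j' ≠ v := by
  have hex : ∃ j ∈ J, e1 j = v ∨ e2 j = v := by
    by_contra! hne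
    have : incid e1 e2 J v = 0 := Finset.sum_eq_zero fun j hj => by simp [hne j hj]
    omega
  obtain ⟨j, hj, hjv⟩ := hex
  have hsum : incid e1 e2 (J.erase j) v + ((if e1 j = v then 1 else 0) +
      (if e2 j = v then 1 else 0)) = 1 := by
    exact (Finset.sum_erase_add J (fun j => (if e1 j = v then 1 else 0) +
      (if e2 j = v then 1 else 0)) hj).trans hv
  have hz : incid e1 e2 (J.erase j) v = 0 := by
    rcases hjv with h | h <;> simp only [h, if_true] at hsum <;> omega
  have hoth : ∀ j' ∈ J, j' ≠ j → e1 j' ≠ v ∧ e2 j' ≠ v := by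
    intro j' hj' hne
    have hz' := hz
    rw [incid, Finset.sum_eq_zero_iff] at hz'
    have := hz' j' (Finset.mem_erase.2 ⟨hne, hj'⟩)
    constructor <;> intro hh <;> simp [hh] at this
  rw [hz] at hsum
  have hS : incidSum e1 e2 J v = (if e1 j = v then j else 0) + (if e2 j = v then j else 0) := by
    unfold incidSum
    rw [Finset.sum_eq_single_of_mem j hj]
    intro j' hj' hne
    simp [hoth j' hj' hne]
  refine ⟨j, hj, ?_, ?_⟩
  · rw [hS]
    rcases hjv with h | h
    · have : e2 j ≠ v := by intro h'; simp [h, h'] at hsum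
      simp [h, this]
    · have : e1 j ≠ v := by intro h'; simp [h, h'] at hsum
      simp [h, this]
  · rcases hjv with h | h
    · have : e2 j ≠ v := by intro h'; simp [h, h'] at hsum
      exact ⟨e2 j, this, Or.inl ⟨h, rfl⟩, hoth⟩
    · have : e1 j ≠ v := by intro h'; simp [h, h'] at hsum
      exact ⟨e1 j, this, Or.inr ⟨h, rfl⟩, hoth⟩

/-- Removing a leaf leaves a tree: a cut of the smaller tree extends to the larger one so that the
leaf is on the same side as its neighbour. -/
theorem erase (h : Strip e1 e2 R J) {v u j : ℕ} (hv : v ∈ R) (hj : j ∈ J)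
    (hju : (e1 j = v ∧ e2 j = u) ∨ (e2 j = v ∧ e1 j = u))
    (hoth : ∀ j' ∈ J, j' ≠ j → e1 j' ≠ v ∧ e2 j' ≠ v) :
    Strip e1 e2 (R.erase v) (J.erase j) where
  card := by
    rw [Finset.card_erase_of_mem hv, Finset.card_erase_of_mem hj, h.card]
    have := Finset.card_pos.2 ⟨j, hj⟩
    omega
  ends := fun j' hj' => by
    obtain ⟨hne, hj'⟩ := Finset.mem_erase.1 hj'
    have := h.ends j' hj'
    have := hoth j' hj' hne
    simp_all
  cut := fun S hS hSn hSR => by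
    by_cases hu : u ∈ S
    · obtain ⟨j', hj', hc⟩ := h.cut (insert v S)
        (Finset.insert_subset hv (hS.trans (Finset.erase_subset _ _))) (by simp) (by
          intro heq
          apply hSR
          rw [← heq, Finset.erase_insert]
          exact fun hvS => (Finset.mem_erase.1 (hS hvS)).1 rfl)
      have hne : j' ≠ j := by
        rintro rfl
        rcases hju with ⟨ha, hb⟩ | ⟨ha, hb⟩ <;> rcases hc with ⟨hc, hd⟩ | ⟨hc, hd⟩ <;>
          simp_all
      have := hoth j' hj' hne
      refine ⟨j', Finset.mem_erase.2 ⟨hne, hj'⟩, ?_⟩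
      simpa [this.1, this.2] using hc
    · obtain ⟨j', hj', hc⟩ := h.cut S (hS.trans (Finset.erase_subset _ _)) hSn (by
        rintro rfl
        exact (Finset.mem_erase.1 (hS hv)).1 rfl)
      have hvS : v ∉ S := fun hvS => (Finset.mem_erase.1 (hS hvS)).1 rfl
      refine ⟨j', Finset.mem_erase.2 ⟨?_, hj'⟩, hc⟩
      rintro rfl
      rcases hju with ⟨ha, hb⟩ | ⟨ha, hb⟩ <;> rcases hc with ⟨hc, hd⟩ | ⟨hc, hd⟩ <;>
          simp_all

theorem mem_of_leaf_edge (h : Strip e1 e2 R J) {v u j : ℕ} (hj : j ∈ J)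
    (hju : (e1 j = v ∧ e2 j = u) ∨ (e2 j = v ∧ e1 j = u)) : u ∈ R := by
  have := h.ends j hj
  rcases hju with ⟨_, rfl⟩ | ⟨_, rfl⟩ <;> simp_all

end Strip

theorem incid_erase {v u j : ℕ} (hj : j ∈ J) (huv : u ≠ v)
    (hju : (e1 j = v ∧ e2 j = u) ∨ (e2 j = v ∧ e1 j = u)) (x : ℕ) (hx : x ≠ v) :
    incid e1 e2 (J.erase j) x = if x = u then incid e1 e2 J u - 1 else incid e1 e2 J x := by
  have := Finset.sum_erase_add J (fun j => (if e1 j = x then 1 else 0) +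
    (if e2 j = x then 1 else 0)) hj
  unfold incid
  split_ifs with hxu
  · subst hxu
    rcases hju with ⟨ha, hb⟩ | ⟨ha, hb⟩ <;>
      simp only [ha, hb, Ne.symm hx, if_true, if_false] at this <;> omega
  · rcases hju with ⟨ha, hb⟩ | ⟨ha, hb⟩ <;>
      simp only [ha, hb, Ne.symm hx, Ne.symm hxu, if_false] at this <;> omega

theorem incidSum_erase {v u j : ℕ} (hj : j ∈ J) (huv : u ≠ v)
    (hju : (e1 j = v ∧ e2 j = u) ∨ (e2 j = v ∧ e1 j = u)) (x : ℕ) (hx : x ≠ v) :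
    incidSum e1 e2 (J.erase j) x =
      if x = u then incidSum e1 e2 J u - j else incidSum e1 e2 J x := by
  have := Finset.sum_erase_add J (fun j => (if e1 j = x then j else 0) +
    (if e2 j = x then j else 0)) hj
  unfold incidSum
  split_ifs with hxu
  · subst hxu
    rcases hju with ⟨ha, hb⟩ | ⟨ha, hb⟩ <;>
      simp only [ha, hb, Ne.symm hx, if_true, if_false] at this <;> omega
  · rcases hju with ⟨ha, hb⟩ | ⟨ha, hb⟩ <;>
      simp only [ha, hb, Ne.symm hx, Ne.symm hxu, if_false] at this <;> omega

theorem le_incidSum {u v j : ℕ} (hj : j ∈ J)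
    (hju : (e1 j = v ∧ e2 j = u) ∨ (e2 j = v ∧ e1 j = u)) : j ≤ incidSum e1 e2 J u := by
  refine le_trans ?_ (Finset.single_le_sum (f := fun j => (if e1 j = u then j else 0) +
    (if e2 j = u then j else 0)) (fun _ _ => Nat.zero_le _) hj)
  rcases hju with ⟨_, h⟩ | ⟨_, h⟩ <;> simp [h]

theorem one_le_incid {u v j : ℕ} (hj : j ∈ J)
    (hju : (e1 j = v ∧ e2 j = u) ∨ (e2 j = v ∧ e1 j = u)) : 1 ≤ incid e1 e2 J u := by
  refine le_trans ?_ (Finset.single_le_sum (f := fun j => (if e1 j = u then 1 else 0) +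
    (if e2 j = u then 1 else 0)) (fun _ _ => Nat.zero_le _) hj)
  rcases hju with ⟨_, h⟩ | ⟨_, h⟩ <;> simp [h]

end strip

section peel

variable (n : ℕ) (e1 e2 : ℕ → ℕ)

/-- The vertices left after the removal of `q 0, …, q (i - 1)`. -/
def restV (q : ℕ → ℕ) (i : ℕ) : Finset ℕ := Finset.range n \ (Finset.range i).image q

/-- The edges left after the removal of the edges `eid 0, …, eid (i - 1)`. -/
def restE (eid : ℕ → ℕ) (i : ℕ) : Finset ℕ := Finset.range (n - 1) \ (Finset.range i).image eid

/-- The invariant of the removal of leaves in the order of the queue `q`, of length `qt`, after `i`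
removals. The `t`-th removed vertex is `q t`, its edge at the time of removal is `eid t`, and the
other endpoint of this edge is `pv t`. The vertex `u` is any vertex that is left. -/
structure Peel (i : ℕ) (q pos eid pv deg es : ℕ → ℕ) (qt u : ℕ) : Prop where
  le : i ≤ qt
  q_lt : ∀ t < qt, q t < n
  q_inj : ∀ s < qt, ∀ t < qt, q s = q t → s = t
  pos_q : ∀ t < i, pos (q t) = t
  eid_lt : ∀ t < i, eid t < n - 1
  eid_inj : ∀ s < i, ∀ t < i, eid s = eid t → s = t
  edge : ∀ t < i, (e1 (eid t) = q t ∧ e2 (eid t) = pv t) ∨ (e2 (eid t) = q t ∧ e1 (eid t) = pv t)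
  pv_lt : ∀ t < i, pv t < n
  pv_ne : ∀ t < i, ∀ s ≤ t, pv t ≠ q s
  strip : Strip e1 e2 (restV n q i) (restE n eid i)
  deg_eq : ∀ v ∈ restV n q i, deg v = incid e1 e2 (restE n eid i) v
  es_eq : ∀ v ∈ restV n q i, es v = incidSum e1 e2 (restE n eid i) v
  leaf : ∀ v ∈ restV n q i, deg v = 1 → ∃ t, i ≤ t ∧ t < qt ∧ q t = v
  queue : ∀ t, i ≤ t → t < qt → deg (q t) ≤ 1
  u_mem : u ∈ restV n q i

variable {n e1 e2} {i qt u : ℕ} {q pos eid pv deg es : ℕ → ℕ}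

theorem mem_restV {v : ℕ} : v ∈ restV n q i ↔ v < n ∧ ∀ t < i, q t ≠ v := by
  simp [restV]

theorem mem_restE {j : ℕ} : j ∈ restE n eid i ↔ j < n - 1 ∧ ∀ t < i, eid t ≠ j := by
  simp [restE]

namespace Peel

theorem qt_le (h : Peel n e1 e2 i q pos eid pv deg es qt u) : qt ≤ n := by
  have := Finset.card_le_card_of_injOn (s := Finset.range qt) (t := Finset.range n) q
    (fun t ht => by simpa using h.q_lt t (by simpa using ht))
    (fun s hs t ht => h.q_inj s (by simpa using hs) t (by simpa using ht))
  simpa using this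

theorem card_restV (h : Peel n e1 e2 i q pos eid pv deg es qt u) :
    (restV n q i).card = n - i := by
  have hle := h.le
  rw [restV, Finset.card_sdiff_of_subset, Finset.card_image_of_injOn]
  · simp
  · exact fun s hs t ht => h.q_inj s (by simp at hs; omega) t (by simp at ht; omega)
  · intro v hv
    simp only [Finset.mem_image, Finset.mem_range] at hv ⊢
    obtain ⟨t, ht, rfl⟩ := hv
    exact h.q_lt t (by omega)

/-- One removal: the next vertex of the queue is a leaf, its edge is found from `es`, and the other
end `u'` of this edge joins the queue if it becomes a leaf. -/
theorem step (h : Peel n e1 e2 i q pos eid pv deg es qt u) (hi : i < n - 1) :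
    ∃ j u', es (q i) = j ∧ j < n - 1 ∧ e1 j < n ∧ e2 j < n ∧ e1 j + e2 j = u' + q i ∧ u' < n ∧
      i < qt ∧ q i < n ∧ 1 ≤ deg u' ∧ j ≤ es u' ∧
      ∀ q' qt', (∀ t < qt, q' t = q t) →
        ((deg u' - 1 ≠ 1 ∧ qt' = qt) ∨ (deg u' - 1 = 1 ∧ qt' = qt + 1 ∧ q' qt = u')) →
        Peel n e1 e2 (i + 1) q' (Function.update pos (q i) i) (Function.update eid i j)
          (Function.update pv i u') (Function.update deg u' (deg u' - 1))
          (Function.update es u' (es u' - j)) qt' u' := by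
  have hcard : 2 ≤ (restV n q i).card := by rw [h.card_restV]; omega
  obtain ⟨v0, hv0, hd0⟩ := h.strip.exists_leaf hcard
  obtain ⟨t0, ht0, ht0', _⟩ := h.leaf v0 hv0 (by rw [h.deg_eq v0 hv0, hd0])
  have hiqt : i < qt := by omega
  have hv : q i ∈ restV n q i := mem_restV.2 ⟨h.q_lt i hiqt, fun t ht he => by
    have := h.q_inj t (by omega) i hiqt he
    omega⟩
  have hdv : incid e1 e2 (restE n eid i) (q i) = 1 := by
    have h1 := h.strip.one_le_incid hcard hv
    have h2 := h.queue i le_rfl hiqt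
    rw [h.deg_eq _ hv] at h2
    omega
  obtain ⟨j, hj, hsum, u', huv, hju, hoth⟩ := Strip.leaf_edge hdv
  have hu := h.strip.mem_of_leaf_edge hj hju
  have hu' := mem_restV.1 hu
  have hends := h.strip.ends j hj
  have hj' := mem_restE.1 hj
  refine ⟨j, u', by rw [h.es_eq _ hv, hsum], hj'.1, (mem_restV.1 hends.1).1,
    (mem_restV.1 hends.2).1, ?_, hu'.1, hiqt, h.q_lt i hiqt, ?_, ?_, ?_⟩
  · rcases hju with ⟨h1, h2⟩ | ⟨h1, h2⟩ <;> omega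
  · rw [h.deg_eq _ hu]; exact one_le_incid hj hju
  · rw [h.es_eq _ hu]; exact le_incidSum hj hju
  intro q' qt' hq hcase
  have hRE : restV n q' (i + 1) = (restV n q i).erase (q i) := by
    ext x
    simp only [mem_restV, Finset.mem_erase]
    constructor
    · rintro ⟨h1, h2⟩
      exact ⟨fun hx => h2 i (by omega) (by rw [hq i hiqt, hx]), h1, fun t ht => by
        rw [← hq t (by omega)]; exact h2 t (by omega)⟩
    · rintro ⟨h1, h2, h3⟩
      refine ⟨h2, fun t ht => ?_⟩
      rw [hq t (by omega)]
      rcases Nat.lt_succ_iff_lt_or_eq.1 ht with h4 | rfl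
      · exact h3 t h4
      · exact Ne.symm h1
  have hJE : restE n (Function.update eid i j) (i + 1) = (restE n eid i).erase j := by
    ext x
    simp only [mem_restE, Finset.mem_erase]
    constructor
    · rintro ⟨h1, h2⟩
      refine ⟨fun hx => h2 i (by omega) (by simp [hx]), h1, fun t ht => ?_⟩
      have := h2 t (by omega)
      rwa [Function.update_of_ne (by omega)] at this
    · rintro ⟨h1, h2, h3⟩
      refine ⟨h2, fun t ht => ?_⟩
      rcases Nat.lt_succ_iff_lt_or_eq.1 ht with h4 | rfl
      · rw [Function.update_of_ne (by omega)]; exact h3 t h4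
      · simpa using Ne.symm h1
  have hqt' : qt ≤ qt' := by omega
  have hlt : ∀ t < qt', t < qt ∨ (t = qt ∧ deg u' - 1 = 1 ∧ q' t = u') := by
    intro t ht
    rcases hcase with ⟨_, h2⟩ | ⟨h1, h2, h3⟩
    · omega
    · rcases Nat.lt_or_ge t qt with h4 | h4
      · exact Or.inl h4
      · have : t = qt := by omega
        exact Or.inr ⟨this, h1, by rw [this, h3]⟩
  have hnew : deg u' - 1 = 1 → ∀ t < qt, q t ≠ u' := by
    intro hd t ht he
    rcases Nat.lt_or_ge t i with h4 | h4
    · exact hu'.2 t h4 he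
    · have := h.queue t h4 ht
      rw [he] at this
      omega
  constructor
  · omega
  · intro t ht
    rcases hlt t ht with h1 | ⟨_, _, h1⟩
    · rw [hq t h1]; exact h.q_lt t h1
    · rw [h1]; exact hu'.1
  · intro s hs t ht he
    rcases hlt s hs with h1 | ⟨h1, h2, h3⟩ <;> rcases hlt t ht with h4 | ⟨h4, h5, h6⟩
    · rw [hq s h1, hq t h4] at he; exact h.q_inj s h1 t h4 he
    · rw [hq s h1, h6] at he; exact absurd he (hnew h5 s h1)
    · rw [hq t h4, h3] at he; exact absurd he.symm (hnew h2 t h4)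
    · omega
  · intro t ht
    rw [hq t (by omega)]
    rcases Nat.lt_succ_iff_lt_or_eq.1 ht with h4 | rfl
    · rw [Function.update_of_ne]
      · exact h.pos_q t h4
      · exact fun he => absurd (h.q_inj _ (by omega) _ hiqt he) (by omega)
    · simp
  · intro t ht
    rcases Nat.lt_succ_iff_lt_or_eq.1 ht with h4 | rfl
    · rw [Function.update_of_ne (by omega)]; exact h.eid_lt t h4
    · simpa using hj'.1
  · intro s hs t ht he
    rcases Nat.lt_succ_iff_lt_or_eq.1 hs with h3 | rfl <;>
      rcases Nat.lt_succ_iff_lt_or_eq.1 ht with h4 | rfl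
    · rw [Function.update_of_ne (by omega), Function.update_of_ne (by omega)] at he
      exact h.eid_inj s h3 t h4 he
    · rw [Function.update_of_ne (by omega), Function.update_self] at he
      exact absurd he (hj'.2 s h3)
    · rw [Function.update_self, Function.update_of_ne (by omega)] at he
      exact absurd he.symm (hj'.2 t h4)
    · rfl
  · intro t ht
    rw [hq t (by omega)]
    rcases Nat.lt_succ_iff_lt_or_eq.1 ht with h4 | rfl
    · rw [Function.update_of_ne (by omega), Function.update_of_ne (by omega)]
      exact h.edge t h4
    · simpa using hju
  · intro t ht
    rcases Nat.lt_succ_iff_lt_or_eq.1 ht with h4 | rfl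
    · rw [Function.update_of_ne (by omega)]; exact h.pv_lt t h4
    · simpa using hu'.1
  · intro t ht s hs
    rw [hq s (by omega)]
    rcases Nat.lt_succ_iff_lt_or_eq.1 ht with h4 | rfl
    · rw [Function.update_of_ne (by omega)]; exact h.pv_ne t h4 s hs
    · rw [Function.update_self]
      rcases Nat.lt_or_ge s t with h5 | h5
      · exact Ne.symm (hu'.2 s h5)
      · have : s = t := by omega
        rw [this]; exact huv
  · rw [hRE, hJE]
    exact h.strip.erase hv hj hju hoth
  · rw [hRE, hJE]
    intro x hx
    obtain ⟨hxv, hx⟩ := Finset.mem_erase.1 hx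
    rw [incid_erase hj huv hju x hxv]
    split_ifs with hxu
    · rw [hxu, Function.update_self, h.deg_eq _ hu]
    · rw [Function.update_of_ne hxu, h.deg_eq _ hx]
  · rw [hRE, hJE]
    intro x hx
    obtain ⟨hxv, hx⟩ := Finset.mem_erase.1 hx
    rw [incidSum_erase hj huv hju x hxv]
    split_ifs with hxu
    · rw [hxu, Function.update_self, h.es_eq _ hu]
    · rw [Function.update_of_ne hxu, h.es_eq _ hx]
  · rw [hRE]
    intro x hx hd
    obtain ⟨hxv, hx⟩ := Finset.mem_erase.1 hx
    by_cases hxu : x = u'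
    · rw [hxu, Function.update_self] at hd
      rcases hcase with ⟨h1, _⟩ | ⟨_, h2, h3⟩
      · exact absurd hd h1
      · exact ⟨qt, by omega, by omega, by rw [h3, hxu]⟩
    · rw [Function.update_of_ne hxu] at hd
      obtain ⟨t, h1, h2, h3⟩ := h.leaf x hx hd
      have : t ≠ i := by rintro rfl; exact hxv h3.symm
      exact ⟨t, by omega, by omega, by rw [hq t h2, h3]⟩
  · intro t h1 h2
    rcases hlt t h2 with h3 | ⟨_, h3, h4⟩
    · rw [hq t h3]
      have := h.queue t (by omega) h3
      by_cases hxu : q t = u'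
      · rw [hxu] at this ⊢
        rw [Function.update_self]; omega
      · rwa [Function.update_of_ne hxu]
    · rw [h4, Function.update_self, h3]
  · rw [hRE]
    exact Finset.mem_erase.2 ⟨huv, hu⟩

end Peel

end peel


/-! ### Rooting the tree -/

/-- A scalar as an expression. -/
prefix:max "♯" => HE.var

/-- The data of an instance as functions on `ℕ`, and an upper bound `C` on the weights. -/
structure Data where
  n : ℕ
  p : ℕ
  k : ℕ
  C : ℕ
  e1 : ℕ → ℕ
  e2 : ℕ → ℕ
  a : ℕ → ℕ
  b : ℕ → ℕ
  wt : ℕ → ℕ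

/-- The data are those of a tree with weighted paths. -/
structure Data.Ok (D : Data) : Prop where
  n_pos : 1 ≤ D.n
  k_pos : 1 ≤ D.k
  e1_lt : ∀ j < D.n - 1, D.e1 j < D.n
  e2_lt : ∀ j < D.n - 1, D.e2 j < D.n
  a_lt : ∀ i < D.p, D.a i < D.n
  b_lt : ∀ i < D.p, D.b i < D.n
  wt_le : ∀ i < D.p, D.wt i ≤ D.C
  strip : Strip D.e1 D.e2 (Finset.range D.n) (Finset.range (D.n - 1))

/-- The parameters of the run are large enough for the data. -/
structure Big (D : Data) (c : Ctx) : Prop where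
  li : c.li = 3 + 2 * (D.n - 1) + 3 * D.p
  lo : c.lo = D.n * (D.k + 1)
  hX : 100 + 100 * D.n + D.n * D.n + D.p + D.C + D.n * (D.k + 1) ≤ c.X

/-- The state holds the data. -/
structure Env (D : Data) (σ : Store) : Prop where
  n : σ.reg .n = D.n
  p : σ.reg .p = D.p
  k : σ.reg .k = D.k
  m : σ.reg .m = D.n - 1
  e1 : ∀ j < D.n - 1, σ.arr .inp (3 + j) = D.e1 j
  e2 : ∀ j < D.n - 1, σ.arr .inp (3 + σ.reg .m + j) = D.e2 j
  a : ∀ i < D.p, σ.arr .inp (3 + 2 * σ.reg .m + i) = D.a i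
  b : ∀ i < D.p, σ.arr .inp (3 + 2 * σ.reg .m + σ.reg .p + i) = D.b i
  wt : ∀ i < D.p, σ.arr .inp (3 + 2 * σ.reg .m + 2 * σ.reg .p + i) = D.wt i

/-- Whether a program leaves the input and its parameters unchanged. -/
def HP.pres (P : HP) : Bool :=
  !(P.wv .n || P.wv .p || P.wv .k || P.wv .m || P.wa .inp)

theorem Env.frame {D : Data} {P : HP} {σ σ' : Store} (h : Env D σ) (hF : Frame P σ σ')
    (hP : P.pres = true) : Env D σ' := by
  simp only [HP.pres, Bool.not_eq_true', Bool.or_eq_false_iff] at hP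
  obtain ⟨⟨⟨⟨h1, h2⟩, h3⟩, h4⟩, h5⟩ := hP
  have e1 := hF.reg _ h1
  have e2 := hF.reg _ h2
  have e3 := hF.reg _ h3
  have e4 := hF.reg _ h4
  have e5 := hF.arr _ h5
  constructor <;> simp only [e1, e2, e3, e4, e5]
  exacts [h.n, h.p, h.k, h.m, h.e1, h.e2, h.a, h.b, h.wt]

/-- Degrees, and sums of the indices of incident edges. -/
def degreesP : HP :=
  .for .j .m (
    .asg .u (.get .inp (3 + ♯.j)) ;;
    .asg .v (.get .inp (3 + ♯.m + ♯.j)) ;;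
    .sto .deg ♯.u (.get .deg ♯.u + 1) ;;
    .sto .deg ♯.v (.get .deg ♯.v + 1) ;;
    .sto .es ♯.u (.get .es ♯.u + ♯.j) ;;
    .sto .es ♯.v (.get .es ♯.v + ♯.j))

theorem incid_range_succ (e1 e2 : ℕ → ℕ) (j v : ℕ) :
    incid e1 e2 (Finset.range (j + 1)) v = incid e1 e2 (Finset.range j) v +
      ((if e1 j = v then 1 else 0) + (if e2 j = v then 1 else 0)) := Finset.sum_range_succ _ _

theorem incidSum_range_succ (e1 e2 : ℕ → ℕ) (j v : ℕ) :
    incidSum e1 e2 (Finset.range (j + 1)) v = incidSum e1 e2 (Finset.range j) v +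
      ((if e1 j = v then j else 0) + (if e2 j = v then j else 0)) := Finset.sum_range_succ _ _

theorem incid_le (e1 e2 : ℕ → ℕ) (J : Finset ℕ) (v : ℕ) : incid e1 e2 J v ≤ 2 * J.card := by
  rw [mul_comm, ← smul_eq_mul]
  exact Finset.sum_le_card_nsmul _ _ _ fun j _ => by split_ifs <;> omega

theorem incidSum_le (e1 e2 : ℕ → ℕ) (j v : ℕ) :
    incidSum e1 e2 (Finset.range j) v ≤ j * j := by
  induction j with
  | zero => simp [incidSum]
  | succ j ih =>
    rw [incidSum_range_succ]
    have : (j + 1) * (j + 1) = j * j + 2 * j + 1 := by ring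
    split_ifs <;> omega

theorem two_updates (f : ℕ → ℕ) (x y v a : ℕ) :
    (if v = y then (if y = x then f x + a else f y) + a else if v = x then f x + a else f v) =
      f v + ((if x = v then a else 0) + (if y = v then a else 0)) := by
  by_cases h1 : v = x <;> by_cases h2 : v = y
  · subst h1; subst h2; simp; omega
  · subst h1; simp [h2, Ne.symm h2]
  · subst h2; simp [h1, Ne.symm h1]
  · simp [h1, h2, Ne.symm h1, Ne.symm h2]

section
variable {D : Data} {c : Ctx} {σ : Store}

theorem degreesP_spec (hD : D.Ok) (hc : Big D c) (hE : Env D σ) (hdeg : ∀ v, σ.arr .deg v = 0)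
    (hes : ∀ v, σ.arr .es v = 0) :
    Runs c degreesP σ fun σ' =>
      (∀ v, σ'.arr .deg v = incid D.e1 D.e2 (Finset.range (D.n - 1)) v) ∧
      (∀ v, σ'.arr .es v = incidSum D.e1 D.e2 (Finset.range (D.n - 1)) v) ∧
      σ'.tm ≤ σ.tm + 10 * D.n := by
  have hX := hc.hX
  have hn := hD.n_pos
  refine Runs.for_rule rfl rfl (by simp) (D.n - 1) hE.m (by omega) (fun j σ' =>
    (∀ v, σ'.arr .deg v = incid D.e1 D.e2 (Finset.range j) v) ∧
      (∀ v, σ'.arr .es v = incidSum D.e1 D.e2 (Finset.range j) v) ∧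
      σ'.tm ≤ σ.tm + 1 + 8 * j) ?_ ?_ ?_
  · simp [incid, incidSum, hdeg, hes]
  · intro j σ' hj hF hr ⟨h1, h2, h3⟩
    have hE' := hE.frame hF rfl
    have he1 := hE'.e1 j hj
    have he2 := hE'.e2 j hj
    have hd1 := fun v => incid_le D.e1 D.e2 (Finset.range j) v
    simp only [Finset.card_range] at hd1
    have hs1 := fun v => incidSum_le D.e1 D.e2 j v
    have hjj : j * j + 2 * D.n ≤ D.n * D.n + 2 * D.n := by
      have := Nat.mul_le_mul (show j ≤ D.n by omega) (show j ≤ D.n by omega)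
      omega
    have hli := hc.li
    have hm := hE'.m
    have hb1 := hD.e1_lt j hj
    have hb2 := hD.e2_lt j hj
    simp only [Runs.seq_iff, Runs.asg_iff, Runs.sto_iff]
    simp [hr, he1, he2, h1, h2, Function.update_apply, incid_range_succ, incidSum_range_succ]
    have b1 := hd1 (D.e1 j)
    have b2 := hd1 (D.e2 j)
    have b3 := hs1 (D.e1 j)
    have b4 := hs1 (D.e2 j)
    refine ⟨by omega, by omega, by omega, by omega, by omega, ?_, by omega, ?_, ?_, ?_, by omega⟩
    · split_ifs with h <;> [rw [← h] at *; skip] <;> omega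
    · split_ifs with h <;> [rw [← h] at *; skip] <;> omega
    · exact fun v => two_updates (incid D.e1 D.e2 (Finset.range j)) _ _ v 1
    · exact fun v => two_updates (incidSum D.e1 D.e2 (Finset.range j)) _ _ v j
  · rintro σ' - - ⟨h1, h2, h3⟩
    exact ⟨h1, h2, by simp; omega⟩

/-- The initial queue of leaves. -/
def leavesP : HP :=
  .asg .qt 0 ;;
  .for .v .n (
    .ite (HE.equal (.get .deg ♯.v) 1)
      (.sto .que ♯.qt ♯.v ;; .asg .qt (♯.qt + 1)) .skip)

theorem leavesP_spec (hD : D.Ok) (hc : Big D c) (hE : Env D σ) :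
    Runs c leavesP σ fun σ' =>
      (∀ t < σ'.reg .qt, σ'.arr .que t < D.n ∧ σ.arr .deg (σ'.arr .que t) = 1) ∧
      (∀ s < σ'.reg .qt, ∀ t < σ'.reg .qt, σ'.arr .que s = σ'.arr .que t → s = t) ∧
      (∀ v < D.n, σ.arr .deg v = 1 → ∃ t < σ'.reg .qt, σ'.arr .que t = v) ∧
      σ'.tm ≤ σ.tm + 10 * D.n := by
  have hX := hc.hX
  have hn := hD.n_pos
  rw [leavesP, Runs.seq_iff, Runs.asg_iff]
  refine ⟨by simp, by simp; omega, ?_⟩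
  refine Runs.for_rule rfl rfl (by simp) D.n (by simpa using hE.n) (by omega) (fun j σ' =>
      σ'.reg .qt ≤ j ∧
      (∀ t < σ'.reg .qt, σ'.arr .que t < j ∧ σ.arr .deg (σ'.arr .que t) = 1) ∧
      (∀ s < σ'.reg .qt, ∀ t < σ'.reg .qt, σ'.arr .que s = σ'.arr .que t → s = t) ∧
      (∀ v < j, σ.arr .deg v = 1 → ∃ t < σ'.reg .qt, σ'.arr .que t = v) ∧
      σ'.tm ≤ σ.tm + 2 + 5 * j) ?_ ?_ ?_
  · simp
  · intro j σ' hj hF hr ⟨h0, h1, h2, h3, h4⟩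
    have hdeg : σ'.arr .deg = σ.arr .deg := by simpa using hF.arr .deg rfl
    simp only [Runs.seq_iff, Runs.asg_iff, Runs.sto_iff, Runs.ite_iff, Runs.skip_iff]
    simp [hr, hdeg]
    constructor
    · intro hd
      refine ⟨by omega, by omega, by omega, ?_, ?_, ?_, by omega⟩
      · intro t ht
        rcases Nat.lt_or_eq_of_le ht with h | rfl
        · rw [Function.update_of_ne (by omega)]
          have := h1 t h
          exact ⟨by omega, this.2⟩
        · simp [hd]
      · intro s hs t ht he
        rcases Nat.lt_or_eq_of_le hs with h | rfl <;>
          rcases Nat.lt_or_eq_of_le ht with h' | rfl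
        · rw [Function.update_of_ne (by omega), Function.update_of_ne (by omega)] at he
          exact h2 s h t h' he
        · rw [Function.update_of_ne (by omega), Function.update_self] at he
          have := (h1 s h).1
          omega
        · rw [Function.update_self, Function.update_of_ne (by omega)] at he
          have := (h1 t h').1
          omega
        · rfl
      · intro v hv hdv
        rcases Nat.lt_or_eq_of_le hv with h | rfl
        · obtain ⟨t, ht, rfl⟩ := h3 v h hdv
          exact ⟨t, by omega, by rw [Function.update_of_ne (by omega)]⟩
        · exact ⟨σ'.reg .qt, by omega, by simp⟩
    · intro hd
      refine ⟨by omega, ?_, h2, ?_, by omega⟩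
      · intro t ht
        have := h1 t ht
        exact ⟨by omega, this.2⟩
      · intro v hv hdv
        rcases Nat.lt_or_eq_of_le hv with h | rfl
        · exact h3 v h hdv
        · exact absurd hdv hd
  · rintro σ' - - ⟨h0, h1, h2, h3, h4⟩
    exact ⟨h1, h2, h3, by simp; omega⟩

/-- The removal of leaves. The only edge of the leaf `v` has the index `es v`, and its other end `u`
is the sum of its ends minus `v`. -/
def stripP : HP :=
  .asg .u 0 ;;
  .for .i .m (
    .asg .v (.get .que ♯.i) ;;
    .asg .j (.get .es ♯.v) ;;
    .asg .u (.get .inp (3 + ♯.j) + .get .inp (3 + ♯.m + ♯.j) - ♯.v) ;;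
    .sto .pos ♯.v ♯.i ;;
    .sto .eid ♯.i ♯.j ;;
    .sto .pv ♯.i ♯.u ;;
    .sto .deg ♯.u (.get .deg ♯.u - 1) ;;
    .sto .es ♯.u (.get .es ♯.u - ♯.j) ;;
    .ite (HE.equal (.get .deg ♯.u) 1)
      (.sto .que ♯.qt ♯.u ;; .asg .qt (♯.qt + 1)) .skip)

/-- The state satisfies the invariant of the removal of leaves after `i` removals. -/
def PeelSt (D : Data) (i : ℕ) (σ : Store) : Prop :=
  Peel D.n D.e1 D.e2 i (σ.arr .que) (σ.arr .pos) (σ.arr .eid) (σ.arr .pv) (σ.arr .deg) (σ.arr .es)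
    (σ.reg .qt) (σ.reg .u) ∧
  (∀ v, σ.arr .deg v ≤ 2 * D.n) ∧ (∀ v, σ.arr .es v ≤ D.n * D.n)

theorem stripP_spec (hD : D.Ok) (hc : Big D c) (hE : Env D σ)
    (h0 : PeelSt D 0 (σ.set .u 0)) :
    Runs c stripP σ fun σ' => PeelSt D (D.n - 1) σ' ∧ σ'.tm ≤ σ.tm + 20 * D.n := by
  have hX := hc.hX
  have hn := hD.n_pos
  rw [stripP, Runs.seq_iff, Runs.asg_iff]
  refine ⟨by simp, by simp; omega, ?_⟩
  refine Runs.for_rule rfl rfl (by simp) (D.n - 1) (by simpa using hE.m) (by omega) (fun i σ' =>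
      PeelSt D i σ' ∧ σ'.tm ≤ σ.tm + 2 + 13 * i) ?_ ?_ ?_
  · simpa [PeelSt] using h0
  · intro i σ' hi hF hr ⟨⟨hP, hdb, heb⟩, ht⟩
    have hE' : Env D σ' := Env.frame (σ := σ.set .u 0)
      ⟨hE.n, hE.p, hE.k, hE.m, hE.e1, hE.e2, hE.a, hE.b, hE.wt⟩ hF rfl
    obtain ⟨j, u', hj, hjm, he1, he2, hsum, hu, hqt, hv, hd1, hs1, hstep⟩ := hP.step hi
    have hqn := hP.qt_le
    have h1 := hE'.e1 j hjm
    have h2 := hE'.e2 j hjm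
    have hli := hc.li
    have hm := hE'.m
    have hsum' : D.e1 j + D.e2 j - σ'.arr .que i = u' := by omega
    have bd := hdb u'
    have be := heb u'
    have hdb' : ∀ v, Function.update (σ'.arr .deg) u' (σ'.arr .deg u' - 1) v ≤ 2 * D.n := by
      intro v
      rw [Function.update_apply]
      split_ifs
      · omega
      · exact hdb v
    have heb' : ∀ v, Function.update (σ'.arr .es) u' (σ'.arr .es u' - j) v ≤ D.n * D.n := by
      intro v
      rw [Function.update_apply]
      split_ifs
      · omega
      · exact heb v
    simp only [Runs.seq_iff, Runs.asg_iff, Runs.sto_iff, Runs.ite_iff, Runs.skip_iff]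
    simp [hr, hj, h1, h2, hsum']
    repeat refine ⟨by omega, ?_⟩
    refine ⟨fun hd => ⟨by omega, by omega, ⟨?_, ?_⟩, by omega⟩, fun hd => ⟨⟨?_, ?_⟩, by omega⟩⟩
    · simpa using hstep (Function.update (σ'.arr .que) (σ'.reg .qt) u') (σ'.reg .qt + 1)
        (fun t ht => Function.update_of_ne (by omega) _ _) (Or.inr ⟨by omega, rfl, by simp⟩)
    · simpa using ⟨hdb', heb'⟩
    · simpa using hstep (σ'.arr .que) (σ'.reg .qt) (fun t ht => rfl) (Or.inl ⟨by omega, rfl⟩)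
    · simpa using ⟨hdb', heb'⟩
  · rintro σ' - - ⟨h1, h2⟩
    exact ⟨by simpa [PeelSt] using h1, by simp; omega⟩

/-- A rooted tree on the vertices `0, …, n - 1` with root `n - 1` in which every vertex `i < n - 1`
has a parent `par i > i`. The vertex `v` of the given tree is renamed to `pos v`, and `eid i` is the
index of the edge from `i` to its parent. -/
structure Rooted (D : Data) (pos par eid : ℕ → ℕ) : Prop where
  pos_lt : ∀ v < D.n, pos v < D.n
  pos_inj : ∀ v < D.n, ∀ w < D.n, pos v = pos w → v = w
  par_gt : ∀ i < D.n - 1, i < par i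
  par_lt : ∀ i < D.n - 1, par i < D.n
  eid_lt : ∀ i < D.n - 1, eid i < D.n - 1
  eid_inj : ∀ i < D.n - 1, ∀ j < D.n - 1, eid i = eid j → i = j
  edge : ∀ i < D.n - 1, (pos (D.e1 (eid i)) = i ∧ pos (D.e2 (eid i)) = par i) ∨
    (pos (D.e2 (eid i)) = i ∧ pos (D.e1 (eid i)) = par i)

/-- The order of removal is the numbering of the rooted tree: the parent of a leaf is the other end
of its only edge, which is removed later. The last vertex becomes the root. -/
theorem Peel.rooted {D : Data} {q pos eid pv deg es pos' : ℕ → ℕ} {qt u : ℕ} (hD : D.Ok)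
    (h : Peel D.n D.e1 D.e2 (D.n - 1) q pos eid pv deg es qt u)
    (hpos : pos' = Function.update pos u (D.n - 1)) :
    Rooted D pos' (fun i => pos' (pv i)) eid := by
  have hn := hD.n_pos
  have hu := mem_restV.1 h.u_mem
  have hle := h.le
  have hcases : ∀ v < D.n, v = u ∨ ∃ t < D.n - 1, q t = v := by
    intro v hv
    by_contra! hne
    have hv' : v ∈ restV D.n q (D.n - 1) := mem_restV.2 ⟨hv, hne.2⟩
    have := Finset.one_lt_card.2 ⟨v, hv', u, h.u_mem, hne.1⟩
    rw [h.card_restV] at this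
    omega
  have hq : ∀ t < D.n - 1, pos' (q t) = t := by
    intro t ht
    rw [hpos, Function.update_of_ne (hu.2 t ht), h.pos_q t ht]
  have hpu : pos' u = D.n - 1 := by simp [hpos]
  refine ⟨?_, ?_, ?_, ?_, h.eid_lt, h.eid_inj, ?_⟩
  · intro v hv
    rcases hcases v hv with rfl | ⟨t, ht, rfl⟩
    · omega
    · rw [hq t ht]; omega
  · intro v hv w hw he
    rcases hcases v hv with rfl | ⟨t, ht, rfl⟩ <;> rcases hcases w hw with rfl | ⟨s, hs, rfl⟩
    · rfl
    · rw [hpu, hq s hs] at he; omega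
    · rw [hpu, hq t ht] at he; omega
    · rw [hq t ht, hq s hs] at he; rw [he]
  · intro i hi
    rcases hcases _ (h.pv_lt i hi) with he | ⟨t, ht, he⟩
    · rw [he, hpu]; exact hi
    · rw [← he, hq t ht]
      by_contra! hc
      exact h.pv_ne i hi t hc he.symm
  · intro i hi
    rcases hcases _ (h.pv_lt i hi) with he | ⟨t, ht, he⟩
    · rw [he, hpu]; omega
    · rw [← he, hq t ht]; omega
  · intro i hi
    rcases h.edge i hi with ⟨h1, h2⟩ | ⟨h1, h2⟩
    · left; rw [h1, h2, hq i hi]; exact ⟨rfl, rfl⟩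
    · right; rw [h1, h2, hq i hi]; exact ⟨rfl, rfl⟩

/-- The parents in the new numbering. -/
def parentsP : HP :=
  .sto .pos ♯.u ♯.m ;;
  .for .i .m (.sto .par ♯.i (.get .pos (.get .pv ♯.i)))

theorem parentsP_spec (hD : D.Ok) (hc : Big D c) (hE : Env D σ) (h0 : PeelSt D (D.n - 1) σ) :
    Runs c parentsP σ fun σ' =>
      Rooted D (σ'.arr .pos) (σ'.arr .par) (σ'.arr .eid) ∧ σ'.tm ≤ σ.tm + 10 * D.n := by
  have hX := hc.hX
  have hn := hD.n_pos
  have hR := h0.1.rooted hD rfl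
  rw [parentsP, Runs.seq_iff, Runs.sto_iff]
  refine ⟨by simp, by simp, by simp, by simp [hE.m]; omega, ?_⟩
  have hm := hE.m
  refine Runs.for_rule rfl rfl (by simp) (D.n - 1) (by simpa using hE.m) (by omega) (fun i σ' =>
      (∀ t < i, σ'.arr .par t = σ'.arr .pos (σ.arr .pv t)) ∧
      σ'.tm ≤ σ.tm + 2 + 3 * i) ?_ ?_ ?_
  · simp
  · intro i σ' hi hF hr ⟨h1, ht⟩
    have hpos : σ'.arr .pos = Function.update (σ.arr .pos) (σ.reg .u) (D.n - 1) := by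
      simpa [hm] using hF.arr .pos rfl
    have hpv : σ'.arr .pv = σ.arr .pv := by simpa using hF.arr .pv rfl
    have hlt := hR.par_lt i hi
    simp only [Runs.sto_iff]
    simp only [← hpos] at hlt
    simp [hr, hpv]
    refine ⟨by omega, ?_, by omega⟩
    intro t ht
    rcases Nat.lt_or_eq_of_le ht with h | rfl
    · rw [Function.update_of_ne (by omega)]; exact h1 t h
    · simp
  · rintro σ' hF - ⟨h1, h2⟩
    have hpos : σ'.arr .pos = Function.update (σ.arr .pos) (σ.reg .u) (D.n - 1) := by
      simpa [hm] using hF.arr .pos rfl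
    have heid : σ'.arr .eid = σ.arr .eid := by simpa using hF.arr .eid rfl
    refine ⟨?_, by simp; omega⟩
    rw [← hpos] at hR
    simp only [Store.arr_tick, heid]
    refine ⟨hR.1, hR.2, ?_, ?_, hR.5, hR.6, ?_⟩
    · intro i hi; rw [h1 i hi]; exact hR.par_gt i hi
    · intro i hi; rw [h1 i hi]; exact hR.par_lt i hi
    · intro i hi; rw [h1 i hi]; exact hR.edge i hi

/-- From the list of edges to the rooted tree. -/
def rootP : HP := degreesP ;; leavesP ;; stripP ;; parentsP

theorem rootP_spec (hD : D.Ok) (hc : Big D c) (hE : Env D σ) (hdeg : ∀ v, σ.arr .deg v = 0)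
    (hes : ∀ v, σ.arr .es v = 0) :
    Runs c rootP σ fun σ' =>
      Rooted D (σ'.arr .pos) (σ'.arr .par) (σ'.arr .eid) ∧ σ'.tm ≤ σ.tm + 50 * D.n := by
  rw [rootP, Runs.seq_iff]
  refine (degreesP_spec hD hc hE hdeg hes).mono fun σ1 F1 ⟨d1, s1, t1⟩ => ?_
  have E1 := hE.frame F1 rfl
  rw [Runs.seq_iff]
  refine (leavesP_spec hD hc E1).mono fun σ2 F2 ⟨l1, l2, l3, t2⟩ => ?_
  have E2 := E1.frame F2 rfl
  rw [Runs.seq_iff]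
  have hn := hD.n_pos
  have hdeg2 : σ2.arr .deg = σ1.arr .deg := F2.arr .deg rfl
  have hes2 : σ2.arr .es = σ1.arr .es := F2.arr .es rfl
  have hV : restV D.n (σ2.arr .que) 0 = Finset.range D.n := by simp [restV]
  have hE0 : restE D.n (σ2.arr .eid) 0 = Finset.range (D.n - 1) := by simp [restE]
  have h0 : PeelSt D 0 (σ2.set .u 0) := by
    refine ⟨?_, ?_, ?_⟩
    · constructor <;> simp [hV, hE0, hdeg2, hes2]
      · exact fun t ht => (l1 t ht).1
      · exact l2
      · exact hD.strip
      · exact fun v _ => d1 v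
      · exact fun v _ => s1 v
      · exact l3
      · exact fun t ht => (l1 t ht).2.le
      · omega
    · intro v
      simp only [Store.arr_set, hdeg2, d1]
      refine (incid_le _ _ _ _).trans ?_
      simp
    · intro v
      simp only [Store.arr_set, hes2, s1]
      exact (incidSum_le _ _ _ _).trans (Nat.mul_le_mul (by omega) (by omega))
  refine (stripP_spec hD hc E2 h0).mono fun σ3 F3 ⟨p3, t3⟩ => ?_
  have E3 := E2.frame F3 rfl
  refine (parentsP_spec hD hc E3 p3).mono fun σ4 F4 ⟨p4, t4⟩ => ⟨p4, by omega⟩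

end

/-! ### Clusters of logarithmic size -/

section
variable {D : Data} {c : Ctx} {σ : Store}

/-- The cluster size parameter `b` with `T = 4 ^ b > n`, and the table of highest powers of two. -/
def tableP : HP :=
  .asg .b 1 ;; .asg .T 4 ;;
  .loop (HE.less ♯.T (♯.n + 1)) (.asg .T (4 * ♯.T) ;; .asg .b (♯.b + 1)) ;;
  .asg .h 1 ;;
  .for .i .T (
    .ite (HE.equal ♯.i (2 * ♯.h)) (.asg .h ♯.i) .skip ;;
    .sto .hb ♯.i ♯.h)

/-- The parameters `b` and `T`, and `hb i` is the highest power of two that is at most `i`. -/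
structure Table (n b T : ℕ) (hb : ℕ → ℕ) : Prop where
  b_pos : 1 ≤ b
  T_eq : T = 2 ^ (2 * b)
  lt_T : n < T
  T_le : T ≤ 4 * n
  hb_eq : ∀ i < T, 1 ≤ i → ∃ t, hb i = 2 ^ t ∧ 2 ^ t ≤ i ∧ i < 2 ^ (t + 1)

theorem tableP_spec (hD : D.Ok) (hc : Big D c) (hE : Env D σ) :
    Runs c tableP σ fun σ' => Table D.n (σ'.reg .b) (σ'.reg .T) (σ'.arr .hb) ∧
      σ'.tm ≤ σ.tm + 100 * D.n := by
  have hX := hc.hX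
  have hn := hD.n_pos
  rw [tableP, Runs.seq_iff, Runs.asg_iff]
  refine ⟨by simp, by simp; omega, ?_⟩
  rw [Runs.seq_iff, Runs.asg_iff]
  refine ⟨by simp, by simp; omega, ?_⟩
  rw [Runs.seq_iff]
  refine Runs.while_rule (fun r σ' => ∃ β, 1 ≤ β ∧ σ'.reg .b = β ∧ σ'.reg .T = 2 ^ (2 * β) ∧
    2 ^ (2 * β) ≤ 4 * D.n ∧ r + β = D.n + 1 ∧ σ'.tm ≤ σ.tm + 3 * β) D.n
    ⟨1, le_rfl, by simp, by simp, by simp; omega, rfl, by simp⟩ ?_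
  rintro r σ' hF ⟨β, h1, hb, hT, hTn, hr, ht⟩
  have hn' : σ'.reg .n = D.n := by rw [hF.reg .n rfl]; simpa using hE.n
  refine ⟨by simp, ?_⟩
  by_cases hlt : 2 ^ (2 * β) ≤ D.n
  · left
    have hβ : β < D.n := by
      have : 2 * β < 2 ^ (2 * β) := Nat.lt_two_pow_self
      omega
    have h4 : 2 ^ (2 * (β + 1)) = 4 * 2 ^ (2 * β) := by rw [mul_add, pow_add]; ring
    simp only [Runs.seq_iff, Runs.asg_iff]
    simp [hT, hn', hb]
    exact ⟨by omega, by omega, by omega, r - 1, by omega, h4.symm, by omega, by omega,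
      by omega⟩
  · right
    refine ⟨by simp [hT, hn']; omega, ?_⟩
    rw [Runs.seq_iff, Runs.asg_iff]
    refine ⟨by simp, by simp; omega, ?_⟩
    refine Runs.for_rule rfl rfl (by simp) (2 ^ (2 * β)) (by simpa using hT) (by omega)
      (fun i σ2 => (∃ t, σ2.reg .h = 2 ^ t ∧ (i ≤ 1 → t = 0) ∧
          (2 ≤ i → 2 ^ t ≤ i - 1 ∧ i - 1 < 2 ^ (t + 1))) ∧
        (∀ i' < i, 1 ≤ i' → ∃ t, σ2.arr .hb i' = 2 ^ t ∧ 2 ^ t ≤ i' ∧ i' < 2 ^ (t + 1)) ∧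
        σ2.tm ≤ σ'.tm + 3 + 5 * i) ?_ ?_ ?_
    · exact ⟨⟨0, by simp, by simp, by simp⟩, by simp, by simp⟩
    · rintro i σ2 hi hF2 hri ⟨⟨t, h2, h3, h4⟩, h5, h6⟩
      have hp : 1 ≤ 2 ^ t := Nat.one_le_two_pow
      have hp1 : 2 ^ (t + 1) = 2 * 2 ^ t := by ring
      have hp2 : 2 ^ (t + 1 + 1) = 4 * 2 ^ t := by ring
      have hlow : 2 ^ t ≤ i ∨ i = 0 := by
        rcases Nat.lt_or_ge i 2 with h | h
        · have := h3 (by omega); subst this; simp; omega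
        · have := h4 h; omega
      have hone : i = 0 → 2 ^ t = 1 := fun h => by simp [h3 (by omega)]
      have hup : i ≤ 2 ^ (t + 1) := by
        rcases Nat.lt_or_ge i 2 with h | h
        · omega
        · have := h4 h; omega
      simp only [Runs.seq_iff, Runs.asg_iff, Runs.sto_iff, Runs.ite_iff, Runs.skip_iff]
      simp [hri, h2]
      constructor
      · intro he
        refine ⟨by omega, ⟨t + 1, by omega, by omega, fun h => ⟨by omega, by omega⟩⟩, ?_,
          by omega⟩
        intro i' hi' hi1
        rcases Nat.lt_or_eq_of_le hi' with h | rfl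
        · rw [Function.update_of_ne (by omega)]; exact h5 i' h hi1
        · exact ⟨t + 1, by simp; omega, by omega, by omega⟩
      · intro he
        refine ⟨by omega, ⟨fun hi0 => h3 (by omega), fun h => ⟨by omega, by omega⟩⟩, ?_,
          by omega⟩
        intro i' hi' hi1
        rcases Nat.lt_or_eq_of_le hi' with h | rfl
        · rw [Function.update_of_ne (by omega)]; exact h5 i' h hi1
        · exact ⟨t, by simp, by omega, by omega⟩
    · rintro σ2 hF2 - ⟨-, h5, h6⟩
      have e1 : σ2.reg .b = β := by rw [hF2.reg .b rfl]; simpa using hb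
      have e2 : σ2.reg .T = 2 ^ (2 * β) := by rw [hF2.reg .T rfl]; simpa using hT
      have hβ : β < 2 ^ (2 * β) :=
        lt_of_lt_of_le Nat.lt_two_pow_self (Nat.pow_le_pow_right (by omega) (by omega))
      refine ⟨⟨by simp [e1, h1], by simp [e1, e2], by simp [e2]; omega, by simp [e2]; omega, ?_⟩,
        by simp; omega⟩
      simpa [e2] using h5

end

/-- The invariant of the bottom-up grouping of siblings, after the vertices below `i` have been
treated. Each child `c` of `x` belongs to a group `gr c` of children of `x`; all groups of `x` but
the last one, `gid x`, are closed. A closed group forms a cluster together with the open groups of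
its members, and the open groups of their members, and so on; an open group belongs to the
cluster of the parent. The number of vertices that come in this way with a member `c` of a group is
`acc c + 1`. -/
structure Grouping (m : ℕ) (par : ℕ → ℕ) (b i : ℕ) (acc gid gr exit closed : ℕ → ℕ) : Prop where
  acc_lt : ∀ x, acc x < b
  gr_le : ∀ c < i, gr c ≤ c
  exit_gr : ∀ c < i, exit (gr c) = par c
  acc_eq : ∀ x, ∑ c ∈ Finset.range i,
    (if par c = x ∧ closed (gr c) = 0 then acc c + 1 else 0) = acc x
  gid_eq : ∀ c < i, closed (gr c) = 0 → gr c = gid (par c)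
  closed_sum : ∀ g, closed g ≠ 0 →
    ∑ c ∈ Finset.range i, (if gr c = g then acc c + 1 else 0) < 2 * b
  closed_lt : ∀ g, closed g ≠ 0 → g < i
  count : b * ((Finset.range m).filter fun g => closed g ≠ 0).card +
    ∑ x ∈ Finset.Ico i (m + 1), acc x ≤ i

namespace Grouping

variable {m : ℕ} {par : ℕ → ℕ} {b i : ℕ} {acc gid gr exit closed : ℕ → ℕ}

/-- The group `γ` that the next child of `y` joins: a new one, named after this child, if the open
group of `y` is empty. -/
theorem group_facts (h : Grouping m par b i acc gid gr exit closed) {y γ : ℕ}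
    (hγ : γ = if acc y = 0 then i else gid y) :
    γ ≤ i ∧ closed γ = 0 ∧ ∀ c < i, gr c = γ ↔ (par c = y ∧ closed (gr c) = 0) := by
  split_ifs at hγ with h0
  · subst hγ
    refine ⟨le_rfl, ?_, fun c hc => ⟨fun he => ?_, fun he => ?_⟩⟩
    · by_contra hcl
      exact absurd (h.closed_lt _ hcl) (lt_irrefl _)
    · have := h.gr_le c hc; omega
    · have h1 := h.acc_eq y
      rw [h0, Finset.sum_eq_zero_iff] at h1
      have := h1 c (Finset.mem_range.2 hc)
      rw [if_pos he] at this
      omega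
  · have h1 := h.acc_eq y
    obtain ⟨c0, hc0, hne⟩ : ∃ c ∈ Finset.range i,
        (if par c = y ∧ closed (gr c) = 0 then acc c + 1 else 0) ≠ 0 := by
      by_contra! hall
      exact h0 (by rw [← h1]; exact Finset.sum_eq_zero hall)
    have hc0 := Finset.mem_range.1 hc0
    have hP : par c0 = y ∧ closed (gr c0) = 0 := by
      by_contra hP; exact hne (if_neg hP)
    have hg : gr c0 = γ := by rw [h.gid_eq c0 hc0 hP.2, hP.1, hγ]
    refine ⟨?_, by rw [← hg]; exact hP.2, fun c hc => ⟨fun he => ?_, fun he => ?_⟩⟩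
    · have := h.gr_le c0 hc0; omega
    · refine ⟨?_, by rw [he, ← hg]; exact hP.2⟩
      rw [← h.exit_gr c hc, he, ← hg, h.exit_gr c0 hc0, hP.1]
    · rw [h.gid_eq c hc he.2, he.1, hγ]

/-- The vertex `i` joins the group `γ` of its parent `y`, which is closed if its weight `a` is at
least `b`. -/
theorem step (h : Grouping m par b i acc gid gr exit closed) {y γ a : ℕ} (hi : i < m)
    (hy : y = par i) (hiy : i < y) (hym : y ≤ m) (hγ : γ = if acc y = 0 then i else gid y)
    (ha : a = acc y + (acc i + 1)) {acc' gid' closed' : ℕ → ℕ}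
    (hgid : gid' = Function.update gid y γ)
    (hcase : (a < b ∧ acc' = Function.update acc y a ∧ closed' = closed) ∨
      (b ≤ a ∧ acc' = Function.update acc y 0 ∧ closed' = Function.update closed γ 1)) :
    Grouping m par b (i + 1) acc' gid' (Function.update gr i γ) (Function.update exit γ y)
      closed' := by
  obtain ⟨hγi, hγc, hγg⟩ := h.group_facts hγ
  have hb : 1 ≤ b := by have := h.acc_lt y; omega
  have hgr : ∀ c < i, Function.update gr i γ c = gr c := fun c hc =>
    Function.update_of_ne (by omega) _ _
  have hacc : ∀ x, x ≠ y → acc' x = acc x := by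
    intro x hx
    rcases hcase with ⟨_, rfl, _⟩ | ⟨_, rfl, _⟩ <;> exact Function.update_of_ne hx _ _
  have hcl : ∀ g, g ≠ γ → closed' g = closed g := by
    intro g hg
    rcases hcase with ⟨_, _, rfl⟩ | ⟨_, _, rfl⟩
    · rfl
    · exact Function.update_of_ne hg _ _
  have hsumγ : ∑ c ∈ Finset.range i, (if gr c = γ then acc c + 1 else 0) = acc y := by
    rw [← h.acc_eq y]
    refine Finset.sum_congr rfl fun c hc => ?_
    simp only [hγg c (Finset.mem_range.1 hc)]
  have key : ∀ P P' : ℕ → Prop, ∀ [DecidablePred P] [DecidablePred P'],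
      (∀ c < i, P c ↔ P' c) →
      ∑ c ∈ Finset.range (i + 1), (if P c then acc' c + 1 else 0) =
        ∑ c ∈ Finset.range i, (if P' c then acc c + 1 else 0) +
          (if P i then acc i + 1 else 0) := by
    intro P P' _ _ hPP
    rw [Finset.sum_range_succ, hacc i (by omega)]
    congr 1
    refine Finset.sum_congr rfl fun c hc => ?_
    have hc := Finset.mem_range.1 hc
    simp only [hPP c hc, hacc c (by omega)]
  constructor
  · intro x
    by_cases hx : x = y
    · subst hx
      rcases hcase with ⟨h1, rfl, _⟩ | ⟨_, rfl, _⟩ <;> simp <;> omega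
    · rw [hacc x hx]; exact h.acc_lt x
  · intro c hc
    rcases Nat.lt_succ_iff_lt_or_eq.1 hc with hc | rfl
    · rw [hgr c hc]; exact h.gr_le c hc
    · simpa using hγi
  · intro c hc
    rcases Nat.lt_succ_iff_lt_or_eq.1 hc with hc | rfl
    · rw [hgr c hc]
      by_cases hg : gr c = γ
      · rw [hg, Function.update_self]; exact ((hγg c hc).1 hg).1.symm
      · rw [Function.update_of_ne hg]; exact h.exit_gr c hc
    · simp [hy]
  · intro x
    by_cases hx : x = y
    · subst hx
      rcases hcase with ⟨h1, hacc', hcl'⟩ | ⟨h1, hacc', hcl'⟩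
      · rw [key _ (fun c => par c = x ∧ closed (gr c) = 0)]
        · rw [h.acc_eq, hacc', hcl', if_pos]
          · simp [ha]
          · simp [hγc, hy]
        · intro c hc; simp only [hgr c hc, hcl']
      · rw [hacc', Function.update_self]
        refine Finset.sum_eq_zero fun c hc => ?_
        rw [if_neg]
        rintro ⟨h2, h3⟩
        rcases Nat.lt_succ_iff_lt_or_eq.1 (Finset.mem_range.1 hc) with hc | rfl
        · rw [hgr c hc] at h3
          by_cases hg : gr c = γ
          · rw [hg, hcl'] at h3; simp at h3
          · rw [hcl _ hg] at h3
            exact hg ((hγg c hc).2 ⟨h2, h3⟩)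
        · rw [hcl'] at h3; simp at h3
    · rw [key _ (fun c => par c = x ∧ closed (gr c) = 0), hacc x hx, h.acc_eq, if_neg]
      · rfl
      · rintro ⟨h2, _⟩; exact hx (h2.symm.trans hy.symm)
      · intro c hc
        rw [hgr c hc]
        by_cases hg : gr c = γ
        · have := (hγg c hc).1 hg
          constructor
          · rintro ⟨h2, _⟩; exact absurd (h2.symm.trans this.1) hx
          · rintro ⟨h2, _⟩; exact absurd (h2.symm.trans this.1) hx
        · rw [hcl _ hg]
  · intro c hc h0
    rw [hgid]
    rcases Nat.lt_succ_iff_lt_or_eq.1 hc with hc | rfl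
    · rw [hgr c hc] at h0 ⊢
      have h0' : closed (gr c) = 0 := by
        by_cases hg : gr c = γ
        · rw [hg]; exact hγc
        · rwa [hcl _ hg] at h0
      by_cases hp : par c = y
      · rw [hp, Function.update_self]; exact (hγg c hc).2 ⟨hp, h0'⟩
      · rw [Function.update_of_ne hp]; exact h.gid_eq c hc h0'
    · rw [← hy]; simp
  · intro g hg
    rw [key _ (fun c => gr c = g) (fun c hc => by simp only [hgr c hc])]
    rw [Function.update_self]
    by_cases hgγ : g = γ
    · subst hgγ
      rw [hsumγ, if_pos rfl]
      have := h.acc_lt y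
      have := h.acc_lt i
      omega
    · rw [hcl g hgγ] at hg
      rw [if_neg (Ne.symm hgγ)]
      exact h.closed_sum g hg
  · intro g hg
    by_cases hgγ : g = γ
    · omega
    · rw [hcl g hgγ] at hg
      have := h.closed_lt g hg; omega
  · have hcnt := h.count
    have hsplit : ∑ x ∈ Finset.Ico i (m + 1), acc x =
        acc i + ∑ x ∈ Finset.Ico (i + 1) (m + 1), acc x :=
      Finset.sum_eq_sum_Ico_succ_bot (by omega) _
    have hymem : y ∈ Finset.Ico (i + 1) (m + 1) := Finset.mem_Ico.2 ⟨by omega, by omega⟩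
    have e1 := Finset.add_sum_erase _ acc hymem
    have e2 := Finset.add_sum_erase _ acc' hymem
    have e3 : ∑ x ∈ (Finset.Ico (i + 1) (m + 1)).erase y, acc' x =
        ∑ x ∈ (Finset.Ico (i + 1) (m + 1)).erase y, acc x :=
      Finset.sum_congr rfl fun x hx => hacc x (Finset.ne_of_mem_erase hx)
    rcases hcase with ⟨h1, hacc', hcl'⟩ | ⟨h1, hacc', hcl'⟩
    · have : acc' y = a := by simp [hacc']
      rw [hcl']; omega
    · have h2 : acc' y = 0 := by simp [hacc']
      have h3 : (Finset.range m).filter (fun g => closed' g ≠ 0) =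
          insert γ ((Finset.range m).filter fun g => closed g ≠ 0) := by
        ext g
        by_cases hg : g = γ
        · subst hg; simp [hcl']; omega
        · simp [hcl g hg, hg]
      have h4 : γ ∉ (Finset.range m).filter (fun g => closed g ≠ 0) := by simp [hγc]
      rw [h3, Finset.card_insert_of_notMem h4, mul_add]
      omega

end Grouping

section
variable {D : Data} {c : Ctx} {σ : Store}

/-- The grouping of siblings. A vertex joins the open group of its parent, which is closed as soon
as its weight reaches `b`. -/
def groupP : HP :=
  .for .i .m (
    .asg .y (.get .par ♯.i) ;;
    .ite (HE.equal (.get .acc ♯.y) 0) (.sto .gid ♯.y ♯.i) .skip ;;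
    .sto .gr ♯.i (.get .gid ♯.y) ;;
    .sto .exit (.get .gr ♯.i) ♯.y ;;
    .asg .a (.get .acc ♯.y + (.get .acc ♯.i + 1)) ;;
    .ite (HE.less ♯.a ♯.b) (.sto .acc ♯.y ♯.a)
      (.sto .acc ♯.y 0 ;; .sto .closed (.get .gr ♯.i) 1))

theorem groupP_spec (hD : D.Ok) (hc : Big D c) (hE : Env D σ)
    (hR : Rooted D (σ.arr .pos) (σ.arr .par) (σ.arr .eid)) (hb : 1 ≤ σ.reg .b)
    (hbn : σ.reg .b ≤ 4 * D.n) (hacc : ∀ x, σ.arr .acc x = 0) (hcl : ∀ x, σ.arr .closed x = 0) :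
    Runs c groupP σ fun σ' => Grouping (D.n - 1) (σ'.arr .par) (σ'.reg .b) (D.n - 1)
      (σ'.arr .acc) (σ'.arr .gid) (σ'.arr .gr) (σ'.arr .exit) (σ'.arr .closed) ∧
      σ'.tm ≤ σ.tm + 20 * D.n := by
  have hX := hc.hX
  have hn := hD.n_pos
  refine Runs.for_rule rfl rfl (by simp) (D.n - 1) (by simpa using hE.m) (by omega) (fun i σ' =>
    Grouping (D.n - 1) (σ.arr .par) (σ.reg .b) i
      (σ'.arr .acc) (σ'.arr .gid) (σ'.arr .gr) (σ'.arr .exit) (σ'.arr .closed) ∧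
      σ'.tm ≤ σ.tm + 1 + 11 * i) ?_ ?_ ?_
  · refine ⟨?_, by simp⟩
    constructor <;> simp [hacc, hcl]; omega
  · intro i σ' hi hF hr ⟨hG, ht⟩
    have hpar : σ'.arr .par = σ.arr .par := hF.arr .par rfl
    have hbb : σ'.reg .b = σ.reg .b := hF.reg .b rfl
    have hgt := hR.par_gt i hi
    have hlt := hR.par_lt i hi
    set y := σ.arr .par i with hy
    obtain ⟨hγi, -, -⟩ := hG.group_facts (y := y) rfl
    have a1 := hG.acc_lt y
    have a2 := hG.acc_lt i
    have stp := fun acc' gid' closed' => hG.step (acc' := acc') (gid' := gid') (closed' := closed')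
      hi hy hgt (by omega) rfl rfl
    simp only [Runs.seq_iff, Runs.asg_iff, Runs.sto_iff, Runs.ite_iff, Runs.skip_iff]
    simp [hr, hpar, hbb, ← hy]
    refine ⟨by omega, fun h0 => ?_, fun h0 => ?_⟩
    all_goals simp only [h0, if_true, if_false] at hγi
    all_goals repeat refine ⟨by omega, ?_⟩
    all_goals refine ⟨?_, ?_⟩
    · intro hlt
      repeat refine ⟨by omega, ?_⟩
      refine ⟨?_, by omega⟩
      have := stp _ _ _ rfl (Or.inl ⟨hlt, rfl, rfl⟩)
      simpa [h0] using this
    · intro hge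
      repeat refine ⟨by omega, ?_⟩
      refine ⟨?_, by omega⟩
      have := stp _ _ _ rfl (Or.inr ⟨hge, rfl, rfl⟩)
      simpa [h0] using this
    · intro hlt
      repeat refine ⟨by omega, ?_⟩
      refine ⟨?_, by omega⟩
      have := stp _ _ _ rfl (Or.inl ⟨hlt, rfl, rfl⟩)
      simpa [h0] using this
    · intro hge
      repeat refine ⟨by omega, ?_⟩
      refine ⟨?_, by omega⟩
      have := stp _ _ _ rfl (Or.inr ⟨hge, rfl, rfl⟩)
      simpa [h0] using this
  · rintro σ' hF - ⟨h1, h2⟩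
    have hpar : σ'.arr .par = σ.arr .par := hF.arr .par rfl
    have hbb : σ'.reg .b = σ.reg .b := hF.reg .b rfl
    exact ⟨by simpa [hpar, hbb] using h1, by simp; omega⟩

end

/-- The cluster of a vertex: the group of the vertex if this group is closed, and the cluster of the
parent otherwise. The cluster of the root `m` is called `m`. -/
def cluster (m : ℕ) (par gr closed : ℕ → ℕ) (x : ℕ) : ℕ :=
  if _ : x < m ∧ x < par x ∧ closed (gr x) = 0 then cluster m par gr closed (par x)
  else if x < m then gr x else m
termination_by m - x
decreasing_by omega

/-- The number of vertices from `lo` up to the root `m` in the cluster `c`. -/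
def clusterCount (m : ℕ) (K : ℕ → ℕ) (lo c : ℕ) : ℕ :=
  ((Finset.range (m + 1)).filter fun y => lo ≤ y ∧ K y = c).card

section cluster

variable {m : ℕ} {par gr closed : ℕ → ℕ}

theorem cluster_root : cluster m par gr closed m = m := by
  rw [cluster]; simp

theorem cluster_of_open {x : ℕ} (hx : x < m) (hp : x < par x) (h : closed (gr x) = 0) :
    cluster m par gr closed x = cluster m par gr closed (par x) := by
  rw [cluster, dif_pos ⟨hx, hp, h⟩]

theorem cluster_of_closed {x : ℕ} (hx : x < m) (h : closed (gr x) ≠ 0) :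
    cluster m par gr closed x = gr x := by
  rw [cluster, dif_neg (fun h' => h h'.2.2), if_pos hx]

/-- A cluster has fewer than `2 b` vertices: each vertex `x` of the cluster is counted once if the
weights `acc c + 1` of its children in open groups, which add up to `acc x`, are subtracted from its
own weight `acc x + 1`, and then only the weights of the topmost vertices remain. -/
theorem Grouping.card_cluster {b : ℕ} {acc gid exit : ℕ → ℕ}
    (h : Grouping m par b m acc gid gr exit closed) (hp : ∀ x < m, x < par x ∧ par x ≤ m) (M : ℕ) :
    clusterCount m (cluster m par gr closed) 0 M < 2 * b := by
  set K := cluster m par gr closed with hK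
  have hb : 1 ≤ b := by have := h.acc_lt 0; omega
  have e1 : clusterCount m K 0 M = ∑ x ∈ Finset.range (m + 1), if K x = M then 1 else 0 := by
    rw [clusterCount, Finset.card_filter]
    exact Finset.sum_congr rfl fun x _ => by simp
  have e2 : ∑ x ∈ Finset.range (m + 1), (if K x = M then acc x else 0) =
      ∑ c ∈ Finset.range m, (if K c = M ∧ closed (gr c) = 0 then acc c + 1 else 0) := by
    have : ∀ x ∈ Finset.range (m + 1), (if K x = M then acc x else 0) =
        ∑ c ∈ Finset.range m,
          (if par c = x then (if K c = M ∧ closed (gr c) = 0 then acc c + 1 else 0) else 0) := by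
      intro x _
      split_ifs with hx
      · rw [← h.acc_eq x]
        refine Finset.sum_congr rfl fun c hc => ?_
        have hc := Finset.mem_range.1 hc
        by_cases h1 : par c = x <;> by_cases h2 : closed (gr c) = 0 <;> simp only [h1, h2, and_true,
          and_false, if_true, if_false]
        rw [hK, cluster_of_open hc (hp c hc).1 h2, h1, ← hK, if_pos hx]
      · symm
        refine Finset.sum_eq_zero fun c hc => ?_
        have hc := Finset.mem_range.1 hc
        by_cases h1 : par c = x
        · rw [if_pos h1, if_neg]
          rintro ⟨h2, h3⟩
          rw [hK, cluster_of_open hc (hp c hc).1 h3, h1] at h2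
          exact hx h2
        · rw [if_neg h1]
    rw [Finset.sum_congr rfl this, Finset.sum_comm]
    refine Finset.sum_congr rfl fun c hc => ?_
    have hc := Finset.mem_range.1 hc
    rw [Finset.sum_ite_eq, if_pos]
    exact Finset.mem_range.2 (by have := hp c hc; omega)
  have e3 : ∑ x ∈ Finset.range (m + 1), (if K x = M then acc x + 1 else 0) =
      ∑ x ∈ Finset.range (m + 1), (if K x = M then acc x else 0) +
        ∑ x ∈ Finset.range (m + 1), (if K x = M then 1 else 0) := by
    rw [← Finset.sum_add_distrib]
    exact Finset.sum_congr rfl fun x _ => by split_ifs <;> rfl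
  have e4 : ∑ x ∈ Finset.range (m + 1), (if K x = M then acc x + 1 else 0) =
      (∑ c ∈ Finset.range m, (if K c = M ∧ closed (gr c) = 0 then acc c + 1 else 0) +
        ∑ c ∈ Finset.range m, (if gr c = M ∧ closed M ≠ 0 then acc c + 1 else 0)) +
        (if m = M then acc m + 1 else 0) := by
    rw [Finset.sum_range_succ, ← Finset.sum_add_distrib]
    congr 1
    · refine Finset.sum_congr rfl fun c hc => ?_
      have hc := Finset.mem_range.1 hc
      by_cases h2 : closed (gr c) = 0
      · simp only [h2, and_true]
        rw [if_neg (c := gr c = M ∧ closed M ≠ 0)]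
        · simp
        · rintro ⟨rfl, h4⟩; exact h4 h2
      · rw [hK, cluster_of_closed hc h2]
        by_cases h3 : gr c = M
        · subst h3; simp [h2]
        · simp [h3]
    · rw [hK, cluster_root]
  have hm := h.acc_lt m
  by_cases hM : m = M
  · have : ∑ c ∈ Finset.range m, (if gr c = M ∧ closed M ≠ 0 then acc c + 1 else 0) = 0 := by
      refine Finset.sum_eq_zero fun c hc => ?_
      rw [if_neg]
      rintro ⟨h1, _⟩
      have := h.gr_le c (Finset.mem_range.1 hc)
      have := Finset.mem_range.1 hc
      omega
    rw [if_pos hM] at e4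
    omega
  · rw [if_neg hM] at e4
    by_cases hcl : closed M = 0
    · simp only [hcl, ne_eq, not_true_eq_false, and_false, if_false, Finset.sum_const_zero] at e4
      omega
    · have := h.closed_sum M hcl
      simp only [hcl, ne_eq, not_false_eq_true, and_true] at e4
      omega

theorem cluster_mem {b : ℕ} {acc gid exit : ℕ → ℕ}
    (h : Grouping m par b m acc gid gr exit closed) (hp : ∀ x < m, x < par x ∧ par x ≤ m) :
    ∀ x ≤ m, cluster m par gr closed x ∈
      insert m ((Finset.range m).filter fun g => closed g ≠ 0) := by
  intro x
  induction hk : m - x using Nat.strong_induction_on generalizing x with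
  | _ k ih =>
    intro hx
    rcases Nat.lt_or_eq_of_le hx with hx | rfl
    · by_cases hc : closed (gr x) = 0
      · rw [cluster_of_open hx (hp x hx).1 hc]
        have := hp x hx
        exact ih (m - par x) (by omega) (par x) rfl this.2
      · rw [cluster_of_closed hx hc]
        have := h.gr_le x hx
        simp [hc]; right; omega
    · rw [cluster_root]; simp

/-- There are `O(m / b)` clusters: each closed group has weight at least `b`. -/
theorem card_clusters {b : ℕ} {acc gid exit : ℕ → ℕ}
    (h : Grouping m par b m acc gid gr exit closed) (hp : ∀ x < m, x < par x ∧ par x ≤ m) :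
    b * ((Finset.range (m + 1)).image (cluster m par gr closed)).card ≤ m + b := by
  have h1 : ((Finset.range (m + 1)).image (cluster m par gr closed)).card ≤
      ((Finset.range m).filter fun g => closed g ≠ 0).card + 1 := by
    refine (Finset.card_le_card ?_).trans (Finset.card_insert_le m _)
    intro g hg
    obtain ⟨x, hx, rfl⟩ := Finset.mem_image.1 hg
    exact cluster_mem h hp x (by have := Finset.mem_range.1 hx; omega)
  have h2 := h.count
  have h3 := Nat.mul_le_mul_left b h1
  rw [mul_add, mul_one] at h3
  omega

theorem clusterCount_eq {K : ℕ → ℕ} {x : ℕ} (hx : x ≤ m) (c : ℕ) :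
    clusterCount m K x c = clusterCount m K (x + 1) c + if K x = c then 1 else 0 := by
  unfold clusterCount
  split_ifs with h
  · rw [← Finset.card_insert_of_notMem (a := x)]
    · congr 1; ext y
      simp only [Finset.mem_filter, Finset.mem_range, Finset.mem_insert]
      constructor
      · rintro ⟨h1, h2, h3⟩
        by_cases hy : y = x
        · exact Or.inl hy
        · exact Or.inr ⟨h1, by omega, h3⟩
      · rintro (rfl | ⟨h1, h2, h3⟩)
        · exact ⟨by omega, le_rfl, h⟩
        · exact ⟨h1, by omega, h3⟩
    · simp
  · rw [add_zero]
    congr 1; ext y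
    simp only [Finset.mem_filter, Finset.mem_range]
    constructor
    · rintro ⟨h1, h2, h3⟩
      refine ⟨h1, ?_, h3⟩
      by_contra hc
      have : y = x := by omega
      exact h (this ▸ h3)
    · rintro ⟨h1, h2, h3⟩
      exact ⟨h1, by omega, h3⟩

theorem clusterCount_anti {K : ℕ → ℕ} {x y : ℕ} (hxy : x ≤ y) (c : ℕ) :
    clusterCount m K y c ≤ clusterCount m K x c := by
  unfold clusterCount
  refine Finset.card_le_card fun z hz => ?_
  simp only [Finset.mem_filter] at hz ⊢
  exact ⟨hz.1, by omega, hz.2.2⟩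

theorem clusterCount_lt {K : ℕ → ℕ} {x y : ℕ} (hxy : x < y) (hy : y ≤ m) :
    clusterCount m K (y + 1) (K y) < clusterCount m K (x + 1) (K y) := by
  have h1 := clusterCount_eq hy (K y) (K := K)
  rw [if_pos rfl] at h1
  have h2 := clusterCount_anti (m := m) (K := K) (show x + 1 ≤ y by omega) (K y)
  omega

end cluster

/-- The micro level of the search for marked ancestors. Each vertex `x` has a rank `rk x` in its
cluster `cl x`, which decreases towards the root; `pw x = 2 ^ rk x` is the bit of `x`, and the mask
`anc x` consists of the bits of those ancestors of `x`, including itself, that are in its cluster.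
The path from `x` to the root leaves the cluster towards the vertex `exit (cl x)`, unless it is the
cluster of the root `m`. The entry `cl x * T + pw x` of `vt` leads back to `x`. -/
structure Micro (m T : ℕ) (par cl anc pw exit vt rk : ℕ → ℕ) : Prop where
  root : cl m = m ∧ anc m = pw m
  step : ∀ x < m, (cl x = cl (par x) ∧ anc x = anc (par x) ||| pw x) ∨
    (exit (cl x) = par x ∧ cl x ≠ m ∧ anc x = pw x)
  par_gt : ∀ x < m, x < par x
  par_le : ∀ x < m, par x ≤ m
  pw_eq : ∀ x ≤ m, pw x = 2 ^ rk x
  pw_lt : ∀ x ≤ m, 2 * pw x ≤ T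
  rk_lt : ∀ x y, x < y → y ≤ m → cl x = cl y → rk y < rk x
  vt_eq : ∀ x ≤ m, vt (cl x * T + pw x) = x

/-- The invariant of the top-down computation of the clusters, when the vertices from `lo` on have
been treated. The cluster of `x` is `K x`, and `tp x` says that its parent is in another cluster.
The rank of `x` is the number of vertices above `x` in its cluster. -/
structure Down (m T : ℕ) (par K : ℕ → ℕ) (tp : ℕ → Prop) (lo : ℕ)
    (cl anc pw mark vt nxt lab elem size top : ℕ → ℕ) : Prop where
  cl_eq : ∀ x, lo ≤ x → x ≤ m → cl x = K x
  pw_eq : ∀ x, lo ≤ x → x ≤ m → pw x = 2 ^ clusterCount m K (x + 1) (K x)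
  anc_top : ∀ x, lo ≤ x → x ≤ m → tp x → anc x = pw x
  anc_par : ∀ x, lo ≤ x → x ≤ m → ¬ tp x → anc x = anc (par x) ||| pw x
  anc_lt : ∀ x, lo ≤ x → x ≤ m → anc x < T
  nxt_eq : ∀ c, nxt c = if clusterCount m K lo c = 0 then 0 else 2 ^ clusterCount m K lo c
  mark_eq : ∀ c s, (mark c).testBit s = decide (s < clusterCount m K lo c)
  vt_eq : ∀ x, lo ≤ x → x ≤ m → vt (K x * T + 2 ^ clusterCount m K (x + 1) (K x)) = x
  lab_eq : ∀ x, lo ≤ x → x ≤ m → lab (K x) = K x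
  elem_eq : ∀ x, lo ≤ x → x ≤ m → elem (K x * (m + 1)) = K x
  size_eq : ∀ x, lo ≤ x → x ≤ m → size (K x) = 1
  top_eq : ∀ x, lo ≤ x → x ≤ m → top (K x) = K x

namespace Down

variable {m b T : ℕ} {par K : ℕ → ℕ} {tp : ℕ → Prop} {x : ℕ}
  {cl anc pw mark vt nxt lab elem size top : ℕ → ℕ}

theorem pow_le_of_count (hT : T = 2 ^ (2 * b)) (hK : ∀ c, clusterCount m K 0 c < 2 * b) (lo c : ℕ) :
    2 * 2 ^ clusterCount m K lo c ≤ T := by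
  have h1 := clusterCount_anti (m := m) (K := K) (Nat.zero_le lo) c
  have h2 := hK c
  rw [hT, ← pow_succ']
  exact Nat.pow_le_pow_right (by omega) (by omega)

theorem mark_lt (h : Down m T par K tp x cl anc pw mark vt nxt lab elem size top)
    (hT : T = 2 ^ (2 * b)) (hK : ∀ c, clusterCount m K 0 c < 2 * b) (c : ℕ) : mark c < T := by
  have h1 := pow_le_of_count hT hK x c
  have : mark c < 2 ^ clusterCount m K x c := by
    refine Nat.lt_pow_two_of_testBit _ fun s hs => ?_
    rw [h.mark_eq]; simpa using hs
  omega

/-- The vertex `x` gets the next free bit `g` of its cluster `c`. -/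
theorem step (h : Down m T par K tp (x + 1) cl anc pw mark vt nxt lab elem size top)
    (hx : x ≤ m) (hT : T = 2 ^ (2 * b)) (hK : ∀ c, clusterCount m K 0 c < 2 * b)
    (hpar : ∀ y, x ≤ y → y ≤ m → ¬ tp y → x < par y ∧ par y ≤ m) {c a g : ℕ} (hc : c = K x)
    (ha : (tp x ∧ a = 0) ∨ (¬ tp x ∧ a = anc (par x)))
    (hg : g = if nxt c = 0 then 1 else nxt c) :
    Down m T par K tp x (Function.update cl x c) (Function.update anc x (a ||| g))
      (Function.update pw x g) (Function.update mark c (mark c ||| g))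
      (Function.update vt (c * T + g) x) (Function.update nxt c (2 * g))
      (Function.update lab c c) (Function.update elem (c * (m + 1)) c)
      (Function.update size c 1) (Function.update top c c) ∧ (a ||| g) < T ∧ 2 * g ≤ T := by
  have hg' : g = 2 ^ clusterCount m K (x + 1) c := by
    rw [hg, h.nxt_eq]
    split_ifs with h1 h2 h2
    · simp [h1]
    · simp at h2
    · simp at h2
    · rfl
  have h2g : 2 * g ≤ T := by rw [hg']; exact pow_le_of_count hT hK _ _
  have hgp : 0 < g := by rw [hg']; positivity
  have haT : a < T := by
    rcases ha with ⟨_, rfl⟩ | ⟨h1, rfl⟩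
    · omega
    · have := hpar x le_rfl hx h1
      exact h.anc_lt _ (by omega) this.2
  have hor : (a ||| g) < T := by
    rw [hT] at haT ⊢
    exact Nat.or_lt_two_pow haT (by omega)
  have hcnt := fun c' => clusterCount_eq (K := K) hx c'
  have hidx : ∀ y, x < y → y ≤ m →
      K y * T + 2 ^ clusterCount m K (y + 1) (K y) ≠ c * T + g := by
    intro y hxy hy he
    have h1 := pow_le_of_count hT hK (y + 1) (K y)
    have h2 : 0 < 2 ^ clusterCount m K (y + 1) (K y) := by positivity
    have hTp : 0 < T := by omega
    have e1 := congrArg (· / T) he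
    have e2 := congrArg (· % T) he
    simp only [Nat.mul_add_mod_self_right] at e2
    rw [Nat.mod_eq_of_lt (by omega), Nat.mod_eq_of_lt (by omega)] at e2
    have e3 : K y = c := by
      have : K y * T = c * T := by omega
      exact Nat.eq_of_mul_eq_mul_right hTp this
    rw [hg', ← e3] at e2
    have e4 := Nat.pow_right_injective le_rfl e2
    have := clusterCount_lt (K := K) hxy hy
    omega
  have hKidx : ∀ y, K y ≠ c → K y * (m + 1) ≠ c * (m + 1) := fun y hy he =>
    hy (Nat.eq_of_mul_eq_mul_right (by omega) he)
  refine ⟨?_, hor, h2g⟩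
  constructor
  · intro y h1 h2
    rcases Nat.lt_or_eq_of_le h1 with h1 | rfl
    · rw [Function.update_of_ne (by omega)]; exact h.cl_eq y h1 h2
    · simp [hc]
  · intro y h1 h2
    rcases Nat.lt_or_eq_of_le h1 with h1 | rfl
    · rw [Function.update_of_ne (by omega)]; exact h.pw_eq y h1 h2
    · simp [hg', hc]
  · intro y h1 h2 h3
    rcases Nat.lt_or_eq_of_le h1 with h1 | rfl
    · rw [Function.update_of_ne (by omega), Function.update_of_ne (by omega)]
      exact h.anc_top y h1 h2 h3
    · rcases ha with ⟨_, rfl⟩ | ⟨h4, _⟩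
      · simp
      · exact absurd h3 h4
  · intro y h1 h2 h3
    have hpy := hpar y h1 h2 h3
    rw [Function.update_of_ne (a := par y) (by omega)]
    rcases Nat.lt_or_eq_of_le h1 with h1 | rfl
    · rw [Function.update_of_ne (by omega), Function.update_of_ne (by omega)]
      exact h.anc_par y h1 h2 h3
    · rcases ha with ⟨h4, _⟩ | ⟨_, rfl⟩
      · exact absurd h4 h3
      · simp
  · intro y h1 h2
    rcases Nat.lt_or_eq_of_le h1 with h1 | rfl
    · rw [Function.update_of_ne (by omega)]; exact h.anc_lt y h1 h2
    · simpa using hor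
  · intro c'
    by_cases hcc : c' = c
    · subst hcc
      rw [Function.update_self, hcnt, if_pos hc.symm, if_neg (by omega), pow_succ, hg', mul_comm]
    · rw [Function.update_of_ne hcc, hcnt, if_neg (fun h => hcc (h.symm.trans hc.symm) :
        ¬ K x = c'), add_zero]
      exact h.nxt_eq c'
  · intro c' s
    by_cases hcc : c' = c
    · subst hcc
      rw [Function.update_self, hcnt, if_pos hc.symm, Nat.testBit_or, h.mark_eq, hg',
        Nat.testBit_two_pow]
      rw [← Bool.decide_or, decide_eq_decide]
      omega
    · rw [Function.update_of_ne hcc, hcnt, if_neg (fun h => hcc (h.symm.trans hc.symm)), add_zero]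
      exact h.mark_eq c' s
  · intro y h1 h2
    rcases Nat.lt_or_eq_of_le h1 with h1 | rfl
    · rw [Function.update_of_ne (hidx y h1 h2)]; exact h.vt_eq y h1 h2
    · rw [← hc, ← hg', Function.update_self]
  · intro y h1 h2
    by_cases hcc : K y = c
    · rw [hcc, Function.update_self]
    · have : y ≠ x := by rintro rfl; exact hcc hc.symm
      rw [Function.update_of_ne hcc]; exact h.lab_eq y (by omega) h2
  · intro y h1 h2
    by_cases hcc : K y = c
    · rw [hcc, Function.update_self]
    · have : y ≠ x := by rintro rfl; exact hcc hc.symm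
      rw [Function.update_of_ne (hKidx y hcc)]; exact h.elem_eq y (by omega) h2
  · intro y h1 h2
    by_cases hcc : K y = c
    · rw [hcc, Function.update_self]
    · have : y ≠ x := by rintro rfl; exact hcc hc.symm
      rw [Function.update_of_ne hcc]; exact h.size_eq y (by omega) h2
  · intro y h1 h2
    by_cases hcc : K y = c
    · rw [hcc, Function.update_self]
    · have : y ≠ x := by rintro rfl; exact hcc hc.symm
      rw [Function.update_of_ne hcc]; exact h.top_eq y (by omega) h2

end Down

/-- The computation of the clusters from the root downwards. All vertices are marked, and each
cluster forms a class of its own in the structure for merging clusters. -/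
def clusterP : HP :=
  .sto .gr ♯.m ♯.m ;;
  .sto .closed ♯.m 1 ;;
  .for .t .n (
    .asg .x (♯.m - ♯.t) ;;
    .ite (.get .closed (.get .gr ♯.x))
      (.asg .c (.get .gr ♯.x) ;; .asg .a 0)
      (.asg .c (.get .cl (.get .par ♯.x)) ;; .asg .a (.get .anc (.get .par ♯.x))) ;;
    .ite (HE.equal (.get .nxt ♯.c) 0) (.asg .g 1) (.asg .g (.get .nxt ♯.c)) ;;
    .sto .cl ♯.x ♯.c ;;
    .sto .anc ♯.x (HE.or' ♯.a ♯.g) ;;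
    .sto .pw ♯.x ♯.g ;;
    .sto .mark ♯.c (HE.or' (.get .mark ♯.c) ♯.g) ;;
    .sto .vt (♯.c * ♯.T + ♯.g) ♯.x ;;
    .sto .nxt ♯.c (2 * ♯.g) ;;
    .sto .lab ♯.c ♯.c ;;
    .sto .elem (♯.c * (♯.m + 1)) ♯.c ;;
    .sto .size ♯.c 1 ;;
    .sto .top ♯.c ♯.c)

/-- The merging structure before any merge, and the marks of all vertices. -/
structure Fresh (m : ℕ) (cl rk mark lab elem size top : ℕ → ℕ) : Prop where
  mark_bit : ∀ x ≤ m, (mark (cl x)).testBit (rk x) = true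
  lab_eq : ∀ x ≤ m, lab (cl x) = cl x
  elem_eq : ∀ x ≤ m, elem (cl x * (m + 1)) = cl x
  size_eq : ∀ x ≤ m, size (cl x) = 1
  top_eq : ∀ x ≤ m, top (cl x) = cl x

section
variable {D : Data} {c : Ctx} {σ : Store}

theorem clusterP_spec (hD : D.Ok) (hc : Big D c) (hE : Env D σ)
    (hR : Rooted D (σ.arr .pos) (σ.arr .par) (σ.arr .eid))
    (hT : Table D.n (σ.reg .b) (σ.reg .T) (σ.arr .hb))
    (hG : Grouping (D.n - 1) (σ.arr .par) (σ.reg .b) (D.n - 1)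
      (σ.arr .acc) (σ.arr .gid) (σ.arr .gr) (σ.arr .exit) (σ.arr .closed))
    (hmark : ∀ x, σ.arr .mark x = 0) (hnxt : ∀ x, σ.arr .nxt x = 0) :
    Runs c clusterP σ fun σ' => ∃ rk,
      Micro (D.n - 1) (σ'.reg .T) (σ'.arr .par) (σ'.arr .cl) (σ'.arr .anc) (σ'.arr .pw)
        (σ'.arr .exit) (σ'.arr .vt) rk ∧
      Fresh (D.n - 1) (σ'.arr .cl) rk (σ'.arr .mark) (σ'.arr .lab) (σ'.arr .elem) (σ'.arr .size)
        (σ'.arr .top) ∧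
      (∀ x, σ'.arr .mark x < σ'.reg .T) ∧
      (∀ x ≤ D.n - 1, σ'.arr .anc x < σ'.reg .T) ∧
      (∀ x ≤ D.n - 1, σ'.arr .cl x ≤ D.n - 1) ∧
      σ'.reg .b * ((Finset.range D.n).image (σ'.arr .cl)).card ≤ D.n + σ'.reg .b ∧
      σ'.tm ≤ σ.tm + 30 * D.n := by
  have hX := hc.hX
  have hn := hD.n_pos
  have hTle := hT.T_le
  set m := D.n - 1 with hm
  have hp : ∀ x < m, x < σ.arr .par x ∧ σ.arr .par x ≤ m := fun x hx =>
    ⟨hR.par_gt x hx, by have := hR.par_lt x hx; omega⟩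
  set K := cluster m (σ.arr .par) (σ.arr .gr) (σ.arr .closed) with hK
  have hKc : ∀ M, clusterCount m K 0 M < 2 * σ.reg .b := hG.card_cluster hp
  have hKm : ∀ x ≤ m, K x ≤ m := by
    intro x hx
    have : K x ∈ _ := cluster_mem hG hp x hx
    simp only [Finset.mem_insert, Finset.mem_filter, Finset.mem_range] at this
    omega
  set tp : ℕ → Prop := fun x => x = m ∨ σ.arr .closed (σ.arr .gr x) ≠ 0 with htp
  rw [clusterP, Runs.seq_iff, Runs.sto_iff]
  refine ⟨by simp, by simp, by simp, by simp [hE.m]; omega, ?_⟩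
  rw [Runs.seq_iff, Runs.sto_iff]
  refine ⟨by simp, by simp, by simp, by simp; omega, ?_⟩
  have hEm : σ.reg .m = m := hE.m
  refine Runs.for_rule rfl rfl (by simp) D.n (by simpa using hE.n) (by omega) (fun t σ' =>
    Down m (σ.reg .T) (σ.arr .par) K tp (D.n - t) (σ'.arr .cl) (σ'.arr .anc) (σ'.arr .pw)
      (σ'.arr .mark) (σ'.arr .vt) (σ'.arr .nxt) (σ'.arr .lab) (σ'.arr .elem) (σ'.arr .size)
      (σ'.arr .top) ∧ σ'.tm ≤ σ.tm + 3 + 20 * t) ?_ ?_ ?_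
  · refine ⟨?_, by simp⟩
    have h0 : ∀ c, clusterCount m K D.n c = 0 := by
      intro c
      rw [clusterCount, Finset.card_eq_zero]
      refine Finset.filter_eq_empty_iff.2 fun y hy => ?_
      have := Finset.mem_range.1 hy
      omega
    constructor <;> intros <;> first | omega | simp [h0, hnxt, hmark]
  · intro t σ' ht hF hr ⟨hDn, htm⟩
    have f1 : σ'.arr .gr = Function.update (σ.arr .gr) m m := by
      simpa [hEm] using hF.arr .gr rfl
    have f2 : σ'.arr .closed = Function.update (σ.arr .closed) m 1 := by
      simpa [hEm] using hF.arr .closed rfl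
    have f3 : σ'.arr .par = σ.arr .par := by simpa using hF.arr .par rfl
    have f4 : σ'.reg .T = σ.reg .T := by simpa using hF.reg .T rfl
    have f5 : σ'.reg .m = m := by simpa [hEm] using hF.reg .m rfl
    obtain ⟨x, hx⟩ : ∃ x, x = m - t := ⟨_, rfl⟩
    have hxm : x ≤ m := by omega
    rw [show D.n - t = x + 1 by omega] at hDn
    rw [show D.n - (t + 1) = x by omega]
    have hpar : ∀ y, x ≤ y → y ≤ m → ¬ tp y → x < σ.arr .par y ∧ σ.arr .par y ≤ m := by
      intro y h1 h2 h3
      have : y ≠ m := fun h => h3 (Or.inl h)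
      have := hp y (by omega)
      omega
    have stp := fun a g => hDn.step (a := a) (g := g) hxm hT.T_eq hKc hpar rfl
    have hml := hDn.mark_lt hT.T_eq hKc
    have hcond : Function.update (σ.arr .closed) m 1 (Function.update (σ.arr .gr) m m x) = 0 ↔
        ¬ tp x := by
      rcases Nat.lt_or_eq_of_le hxm with h | rfl
      · have := hG.gr_le x h
        rw [Function.update_of_ne (a := x) (by omega), Function.update_of_ne (by omega)]
        simp only [htp]; omega
      · simp [htp]
    have hcT : tp x → Function.update (σ.arr .gr) m m x = K x := by
      intro h
      rcases Nat.lt_or_eq_of_le hxm with h' | rfl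
      · rw [Function.update_of_ne (by omega), hK, cluster_of_closed h']
        rcases h with h | h
        · omega
        · exact h
      · rw [hK, cluster_root]; simp
    have hcF : ¬ tp x →
        σ'.arr .cl (σ.arr .par x) = K x ∧ σ'.arr .anc (σ.arr .par x) < σ.reg .T := by
      intro h
      have h1 := hpar x le_rfl hxm h
      refine ⟨?_, hDn.anc_lt _ (by omega) h1.2⟩
      rw [hDn.cl_eq _ (by omega) h1.2, hK]
      simp only [htp, not_or, not_not] at h
      exact (cluster_of_open (by omega) (by omega) h.2).symm
    have hKx := hKm x hxm
    have hor : ∀ g, 2 * g ≤ σ.reg .T → 0 < g → (σ'.arr .mark (K x) ||| g) < σ.reg .T := by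
      intro g hg hg0
      have := hml (K x)
      rw [hT.T_eq] at this hg ⊢
      exact Nat.or_lt_two_pow this (by omega)
    simp only [Runs.seq_iff, Runs.asg_iff, Runs.sto_iff, Runs.ite_iff]
    simp only [Store.reg_set_self, Store.reg_set_of_ne, Store.arr_set, Store.reg_tick,
      Store.arr_tick, Store.tm_set, Store.tm_put, Store.tm_tick, Store.reg_put,
      Store.arr_put_self, Store.arr_put_of_ne, HE.val_sub, HE.val_var, HE.val_get, HE.ok_sub,
      HE.ok_var, HE.ok_get, hr, f1, f2, f3, f4, f5, ← hx, hcond, ne_eq, not_not,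
      HE.val_equal, HE.val_or, HE.val_add, HE.val_mul, HE.val_ofNat, HE.ok_ofNat,
      HE.ok_add, HE.ok_mul, HE.ok_or, HE.ok_equal, reduceCtorEq,
      not_false_eq_true, false_imp_iff, true_and, and_self, ite_eq_right_iff,
      one_ne_zero, imp_false]
    refine ⟨by omega, by omega, fun htop => ?_, fun htop => ?_⟩
    · rw [hcT htop]
      have stp0 := fun g => stp 0 g (Or.inl ⟨htop, rfl⟩)
      refine ⟨by omega, by omega, fun hz => ?_, fun hz => ?_⟩
      · obtain ⟨s1, s2, s3⟩ := stp0 1 (by simp [hz])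
        have := hor 1 s3 (by omega)
        repeat refine ⟨by omega, ?_⟩
        omega
      · obtain ⟨s1, s2, s3⟩ := stp0 (σ'.arr .nxt (K x)) (by simp [hz])
        have := hor _ s3 (by omega)
        repeat refine ⟨by omega, ?_⟩
        omega
    · obtain ⟨hcF1, hcF2⟩ := hcF htop
      rw [hcF1]
      have stp0 := fun g => stp (σ'.arr .anc (σ.arr .par x)) g (Or.inr ⟨htop, rfl⟩)
      refine ⟨by omega, by omega, fun hz => ?_, fun hz => ?_⟩
      · obtain ⟨s1, s2, s3⟩ := stp0 1 (by simp [hz])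
        have := hor 1 s3 (by omega)
        repeat refine ⟨by omega, ?_⟩
        omega
      · obtain ⟨s1, s2, s3⟩ := stp0 (σ'.arr .nxt (K x)) (by simp [hz])
        have := hor _ s3 (by omega)
        repeat refine ⟨by omega, ?_⟩
        omega
  · rintro σ' hF - ⟨hDn, htm⟩
    have f3 : σ'.arr .par = σ.arr .par := by simpa using hF.arr .par rfl
    have f4 : σ'.reg .T = σ.reg .T := by simpa using hF.reg .T rfl
    have f5 : σ'.reg .b = σ.reg .b := by simpa using hF.reg .b rfl
    have f6 : σ'.arr .exit = σ.arr .exit := by simpa using hF.arr .exit rfl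
    rw [Nat.sub_self] at hDn
    have hcl : ∀ x ≤ m, σ'.arr .cl x = K x := fun x hx => hDn.cl_eq x (Nat.zero_le _) hx
    refine ⟨fun x => clusterCount m K (x + 1) (K x), ?_, ?_, ?_, ?_, ?_, ?_, ?_⟩
    · simp only [Store.arr_tick, Store.reg_tick, f3, f4, f6]
      constructor
      · rw [hcl m le_rfl, hK, cluster_root]
        exact ⟨rfl, hDn.anc_top m (Nat.zero_le _) le_rfl (Or.inl rfl)⟩
      · intro x hx
        have h1 := hp x hx
        rw [hcl x hx.le, hcl _ h1.2]
        by_cases htx : tp x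
        · right
          have h2 : σ.arr .closed (σ.arr .gr x) ≠ 0 := by
            rcases htx with h | h
            · omega
            · exact h
          have h3 := hG.gr_le x hx
          rw [hK, cluster_of_closed hx h2]
          exact ⟨hG.exit_gr x hx, by omega, hDn.anc_top x (Nat.zero_le _) hx.le htx⟩
        · left
          refine ⟨?_, hDn.anc_par x (Nat.zero_le _) hx.le htx⟩
          simp only [htp, not_or, not_not] at htx
          exact cluster_of_open hx h1.1 htx.2
      · exact fun x hx => (hp x hx).1
      · exact fun x hx => (hp x hx).2
      · exact fun x hx => hDn.pw_eq x (Nat.zero_le _) hx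
      · intro x hx
        rw [hDn.pw_eq x (Nat.zero_le _) hx]
        exact Down.pow_le_of_count hT.T_eq hKc _ _
      · intro x y hxy hy he
        rw [hcl x (by omega), hcl y hy] at he
        simp only [he]
        exact clusterCount_lt hxy hy
      · intro x hx
        rw [hcl x hx, hDn.pw_eq x (Nat.zero_le _) hx]
        exact hDn.vt_eq x (Nat.zero_le _) hx
    · simp only [Store.arr_tick]
      constructor <;> intro x hx <;> rw [hcl x hx]
      · rw [hDn.mark_eq, decide_eq_true_iff]
        have h1 := clusterCount_eq (K := K) hx (K x)
        rw [if_pos rfl] at h1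
        have h2 := clusterCount_anti (m := m) (K := K) (Nat.zero_le x) (K x)
        omega
      · exact hDn.lab_eq x (Nat.zero_le _) hx
      · exact hDn.elem_eq x (Nat.zero_le _) hx
      · exact hDn.size_eq x (Nat.zero_le _) hx
      · exact hDn.top_eq x (Nat.zero_le _) hx
    · simp only [Store.arr_tick, Store.reg_tick, f4]
      exact hDn.mark_lt hT.T_eq hKc
    · simp only [Store.arr_tick, Store.reg_tick, f4]
      exact fun x hx => hDn.anc_lt x (Nat.zero_le _) hx
    · intro x hx
      simp only [Store.arr_tick]
      rw [hcl x hx]; exact hKm x hx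
    · simp only [Store.arr_tick, Store.reg_tick, f5]
      have h1 : (Finset.range D.n).image (σ'.arr .cl) = (Finset.range (m + 1)).image K := by
        rw [show m + 1 = D.n by omega]
        refine Finset.image_congr fun x hx => hcl x ?_
        have := Finset.mem_range.1 (Finset.mem_coe.1 hx)
        omega
      rw [h1]
      have : σ.reg .b * ((Finset.range (m + 1)).image K).card ≤ m + σ.reg .b :=
        card_clusters hG hp
      omega
    · simp; omega

end

/-! ### Nearest marked ancestors -/

/-- `y` is reached from `x` by going up over vertices that are not marked. -/
def Skip (m : ℕ) (par : ℕ → ℕ) (mk : ℕ → Prop) : ℕ → ℕ → Prop :=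
  Relation.ReflTransGen fun a b => a < m ∧ ¬ mk a ∧ b = par a

section micro

variable {m b T n : ℕ} {par cl anc pw exit vt rk hb mark : ℕ → ℕ} {mk : ℕ → Prop}

theorem Skip.step {x y : ℕ} (hx : x < m) (h : ¬ mk x) (hs : Skip m par mk (par x) y) :
    Skip m par mk x y :=
  Relation.ReflTransGen.head ⟨hx, h, rfl⟩ hs

theorem Skip.le (hp : ∀ x < m, x < par x) {x y : ℕ} (h : Skip m par mk x y) : x ≤ y := by
  induction h with
  | refl => exact le_rfl
  | tail _ h ih =>
    obtain ⟨h1, _, rfl⟩ := h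
    have := hp _ h1
    omega

theorem Skip.mono {mk' : ℕ → Prop} (hm : ∀ x, mk' x → mk x) {x y : ℕ}
    (h : Skip m par mk x y) : Skip m par mk' x y := by
  induction h with
  | refl => exact Relation.ReflTransGen.refl
  | tail _ h ih => exact ih.tail ⟨h.1, fun h' => h.2.1 (hm _ h'), h.2.2⟩

namespace Micro

theorem induction_top (h : Micro m T par cl anc pw exit vt rk) {P : ℕ → Prop} (h0 : P m)
    (hs : ∀ x < m, P (par x) → P x) : ∀ x ≤ m, P x := by
  intro x
  induction hk : m - x using Nat.strong_induction_on generalizing x with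
  | _ k ih =>
    intro hx
    rcases Nat.lt_or_eq_of_le hx with hx | rfl
    · have h1 := h.par_gt x hx
      have h2 := h.par_le x hx
      exact hs x hx (ih (m - par x) (by omega) (par x) rfl h2)
    · exact h0

theorem exit_gt (h : Micro m T par cl anc pw exit vt rk) :
    ∀ x ≤ m, cl x ≠ m → x < exit (cl x) ∧ exit (cl x) ≤ m := by
  refine h.induction_top (fun h0 => absurd h.root.1 h0) fun x hx ih hne => ?_
  have h1 := h.par_gt x hx
  have h2 := h.par_le x hx
  rcases h.step x hx with ⟨h3, _⟩ | ⟨h3, _, _⟩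
  · rw [h3] at hne ⊢
    have := ih hne
    omega
  · omega

/-- The highest bit of the mask of the ancestors of `x` in its cluster is the bit of `x`. -/
theorem anc_bits (h : Micro m T par cl anc pw exit vt rk) :
    ∀ x ≤ m, anc x < 2 ^ (rk x + 1) ∧ (anc x).testBit (rk x) = true := by
  have hpow : ∀ x ≤ m, anc x = pw x → anc x < 2 ^ (rk x + 1) ∧ (anc x).testBit (rk x) = true := by
    intro x hx he
    rw [he, h.pw_eq x hx]
    exact ⟨Nat.pow_lt_pow_right (by omega) (by omega), by simp⟩
  refine h.induction_top (hpow m le_rfl h.root.2) fun x hx ih => ?_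
  rcases h.step x hx with ⟨h3, h4⟩ | ⟨_, _, h4⟩
  · rw [h4, h.pw_eq x hx.le]
    have h5 := h.rk_lt x (par x) (h.par_gt x hx) (h.par_le x hx) h3
    refine ⟨Nat.or_lt_two_pow (lt_of_lt_of_le ih.1 (Nat.pow_le_pow_right (by omega) (by omega)))
      (Nat.pow_lt_pow_right (by omega) (by omega)), by simp [Nat.testBit_or]⟩
  · exact hpow x hx.le h4

/-- The search within one cluster: the highest bit of the mask of the ancestors of `x` in its
cluster, restricted to the marked vertices, is the bit of the nearest marked ancestor. If there is
no bit, the search goes on at the exit of the cluster. -/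
theorem search (h : Micro m T par cl anc pw exit vt rk) (hb' : Table n b T hb)
    (hanc : ∀ x ≤ m, anc x < T) (hmark : ∀ x ≤ m, (mark (cl x)).testBit (rk x) = true ↔ mk x)
    (hroot : mk m) : ∀ x ≤ m,
      (mark (cl x) &&& anc x ≠ 0 → ∃ y ≤ m, vt (cl x * T + hb (mark (cl x) &&& anc x)) = y ∧
        Skip m par mk x y ∧ mk y) ∧
      (mark (cl x) &&& anc x = 0 → cl x ≠ m ∧ Skip m par mk x (exit (cl x))) := by
  have hmarked : ∀ x ≤ m, mk x →
      (mark (cl x) &&& anc x ≠ 0 → ∃ y ≤ m, vt (cl x * T + hb (mark (cl x) &&& anc x)) = y ∧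
        Skip m par mk x y ∧ mk y) ∧
      (mark (cl x) &&& anc x = 0 → cl x ≠ m ∧ Skip m par mk x (exit (cl x))) := by
    intro x hx hmx
    obtain ⟨h1, h2⟩ := h.anc_bits x hx
    have h3 : (mark (cl x) &&& anc x).testBit (rk x) = true := by
      rw [Nat.testBit_and, h2, (hmark x hx).2 hmx]; rfl
    have h4 : mark (cl x) &&& anc x ≤ anc x := Nat.and_le_right
    have h5 := Nat.ge_two_pow_of_testBit h3
    have h6 : 0 < 2 ^ rk x := by positivity
    refine ⟨fun _ => ⟨x, hx, ?_, Relation.ReflTransGen.refl, hmx⟩, fun h0 => by omega⟩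
    obtain ⟨t, ht1, ht2, ht3⟩ := hb'.hb_eq (mark (cl x) &&& anc x)
      (by have := hanc x hx; omega) (by omega)
    have h7 : rk x < t + 1 := (Nat.pow_lt_pow_iff_right (a := 2) (by omega)).1 (by omega)
    have h8 : t < rk x + 1 := (Nat.pow_lt_pow_iff_right (a := 2) (by omega)).1 (by omega)
    have h9 : t = rk x := by omega
    rw [ht1, h9, ← h.pw_eq x hx]
    exact h.vt_eq x hx
  refine h.induction_top (hmarked m le_rfl hroot) fun x hx ih => ?_
  by_cases hmx : mk x
  · exact hmarked x hx.le hmx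
  have hbit : (mark (cl x)).testBit (rk x) = false := by
    rw [← Bool.not_eq_true]; exact fun h' => hmx ((hmark x hx.le).1 h')
  have hand : mark (cl x) &&& pw x = 0 := by
    rw [h.pw_eq x hx.le]
    apply Nat.eq_of_testBit_eq
    intro i
    rw [Nat.testBit_and, Nat.testBit_two_pow, Nat.zero_testBit]
    by_cases hi : rk x = i
    · rw [← hi, hbit]; rfl
    · simp [hi]
  rcases h.step x hx with ⟨h3, h4⟩ | ⟨h3, h4, h5⟩
  · have h5 : mark (cl x) &&& anc x = mark (cl (par x)) &&& anc (par x) := by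
      rw [h4, Nat.and_or_distrib_left, hand, Nat.or_zero, h3]
    rw [h5, h3]
    refine ⟨fun h0 => ?_, fun h0 => ?_⟩
    · obtain ⟨y, h6, h7, h8, h9⟩ := ih.1 h0
      exact ⟨y, h6, h7, h8.step hx hmx, h9⟩
    · exact ⟨(ih.2 h0).1, (ih.2 h0).2.step hx hmx⟩
  · rw [h5, hand]
    refine ⟨fun h0 => absurd rfl h0, fun _ => ⟨h4, ?_⟩⟩
    rw [h3]
    exact Skip.step hx hmx Relation.ReflTransGen.refl

end Micro

end micro

/-! ### Merging classes of clusters -/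

/-- The classes of clusters. The members of the class with label `g` are listed in the entries
`g * n, …, g * n + size g - 1` of `elem`. -/
structure Classes (Cs : Finset ℕ) (n : ℕ) (lab elem size : ℕ → ℕ) : Prop where
  lab_mem : ∀ c ∈ Cs, lab c ∈ Cs
  size_eq : ∀ g ∈ Cs, size g = (Cs.filter fun c => lab c = g).card
  elem_mem : ∀ g ∈ Cs, ∀ t < size g, elem (g * n + t) ∈ Cs ∧ lab (elem (g * n + t)) = g
  elem_surj : ∀ c ∈ Cs, ∃ t < size (lab c), elem (lab c * n + t) = c

/-- The potential: each cluster contributes the logarithm of the size of its class. A merge raises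
it at least by the number of relabelled clusters. -/
def potential (Cs : Finset ℕ) (lab : ℕ → ℕ) : ℕ :=
  ∑ c ∈ Cs, Nat.log 2 (Cs.filter fun c' => lab c' = lab c).card

theorem potential_le (Cs : Finset ℕ) (lab : ℕ → ℕ) :
    potential Cs lab ≤ Cs.card * Nat.log 2 Cs.card := by
  rw [← smul_eq_mul]
  exact Finset.sum_le_card_nsmul _ _ _ fun c _ =>
    Nat.log_mono_right (Finset.card_le_card (Finset.filter_subset _ _))

section classes

variable {Cs : Finset ℕ} {n : ℕ} {lab elem size lab' elem' : ℕ → ℕ} {src dst : ℕ}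

theorem mul_add_inj {a b s t : ℕ} (hs : s < n) (ht : t < n) (h : a * n + s = b * n + t) :
    a = b ∧ s = t := by
  have e2 := congrArg (· % n) h
  simp only [Nat.mul_add_mod_self_right] at e2
  rw [Nat.mod_eq_of_lt hs, Nat.mod_eq_of_lt ht] at e2
  exact ⟨Nat.eq_of_mul_eq_mul_right (show 0 < n by omega) (by omega), e2⟩

theorem filter_merge_dst (hlab : ∀ c ∈ Cs, lab' c = if lab c = src then dst else lab c)
    (hne : src ≠ dst) : (Cs.filter fun c => lab' c = dst).card =
      (Cs.filter fun c => lab c = dst).card + (Cs.filter fun c => lab c = src).card := by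
  rw [← Finset.card_union_of_disjoint]
  · congr 1
    ext c
    simp only [Finset.mem_filter, Finset.mem_union]
    constructor
    · rintro ⟨h1, h2⟩
      rw [hlab c h1] at h2
      split_ifs at h2 with h3
      · exact Or.inr ⟨h1, h3⟩
      · exact Or.inl ⟨h1, h2⟩
    · rintro (⟨h1, h2⟩ | ⟨h1, h2⟩)
      · refine ⟨h1, ?_⟩
        rw [hlab c h1, h2, if_neg (Ne.symm hne)]
      · exact ⟨h1, by rw [hlab c h1, if_pos h2]⟩
  · rw [Finset.disjoint_filter]
    rintro c _ h1 h2
    exact hne (h2.symm.trans h1)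

theorem filter_merge_of_ne (hlab : ∀ c ∈ Cs, lab' c = if lab c = src then dst else lab c)
    {g : ℕ} (h1 : g ≠ src) (h2 : g ≠ dst) :
    (Cs.filter fun c => lab' c = g) = Cs.filter fun c => lab c = g := by
  refine Finset.filter_congr fun c hc => ?_
  rw [hlab c hc]
  split_ifs with h3
  · constructor
    · intro h; exact absurd h.symm h2
    · intro h; exact absurd (h.symm.trans h3) h1
  · rfl

theorem Classes.size_add_le (h : Classes Cs n lab elem size) (hs : src ∈ Cs) (hd : dst ∈ Cs)
    (hne : src ≠ dst) : size src + size dst ≤ Cs.card := by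
  rw [h.size_eq _ hs, h.size_eq _ hd, ← Finset.card_union_of_disjoint]
  · exact Finset.card_le_card (Finset.union_subset (Finset.filter_subset _ _)
      (Finset.filter_subset _ _))
  · rw [Finset.disjoint_filter]
    rintro c _ h1 h2
    exact hne (h1.symm.trans h2)

theorem Classes.merge (h : Classes Cs n lab elem size) (hs : src ∈ Cs) (hd : dst ∈ Cs)
    (hne : src ≠ dst) (hn : Cs.card ≤ n)
    (hlab : ∀ c ∈ Cs, lab' c = if lab c = src then dst else lab c)
    (helem1 : ∀ t < size src, elem' (dst * n + (size dst + t)) = elem (src * n + t))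
    (helem2 : ∀ j, (∀ t < size src, j ≠ dst * n + (size dst + t)) → elem' j = elem j) :
    Classes Cs n lab' elem'
      (Function.update (Function.update size dst (size dst + size src)) src 0) := by
  have hsz := h.size_add_le hs hd hne
  have hlt : ∀ g ∈ Cs, size g ≤ n := fun g hg => by
    rw [h.size_eq g hg]
    exact (Finset.card_le_card (Finset.filter_subset _ _)).trans hn
  have hsrc : ∀ c ∈ Cs, lab' c ≠ src := by
    intro c hc he
    rw [hlab c hc] at he
    split_ifs at he with h3
    · exact hne he.symm
    · exact h3 he
  constructor
  · intro c hc
    rw [hlab c hc]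
    split_ifs
    · exact hd
    · exact h.lab_mem c hc
  · intro g hg
    by_cases h1 : g = src
    · subst h1
      rw [Function.update_self]
      symm
      rw [Finset.card_eq_zero]
      exact Finset.filter_eq_empty_iff.2 fun c hc => hsrc c hc
    · rw [Function.update_of_ne h1]
      by_cases h2 : g = dst
      · subst h2
        rw [Function.update_self, filter_merge_dst hlab hne, h.size_eq _ hs, h.size_eq _ hg]
      · rw [Function.update_of_ne h2, filter_merge_of_ne hlab h1 h2, h.size_eq _ hg]
  · intro g hg t ht
    by_cases h1 : g = src
    · subst h1; simp at ht
    · rw [Function.update_of_ne h1] at ht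
      by_cases h2 : g = dst
      · subst h2
        rw [Function.update_self] at ht
        rcases Nat.lt_or_ge t (size g) with h3 | h3
        · rw [helem2 _ (fun s _ => by omega)]
          have := h.elem_mem g hg t h3
          exact ⟨this.1, by rw [hlab _ this.1, this.2, if_neg h1]⟩
        · obtain ⟨s, rfl⟩ := Nat.exists_eq_add_of_le h3
          rw [helem1 s (by omega)]
          have := h.elem_mem src hs s (by omega)
          exact ⟨this.1, by rw [hlab _ this.1, if_pos this.2]⟩
      · rw [Function.update_of_ne h2] at ht
        have := h.elem_mem g hg t ht
        have hg' := hlt g hg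
        rw [helem2 _ (fun s hs' he => h2 (mul_add_inj (by omega) (by omega) he).1)]
        exact ⟨this.1, by rw [hlab _ this.1, this.2, if_neg h1]⟩
  · intro c hc
    obtain ⟨t, ht, he⟩ := h.elem_surj c hc
    rw [Function.update_of_ne (hsrc c hc), hlab c hc]
    have hl := hlt (lab c) (h.lab_mem c hc)
    split_ifs with h3
    · rw [Function.update_self]
      rw [h3] at ht he
      exact ⟨size dst + t, by omega, by rw [helem1 t ht, he]⟩
    · by_cases h4 : lab c = dst
      · rw [h4, Function.update_self]
        rw [h4] at ht he
        exact ⟨t, by omega, by rw [helem2 _ (fun s _ => by omega), he]⟩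
      · rw [Function.update_of_ne h4]
        refine ⟨t, ht, ?_⟩
        rw [helem2 _ (fun s hs' he' => h4 (mul_add_inj (by omega) (by omega) he').1), he]

/-- Each relabelled cluster at least doubles the size of its class. -/
theorem potential_merge (hlab : ∀ c ∈ Cs, lab' c = if lab c = src then dst else lab c)
    (hne : src ≠ dst)
    (hle : (Cs.filter fun c => lab c = src).card ≤ (Cs.filter fun c => lab c = dst).card) :
    potential Cs lab + (Cs.filter fun c => lab c = src).card ≤ potential Cs lab' := by
  unfold potential
  rw [Finset.card_filter (fun c => lab c = src), ← Finset.sum_add_distrib]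
  refine Finset.sum_le_sum fun c hc => ?_
  by_cases h1 : lab c = src
  · have hpos : 0 < (Cs.filter fun c' => lab c' = src).card :=
      Finset.card_pos.2 ⟨c, Finset.mem_filter.2 ⟨hc, h1⟩⟩
    have h2 : lab' c = dst := by rw [hlab c hc, if_pos h1]
    rw [h1, h2, if_pos rfl, filter_merge_dst hlab hne, ← Nat.log_mul_base (by omega) (by omega)]
    exact Nat.log_mono_right (by omega)
  · have h2 : lab' c = lab c := by rw [hlab c hc, if_neg h1]
    rw [if_neg h1, add_zero, h2]
    by_cases h3 : lab c = dst
    · rw [h3, filter_merge_dst hlab hne]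
      exact Nat.log_mono_right (by omega)
    · rw [filter_merge_of_ne hlab h1 h3]

end classes

/-- Moving the members of the class `g` to the class `d`, whose new top is `z`. -/
def relabelP : HP :=
  .asg .s (.get .size ♯.g) ;;
  .asg .q (.get .size ♯.d) ;;
  .for .t .s (
    .asg .e (.get .elem (♯.g * ♯.n + ♯.t)) ;;
    .sto .lab ♯.e ♯.d ;;
    .sto .elem (♯.d * ♯.n + (♯.q + ♯.t)) ♯.e) ;;
  .sto .size ♯.d (♯.q + ♯.s) ;;
  .sto .size ♯.g 0 ;;
  .sto .top ♯.d ♯.z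

/-- Merging the classes with labels `g` and `d` by relabelling the smaller one. The top of the new
class is the top of the class `d`. -/
def mergeP : HP :=
  .asg .z (.get .top ♯.d) ;;
  .ite (HE.less (.get .size ♯.d) (.get .size ♯.g))
    (.asg .s ♯.d ;; .asg .d ♯.g ;; .asg .g ♯.s) .skip ;;
  relabelP

section
variable {D : Data} {c : Ctx} {σ : Store} {Cs : Finset ℕ}

theorem relabelP_spec (hD : D.Ok) (hc : Big D c) (hE : Env D σ) (hCs : Cs ⊆ Finset.range D.n)
    (hC : Classes Cs D.n (σ.arr .lab) (σ.arr .elem) (σ.arr .size))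
    {src dst : ℕ} (hsrc : σ.reg .g = src) (hdst : σ.reg .d = dst) (hs : src ∈ Cs) (hd : dst ∈ Cs)
    (hne : src ≠ dst) (hz : σ.reg .z < c.X) :
    Runs c relabelP σ fun σ' =>
      Classes Cs D.n (σ'.arr .lab) (σ'.arr .elem) (σ'.arr .size) ∧
      (∀ c ∈ Cs, σ'.arr .lab c = if σ.arr .lab c = src then dst else σ.arr .lab c) ∧
      σ'.arr .top = Function.update (σ.arr .top) dst (σ.reg .z) ∧
      σ'.tm ≤ σ.tm + 10 + 5 * (Cs.filter fun c => σ.arr .lab c = src).card := by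
  have hX := hc.hX
  have hn := hD.n_pos
  have hcard : Cs.card ≤ D.n := by simpa using Finset.card_le_card hCs
  have hsz := hC.size_add_le hs hd hne
  have hsn := Finset.mem_range.1 (hCs hs)
  have hdn := Finset.mem_range.1 (hCs hd)
  have hCsn : ∀ c ∈ Cs, c < D.n := fun c hc => Finset.mem_range.1 (hCs hc)
  rw [← hC.size_eq src hs]
  set S := σ.arr .size src with hS
  set Q := σ.arr .size dst with hQ
  rw [relabelP, Runs.seq_iff, Runs.asg_iff]
  refine ⟨by simp, by simp [hsrc, ← hS]; omega, ?_⟩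
  rw [Runs.seq_iff, Runs.asg_iff]
  refine ⟨by simp, by simp [hdst, ← hQ]; omega, ?_⟩
  rw [Runs.seq_iff]
  refine Runs.for_rule rfl rfl (by simp) S (by simp [hsrc, hS]) (by omega) (fun t σ' =>
    (∀ c, (∃ s < t, σ.arr .elem (src * D.n + s) = c) → σ'.arr .lab c = dst) ∧
    (∀ c, (∀ s < t, σ.arr .elem (src * D.n + s) ≠ c) → σ'.arr .lab c = σ.arr .lab c) ∧
    (∀ s < t, σ'.arr .elem (dst * D.n + (Q + s)) = σ.arr .elem (src * D.n + s)) ∧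
    (∀ j, (∀ s < t, j ≠ dst * D.n + (Q + s)) → σ'.arr .elem j = σ.arr .elem j) ∧
    σ'.tm ≤ σ.tm + 3 + 5 * t) ?_ ?_ ?_
  · simp
  · rintro t σ' ht hF hr ⟨h1, h2, h3, h4, h5⟩
    have f1 : σ'.reg .g = src := by simpa [hsrc] using hF.reg .g rfl
    have f2 : σ'.reg .d = dst := by simpa [hdst] using hF.reg .d rfl
    have f3 : σ'.reg .q = Q := by simpa [hdst, hQ] using hF.reg .q rfl
    have f4 : σ'.reg .n = D.n := by simpa [hE.n] using hF.reg .n rfl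
    have hel : σ'.arr .elem (src * D.n + t) = σ.arr .elem (src * D.n + t) :=
      h4 _ fun s hs' he => hne (mul_add_inj (by omega) (by omega) he).1
    have hem := hC.elem_mem src hs t ht
    have hem' := hCsn _ hem.1
    simp only [Runs.seq_iff, Runs.asg_iff, Runs.sto_iff]
    simp only [Store.reg_set_self, Store.reg_set_of_ne, Store.arr_set, Store.reg_tick,
      Store.arr_tick, Store.tm_set, Store.tm_put, Store.tm_tick, Store.reg_put,
      Store.arr_put_self, Store.arr_put_of_ne, HE.val_var, HE.val_get,
      HE.ok_var, HE.ok_get, hr, f1, f2, f3, f4, ne_eq, HE.val_add, HE.val_mul,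
      HE.ok_add, HE.ok_mul, reduceCtorEq, hel,
      not_false_eq_true, false_imp_iff, true_and, and_self]
    refine ⟨by omega, by omega, by omega, ?_, ?_, ?_, ?_, by omega⟩
    · rintro c ⟨s, hs', rfl⟩
      rcases Nat.lt_succ_iff_lt_or_eq.1 hs' with h | rfl
      · rw [Function.update_apply]
        split_ifs
        · rfl
        · exact h1 _ ⟨s, h, rfl⟩
      · simp
    · intro c hc
      rw [Function.update_of_ne (Ne.symm (hc t (by omega)))]
      exact h2 c fun s hs' => hc s (by omega)
    · intro s hs'
      rcases Nat.lt_succ_iff_lt_or_eq.1 hs' with h | rfl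
      · rw [Function.update_of_ne (by omega)]; exact h3 s h
      · simp
    · intro j hj
      rw [Function.update_of_ne (hj t (by omega))]
      exact h4 j fun s hs' => hj s (by omega)
  · rintro σ' hF - ⟨h1, h2, h3, h4, h5⟩
    have f1 : σ'.reg .g = src := by simpa [hsrc] using hF.reg .g rfl
    have f2 : σ'.reg .d = dst := by simpa [hdst] using hF.reg .d rfl
    have f3 : σ'.reg .q = Q := by simpa [hdst, hQ] using hF.reg .q rfl
    have f4 : σ'.reg .s = S := by simpa [hsrc, hS] using hF.reg .s rfl
    have f5 : σ'.reg .z = σ.reg .z := by simpa using hF.reg .z rfl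
    have f6 : σ'.arr .size = σ.arr .size := by simpa using hF.arr .size rfl
    have f7 : σ'.arr .top = σ.arr .top := by simpa using hF.arr .top rfl
    have hlab : ∀ c ∈ Cs, σ'.arr .lab c = if σ.arr .lab c = src then dst else σ.arr .lab c := by
      intro c hc
      obtain ⟨t, ht, he⟩ := hC.elem_surj c hc
      split_ifs with h
      · rw [h] at ht he
        exact h1 c ⟨t, ht, he⟩
      · refine h2 c fun s hs' he' => h ?_
        rw [← he']
        exact (hC.elem_mem src hs s hs').2
    have hmerge := hC.merge hs hd hne hcard hlab h3 h4
    simp only [Runs.seq_iff, Runs.sto_iff]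
    simp only [Store.arr_tick, Store.reg_tick, Store.tm_put, Store.tm_tick, Store.reg_put,
      Store.arr_put_self, Store.arr_put_of_ne, HE.val_var,
      HE.ok_var, f1, f2, f3, f4, f5, f6, f7, ne_eq, HE.val_add, HE.val_zero,
      HE.ok_add, HE.ok_zero, reduceCtorEq,
      not_false_eq_true, false_imp_iff, true_and, and_self]
    exact ⟨by omega, by omega, by omega, hmerge, hlab, by omega⟩

theorem mergeP_spec (hD : D.Ok) (hc : Big D c) (hE : Env D σ) (hCs : Cs ⊆ Finset.range D.n)
    (hC : Classes Cs D.n (σ.arr .lab) (σ.arr .elem) (σ.arr .size))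
    {c1 c2 : ℕ} (h1 : c1 ∈ Cs) (h2 : c2 ∈ Cs) (hg : σ.reg .g = σ.arr .lab c1)
    (hd : σ.reg .d = σ.arr .lab c2) (hne : σ.arr .lab c1 ≠ σ.arr .lab c2)
    (hz : σ.arr .top (σ.reg .d) < D.n) :
    Runs c mergeP σ fun σ' => ∃ src dst,
      ((src = σ.reg .g ∧ dst = σ.reg .d) ∨ (src = σ.reg .d ∧ dst = σ.reg .g)) ∧
      Classes Cs D.n (σ'.arr .lab) (σ'.arr .elem) (σ'.arr .size) ∧
      (∀ c ∈ Cs, σ'.arr .lab c = if σ.arr .lab c = src then dst else σ.arr .lab c) ∧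
      σ'.arr .top = Function.update (σ.arr .top) dst (σ.arr .top (σ.reg .d)) ∧
      potential Cs (σ.arr .lab) < potential Cs (σ'.arr .lab) ∧
      σ'.tm + 30 * potential Cs (σ.arr .lab) ≤ σ.tm + 30 * potential Cs (σ'.arr .lab) := by
  have hX := hc.hX
  have hn := hD.n_pos
  have hgC := hC.lab_mem c1 h1
  have hdC := hC.lab_mem c2 h2
  have hpos : ∀ c ∈ Cs, 0 < (Cs.filter fun c' => σ.arr .lab c' = σ.arr .lab c).card := fun c hc =>
    Finset.card_pos.2 ⟨c, Finset.mem_filter.2 ⟨hc, rfl⟩⟩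
  have hp1 := hpos c1 h1
  have hp2 := hpos c2 h2
  have hgn := Finset.mem_range.1 (hCs hgC)
  have hdn := Finset.mem_range.1 (hCs hdC)
  have hs1 := hC.size_eq _ hgC
  have hs2 := hC.size_eq _ hdC
  rw [hd] at hz
  rw [hg, hd]
  have key : ∀ (τ : Store) (src dst : ℕ),
      ((src = σ.arr .lab c1 ∧ dst = σ.arr .lab c2) ∨
        (src = σ.arr .lab c2 ∧ dst = σ.arr .lab c1)) →
      Env D τ → τ.arr = σ.arr → τ.reg .g = src → τ.reg .d = dst →
      τ.reg .z = σ.arr .top (σ.arr .lab c2) → σ.arr .size src ≤ σ.arr .size dst →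
      τ.tm ≤ σ.tm + 10 → Runs c relabelP τ fun σ' => ∃ src dst,
      ((src = σ.arr .lab c1 ∧ dst = σ.arr .lab c2) ∨
        (src = σ.arr .lab c2 ∧ dst = σ.arr .lab c1)) ∧
      Classes Cs D.n (σ'.arr .lab) (σ'.arr .elem) (σ'.arr .size) ∧
      (∀ c ∈ Cs, σ'.arr .lab c = if σ.arr .lab c = src then dst else σ.arr .lab c) ∧
      σ'.arr .top = Function.update (σ.arr .top) dst (σ.arr .top (σ.arr .lab c2)) ∧
      potential Cs (σ.arr .lab) < potential Cs (σ'.arr .lab) ∧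
      σ'.tm + 30 * potential Cs (σ.arr .lab) ≤ σ.tm + 30 * potential Cs (σ'.arr .lab) := by
    intro τ src dst hsd hEτ harr hgτ hdτ hzτ hle htm
    have hs : src ∈ Cs := by rcases hsd with ⟨h, -⟩ | ⟨h, -⟩ <;> rw [h] <;> assumption
    have hd : dst ∈ Cs := by rcases hsd with ⟨-, h⟩ | ⟨-, h⟩ <;> rw [h] <;> assumption
    have hne' : src ≠ dst := by
      rcases hsd with ⟨h, h'⟩ | ⟨h, h'⟩ <;> rw [h, h']
      · exact hne
      · exact hne.symm
    have hpos : 0 < (Cs.filter fun c' => σ.arr .lab c' = src).card := by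
      rcases hsd with ⟨h, -⟩ | ⟨h, -⟩ <;> rw [h] <;> assumption
    rw [hC.size_eq _ hs, hC.size_eq _ hd] at hle
    refine (relabelP_spec hD hc hEτ hCs (by rw [harr]; exact hC) hgτ hdτ hs hd hne'
      (by omega)).mono fun σ' _ ⟨q1, q2, q3, q4⟩ => ?_
    rw [harr] at q2 q3 q4
    rw [hzτ] at q3
    have hpot := potential_merge q2 hne' hle
    exact ⟨src, dst, hsd, q1, q2, q3, by omega, by omega⟩
  rw [mergeP, Runs.seq_iff, Runs.asg_iff]
  refine ⟨by simp, by simp [hd]; omega, ?_⟩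
  rw [Runs.seq_iff, Runs.ite_iff]
  refine ⟨by simp, fun hlt => ?_, fun hge => ?_⟩
  · have hlt' : σ.arr .size (σ.arr .lab c2) < σ.arr .size (σ.arr .lab c1) := by
      by_contra hcon
      exact hlt (by simp [hg, hd, hcon])
    rw [Runs.seq_iff, Runs.asg_iff]
    refine ⟨by simp, by simp [hd]; omega, ?_⟩
    rw [Runs.seq_iff, Runs.asg_iff]
    refine ⟨by simp, by simp [hg]; omega, ?_⟩
    rw [Runs.asg_iff]
    refine ⟨by simp, by simp [hd]; omega, ?_⟩
    refine key _ (σ.arr .lab c2) (σ.arr .lab c1) (Or.inr ⟨rfl, rfl⟩)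
      ⟨?_, ?_, ?_, ?_, ?_, ?_, ?_, ?_, ?_⟩ ?_
      (by simp [hd]) (by simp [hg]) (by simp [hd]) hlt'.le (by simp)
    · simpa using hE.n
    · simpa using hE.p
    · simpa using hE.k
    · simpa using hE.m
    · simpa using hE.e1
    · simpa using hE.e2
    · simpa using hE.a
    · simpa using hE.b
    · simpa using hE.wt
    · rfl
  · have hge' : σ.arr .size (σ.arr .lab c1) ≤ σ.arr .size (σ.arr .lab c2) := by
      by_contra hcon
      simp [hg, hd] at hge
      omega
    rw [Runs.skip_iff]
    refine key _ (σ.arr .lab c1) (σ.arr .lab c2) (Or.inl ⟨rfl, rfl⟩)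
      ⟨?_, ?_, ?_, ?_, ?_, ?_, ?_, ?_, ?_⟩ ?_
      (by simp [hg]) (by simp [hd]) (by simp [hd]) hge' (by simp)
    · simpa using hE.n
    · simpa using hE.p
    · simpa using hE.k
    · simpa using hE.m
    · simpa using hE.e1
    · simpa using hE.e2
    · simpa using hE.a
    · simpa using hE.b
    · simpa using hE.wt
    · rfl

end

/-! ### The search for the nearest marked ancestor -/

/-- The set of clusters. -/
def clusters (D : Data) (σ : Store) : Finset ℕ := (Finset.range D.n).image (σ.arr .cl)

/-- The invariant of the search structure. The marked vertices are given by `mk`, and `rk` gives the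
ranks within the clusters. In the class of a cluster `c` no vertex between the exit of `c` and the
exit of the top of the class is marked. -/
structure Finder (D : Data) (rk : ℕ → ℕ) (mk : ℕ → Prop) (σ : Store) : Prop where
  micro : Micro (D.n - 1) (σ.reg .T) (σ.arr .par) (σ.arr .cl) (σ.arr .anc) (σ.arr .pw)
    (σ.arr .exit) (σ.arr .vt) rk
  table : Table D.n (σ.reg .b) (σ.reg .T) (σ.arr .hb)
  anc_lt : ∀ x ≤ D.n - 1, σ.arr .anc x < σ.reg .T
  cl_le : ∀ x ≤ D.n - 1, σ.arr .cl x ≤ D.n - 1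
  mark_lt : ∀ x, σ.arr .mark x < σ.reg .T
  mark : ∀ x ≤ D.n - 1, (σ.arr .mark (σ.arr .cl x)).testBit (rk x) = true ↔ mk x
  root : mk (D.n - 1)
  classes : Classes (clusters D σ) D.n (σ.arr .lab) (σ.arr .elem) (σ.arr .size)
  top : ∀ c ∈ clusters D σ, c ≠ D.n - 1 →
    σ.arr .top (σ.arr .lab c) ∈ clusters D σ ∧ σ.arr .top (σ.arr .lab c) ≠ D.n - 1 ∧
    σ.arr .lab (σ.arr .top (σ.arr .lab c)) = σ.arr .lab c ∧
    Skip (D.n - 1) (σ.arr .par) mk (σ.arr .exit c) (σ.arr .exit (σ.arr .top (σ.arr .lab c)))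

/-- Writing a scalar other than the parameters of the structure, or ticking the clock. -/
theorem Finder.of_eq {D : Data} {rk : ℕ → ℕ} {mk : ℕ → Prop} {σ τ : Store}
    (h : Finder D rk mk σ) (harr : τ.arr = σ.arr) (hb : τ.reg .b = σ.reg .b)
    (hT : τ.reg .T = σ.reg .T) : Finder D rk mk τ := by
  obtain ⟨h1, h2, h3, h4, h5, h6, h7, h8, h9⟩ := h
  have e : clusters D τ = clusters D σ := by simp only [clusters, harr]
  constructor <;> (try simp only [e, harr, hb, hT]) <;> assumption

/-- The potential of the merging structure. -/
def pot (D : Data) (σ : Store) : ℕ := potential (clusters D σ) (σ.arr .lab)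

section
variable {D : Data} {c : Ctx} {σ : Store} {rk : ℕ → ℕ} {mk : ℕ → Prop}

theorem mem_clusters (hD : D.Ok) {x : ℕ} (hx : x ≤ D.n - 1) : σ.arr .cl x ∈ clusters D σ :=
  Finset.mem_image.2 ⟨x, by have := hD.n_pos; simp; omega, rfl⟩

theorem Finder.exit_le (hD : D.Ok) (h : Finder D rk mk σ) {k : ℕ} (hk : k ∈ clusters D σ)
    (hne : k ≠ D.n - 1) : σ.arr .exit k ≤ D.n - 1 := by
  obtain ⟨x, hx, rfl⟩ := Finset.mem_image.1 hk
  have := hD.n_pos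
  exact (h.micro.exit_gt x (by simp at hx; omega) hne).2

theorem Finder.subset (hD : D.Ok) (h : Finder D rk mk σ) :
    clusters D σ ⊆ Finset.range D.n := by
  intro k hk
  obtain ⟨x, hx, rfl⟩ := Finset.mem_image.1 hk
  have := hD.n_pos
  simp at hx ⊢
  have := h.cl_le x (by omega)
  omega

theorem Finder.search (h : Finder D rk mk σ) : ∀ x ≤ D.n - 1,
    (σ.arr .mark (σ.arr .cl x) &&& σ.arr .anc x ≠ 0 → ∃ y ≤ D.n - 1,
      σ.arr .vt (σ.arr .cl x * σ.reg .T + σ.arr .hb (σ.arr .mark (σ.arr .cl x) &&& σ.arr .anc x)) = y ∧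
        Skip (D.n - 1) (σ.arr .par) mk x y ∧ mk y) ∧
    (σ.arr .mark (σ.arr .cl x) &&& σ.arr .anc x = 0 → σ.arr .cl x ≠ D.n - 1 ∧
      Skip (D.n - 1) (σ.arr .par) mk x (σ.arr .exit (σ.arr .cl x))) :=
  h.micro.search h.table h.anc_lt h.mark h.root

/-- Merging the class of `c` with the class of the cluster that its exit belongs to. -/
def uniteP : HP :=
  .asg .g (.get .lab ♯.c) ;;
  .asg .d (.get .lab (.get .cl ♯.y)) ;;
  mergeP

/-- If neither `y`, the exit of `k`, nor an ancestor of `y` in the cluster of `y` is marked, then a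
search can skip from `y` to the exit of this cluster, and the classes of the two clusters can be
merged. -/
theorem uniteP_spec (hD : D.Ok) (hc : Big D c) (hE : Env D σ) (hF : Finder D rk mk σ) {k y : ℕ}
    (hk : k ∈ clusters D σ) (hne : k ≠ D.n - 1) (htop : σ.arr .top (σ.arr .lab k) = k)
    (hrc : σ.reg .c = k) (hry : σ.reg .y = y) (hy : y = σ.arr .exit k)
    (hf : σ.arr .mark (σ.arr .cl y) &&& σ.arr .anc y = 0) :
    Runs c uniteP σ fun σ' => Finder D rk mk σ' ∧ σ.arr .cl y ≠ D.n - 1 ∧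
      Skip (D.n - 1) (σ.arr .par) mk y (σ.arr .exit (σ.arr .cl y)) ∧ pot D σ < pot D σ' ∧
      σ'.tm + 40 * pot D σ ≤ σ.tm + 40 * pot D σ' := by
  have hX := hc.hX
  have hn := hD.n_pos
  have hym : y ≤ D.n - 1 := hy ▸ hF.exit_le hD hk hne
  obtain ⟨hcy, hskip⟩ := (hF.search y hym).2 hf
  have hcyC : σ.arr .cl y ∈ clusters D σ := mem_clusters hD hym
  obtain ⟨ht1, ht2, ht3, ht4⟩ := hF.top _ hcyC hcy
  -- In the same class, the exit of the cluster of `y` would lead up to `y`, the exit of the top `k`,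
  -- although `y` is below that exit.
  have hlab : σ.arr .lab k ≠ σ.arr .lab (σ.arr .cl y) := by
    intro he
    rw [← he, htop, ← hy] at ht4
    have h1 := ht4.le hF.micro.par_gt
    have h2 := hF.micro.exit_gt y hym hcy
    omega
  have hlt : ∀ k ∈ clusters D σ, k < D.n := fun k hk => Finset.mem_range.1 (hF.subset hD hk)
  have hl1 := hlt _ (hF.classes.lab_mem k hk)
  have hl2 := hlt _ (hF.classes.lab_mem _ hcyC)
  have ht1' := hlt _ ht1
  rw [uniteP, Runs.seq_iff, Runs.asg_iff]
  refine ⟨by simp, by simp [hrc]; omega, ?_⟩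
  rw [Runs.seq_iff, Runs.asg_iff]
  refine ⟨by simp, by simp [hry]; omega, ?_⟩
  refine Runs.mono (mergeP_spec (Cs := clusters D σ) (c1 := k) (c2 := σ.arr .cl y) hD hc
    ⟨by simpa using hE.n, by simpa using hE.p, by simpa using hE.k, by simpa using hE.m,
      by simpa using hE.e1, by simpa using hE.e2, by simpa using hE.a, by simpa using hE.b,
      by simpa using hE.wt⟩ (hF.subset hD) hF.classes hk hcyC (by simp [hrc]) (by simp [hry])
      hlab (by simpa [hry] using ht1')) fun σ' hFr ⟨src, dst, hsd, q1, q2, q3, q4, q5⟩ => ?_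
  simp only [Store.reg_set_self, Store.arr_set, Store.tm_set, HE.val_get, HE.val_var,
    Store.reg_set_of_ne, ne_eq, reduceCtorEq, not_false_eq_true, hrc, hry] at hsd q1 q2 q3 q4 q5
  have f1 : σ'.reg .T = σ.reg .T := by simpa using hFr.reg .T rfl
  have f2 : σ'.reg .b = σ.reg .b := by simpa using hFr.reg .b rfl
  have f3 : σ'.arr .par = σ.arr .par := by simpa using hFr.arr .par rfl
  have f4 : σ'.arr .cl = σ.arr .cl := by simpa using hFr.arr .cl rfl
  have f5 : σ'.arr .anc = σ.arr .anc := by simpa using hFr.arr .anc rfl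
  have f6 : σ'.arr .pw = σ.arr .pw := by simpa using hFr.arr .pw rfl
  have f7 : σ'.arr .exit = σ.arr .exit := by simpa using hFr.arr .exit rfl
  have f8 : σ'.arr .vt = σ.arr .vt := by simpa using hFr.arr .vt rfl
  have f9 : σ'.arr .hb = σ.arr .hb := by simpa using hFr.arr .hb rfl
  have f10 : σ'.arr .mark = σ.arr .mark := by simpa using hFr.arr .mark rfl
  have f11 : clusters D σ' = clusters D σ := by simp only [clusters, f4]
  refine ⟨?_, hcy, hskip, by simpa only [pot, f11] using q4, by simp only [pot, f11] at q4 ⊢; omega⟩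
  have hsd' : (∀ l, (l = src ∨ l = dst) ↔
      (l = σ.arr .lab k ∨ l = σ.arr .lab (σ.arr .cl y))) ∧ src ≠ dst := by
    rcases hsd with ⟨rfl, rfl⟩ | ⟨rfl, rfl⟩
    · exact ⟨fun l => Iff.rfl, hlab⟩
    · exact ⟨fun l => Or.comm, hlab.symm⟩
  constructor <;> try simp only [f1, f2, f3, f4, f5, f6, f7, f8, f9, f10, f11]
  · exact hF.micro
  · exact hF.table
  · exact hF.anc_lt
  · exact hF.cl_le
  · exact hF.mark_lt
  · exact hF.mark
  · exact hF.root
  · exact q1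
  · intro k' hk' hne'
    obtain ⟨o1, o2, o3, o4⟩ := hF.top k' hk' hne'
    by_cases hin : σ.arr .lab k' = src ∨ σ.arr .lab k' = dst
    · have hl' : σ'.arr .lab k' = dst := by
        rw [q2 k' hk']
        rcases hin with h | h
        · rw [if_pos h]
        · rw [if_neg (by rw [h]; exact hsd'.2.symm), h]
      rw [hl', q3, Function.update_self]
      refine ⟨ht1, ht2, ?_, ?_⟩
      · rw [q2 _ ht1, ht3]
        rcases ((hsd'.1 (σ.arr .lab (σ.arr .cl y))).2 (Or.inr rfl)) with h | h
        · rw [if_pos h]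
        · rw [if_neg (by rw [h]; exact hsd'.2.symm), h]
      · rcases (hsd'.1 _).1 hin with h | h
        · rw [h, htop, ← hy] at o4
          exact o4.trans (hskip.trans ht4)
        · rw [h] at o4
          exact o4
    · have hl' : σ'.arr .lab k' = σ.arr .lab k' := by
        rw [q2 k' hk', if_neg fun h => hin (Or.inl h)]
      rw [hl', q3, Function.update_of_ne fun h => hin (Or.inr h)]
      refine ⟨o1, o2, ?_, o4⟩
      rw [q2 _ o1, o3, if_neg fun h => hin (Or.inl h)]

/-- Replacing the vertex `x` by its nearest marked ancestor. If there is none in the cluster of `x`,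
the search proceeds from the exit of the top of its class, merging classes until it succeeds. -/
def findP : HP :=
  .asg .f (HE.and' (.get .mark (.get .cl ♯.x)) (.get .anc ♯.x)) ;;
  .ite ♯.f (.asg .x (.get .vt (.get .cl ♯.x * ♯.T + .get .hb ♯.f)))
    (.asg .c (.get .top (.get .lab (.get .cl ♯.x))) ;;
      .asg .y (.get .exit ♯.c) ;;
      .asg .f (HE.and' (.get .mark (.get .cl ♯.y)) (.get .anc ♯.y)) ;;
      .loop (HE.equal ♯.f 0) (
        uniteP ;;
        .asg .c (.get .top (.get .lab (.get .cl ♯.y))) ;;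
        .asg .y (.get .exit ♯.c) ;;
        .asg .f (HE.and' (.get .mark (.get .cl ♯.y)) (.get .anc ♯.y))) ;;
      .asg .x (.get .vt (.get .cl ♯.y * ♯.T + .get .hb ♯.f)))

/-- A search takes constant time apart from the merges, which are paid for by the potential. -/
theorem findP_spec (hD : D.Ok) (hc : Big D c) (hE : Env D σ) (hF : Finder D rk mk σ) {x : ℕ}
    (hx : σ.reg .x = x) (hxm : x ≤ D.n - 1) :
    Runs c findP σ fun σ' => Finder D rk mk σ' ∧ σ'.reg .x ≤ D.n - 1 ∧
      Skip (D.n - 1) (σ.arr .par) mk x (σ'.reg .x) ∧ mk (σ'.reg .x) ∧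
      pot D σ ≤ pot D σ' ∧ σ'.tm + 50 * pot D σ ≤ σ.tm + 10 + 50 * pot D σ' := by
  have hX := hc.hX
  have hn := hD.n_pos
  have hT := hF.table.T_le
  have hand : ∀ z ≤ D.n - 1, σ.arr .mark (σ.arr .cl z) &&& σ.arr .anc z < c.X := fun z hz => by
    have h1 := hF.anc_lt z hz
    have h2 : σ.arr .mark (σ.arr .cl z) &&& σ.arr .anc z ≤ σ.arr .anc z := Nat.and_le_right
    omega
  rw [findP, Runs.seq_iff, Runs.asg_iff]
  refine ⟨by simp, by simpa [hx] using hand x hxm, ?_⟩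
  simp only [HE.val_and, HE.val_get, HE.val_var, hx]
  rw [Runs.ite_iff]
  refine ⟨by simp, fun h => ?_, fun h => ?_⟩
  · simp only [HE.val_var, Store.reg_set_self] at h
    obtain ⟨y, hy1, hy2, hy3, hy4⟩ := (hF.search x hxm).1 h
    rw [Runs.asg_iff]
    simp only [Store.reg_set_self, Store.arr_set, Store.reg_tick, Store.arr_tick, HE.val_get,
      HE.val_add, HE.val_mul, HE.val_var, Store.reg_set_of_ne, ne_eq, reduceCtorEq,
      not_false_eq_true, hx, hy2]
    refine ⟨by simp, by omega, hF.of_eq rfl (by simp) (by simp), hy1, hy3, hy4, le_rfl, ?_⟩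
    simp only [Store.tm_set, Store.tm_tick, pot, clusters, Store.arr_set, Store.arr_tick]
    omega
  simp only [HE.val_var, Store.reg_set_self] at h
  obtain ⟨hcx, hskip⟩ := (hF.search x hxm).2 h
  have hcxC : σ.arr .cl x ∈ clusters D σ := mem_clusters hD hxm
  obtain ⟨t1, t2, t3, t4⟩ := hF.top _ hcxC hcx
  set k := σ.arr .top (σ.arr .lab (σ.arr .cl x)) with hk
  have hkn := Finset.mem_range.1 (hF.subset hD t1)
  have hym := hF.exit_le hD t1 t2
  rw [Runs.seq_iff, Runs.asg_iff]
  refine ⟨by simp, by simp [hx, ← hk]; omega, ?_⟩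
  rw [Runs.seq_iff, Runs.asg_iff]
  refine ⟨by simp, by simp [hx, ← hk]; omega, ?_⟩
  rw [Runs.seq_iff, Runs.asg_iff]
  refine ⟨by simp, by simpa [hx, ← hk] using hand _ hym, ?_⟩
  simp only [Store.reg_set_self, Store.arr_set, Store.reg_tick, Store.arr_tick, HE.val_get,
      HE.val_and, HE.val_var, Store.reg_set_of_ne, ne_eq, reduceCtorEq,
      not_false_eq_true, hx, ← hk]
  rw [Runs.seq_iff]
  refine Runs.while_rule (fun b' σ' =>
    b' + pot D σ' = (clusters D σ).card * Nat.log 2 (clusters D σ).card ∧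
    Finder D rk mk σ' ∧ σ'.reg .c ∈ clusters D σ ∧ σ'.reg .c ≠ D.n - 1 ∧
    σ'.arr .top (σ'.arr .lab (σ'.reg .c)) = σ'.reg .c ∧ σ'.reg .y = σ'.arr .exit (σ'.reg .c) ∧
    σ'.reg .f = σ'.arr .mark (σ'.arr .cl (σ'.reg .y)) &&& σ'.arr .anc (σ'.reg .y) ∧
    Skip (D.n - 1) (σ.arr .par) mk x (σ'.reg .y) ∧ pot D σ ≤ pot D σ' ∧
    σ'.tm + 50 * pot D σ ≤ σ.tm + 5 + 50 * pot D σ')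
    ((clusters D σ).card * Nat.log 2 (clusters D σ).card - pot D σ) ?_ ?_
  · have hpl : pot D σ ≤ _ := potential_le (clusters D σ) (σ.arr .lab)
    simp only [Store.reg_set_self, Store.arr_set, Store.arr_tick,
      Store.reg_set_of_ne, ne_eq, reduceCtorEq, not_false_eq_true, Store.tm_set, Store.tm_tick,
      pot, clusters, true_and]
    refine ⟨?_, hF.of_eq rfl (by simp) (by simp), t1, t2, ?_, hskip.trans t4, le_rfl, by omega⟩
    · exact Nat.sub_add_cancel hpl
    · rw [t3]
  · rintro b' σ' hFr ⟨i1, i2, i3, i4, i5, i6, i7, i8, i9, i10⟩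
    have f1 : σ'.reg .T = σ.reg .T := by simpa using hFr.reg .T rfl
    have f2 : σ'.arr .cl = σ.arr .cl := by simpa using hFr.arr .cl rfl
    have f3 : σ'.arr .par = σ.arr .par := by simpa using hFr.arr .par rfl
    have f4 : σ'.arr .anc = σ.arr .anc := by simpa using hFr.arr .anc rfl
    have f5 : σ'.arr .exit = σ.arr .exit := by simpa using hFr.arr .exit rfl
    have f6 : σ'.arr .mark = σ.arr .mark := by simpa using hFr.arr .mark rfl
    have f7 : clusters D σ' = clusters D σ := by simp only [clusters, f2]
    have hE' : Env D σ' := by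
      refine Env.frame (P := findP) hE ⟨fun v hv => ?_, fun a ha => ?_⟩ rfl
      · rw [hFr.reg v (by revert hv; cases v <;> decide)]
        have h1 : v ≠ .f := by rintro rfl; exact absurd hv (by decide)
        have h2 : v ≠ .y := by rintro rfl; exact absurd hv (by decide)
        have h3 : v ≠ .c := by rintro rfl; exact absurd hv (by decide)
        simp [h1, h2, h3]
      · rw [hFr.arr a (by revert ha; cases a <;> decide)]
        simp
    have hym' : σ'.reg .y ≤ D.n - 1 := by
      rw [i6]; exact i2.exit_le hD (f7 ▸ i3) i4
    refine ⟨by simp, ?_⟩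
    by_cases hf0 : σ'.reg .f = 0
    · left
      refine ⟨by simp [hf0], ?_⟩
      rw [Runs.seq_iff]
      have hE'' : Env D σ'.tick := ⟨hE'.n, hE'.p, hE'.k, hE'.m, hE'.e1, hE'.e2, hE'.a, hE'.b, hE'.wt⟩
      have hFi : Finder D rk mk σ'.tick := i2.of_eq rfl rfl rfl
      refine (uniteP_spec (k := σ'.reg .c) hD hc hE'' hFi
        (by simpa only [clusters, Store.arr_tick, f2] using i3) i4 i5 rfl rfl i6
        (by simpa using i7.symm.trans hf0)).mono fun σ'' hFr2 ⟨u1, u2, u3, u4, u5⟩ => ?_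
      simp only [Store.arr_tick, Store.reg_tick, Store.tm_tick] at u2 u3 u5
      have e1 : σ''.reg .y = σ'.reg .y := by simpa using hFr2.reg .y rfl
      have e2 : σ''.arr .cl = σ'.arr .cl := by simpa using hFr2.arr .cl rfl
      have e3 : σ''.arr .exit = σ'.arr .exit := by simpa using hFr2.arr .exit rfl
      have e4 : σ''.arr .mark = σ'.arr .mark := by simpa using hFr2.arr .mark rfl
      have e5 : σ''.arr .anc = σ'.arr .anc := by simpa using hFr2.arr .anc rfl
      have e6 : σ''.arr .par = σ'.arr .par := by simpa using hFr2.arr .par rfl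
      have e7 : clusters D σ'' = clusters D σ := by simp only [clusters, e2, f2]
      have e8 : pot D σ'.tick = pot D σ' := rfl
      have hcy : σ'.arr .cl (σ'.reg .y) ∈ clusters D σ'' := by
        rw [e7, ← f7]; exact mem_clusters hD hym'
      obtain ⟨w1, w2, w3, w4⟩ := u1.top _ hcy u2
      have w5 := u1.exit_le hD w1 w2
      have w6 := Finset.mem_range.1 (u1.subset hD w1)
      have hpl : pot D σ'' ≤ _ := potential_le (clusters D σ'') (σ''.arr .lab)
      rw [e7] at hpl
      rw [e3] at w4 w5
      simp only [Runs.seq_iff, Runs.asg_iff]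
      simp only [Store.reg_set_self, Store.reg_set_of_ne, Store.arr_set, Store.tm_set, HE.val_var,
        HE.val_get, HE.val_and, HE.ok_and, HE.ok_var, HE.ok_get, e1, e2, e3, e4, e5, ne_eq,
        reduceCtorEq, not_false_eq_true, false_imp_iff, and_self, true_and]
      refine ⟨by omega, by omega, ?_, ?_⟩
      · simpa only [f6, f2, f4] using hand _ w5
      · have e9 : pot D σ'' ≤ (clusters D σ).card * Nat.log 2 (clusters D σ).card := hpl
        refine ⟨_, ?_, Nat.sub_add_cancel e9, u1.of_eq rfl (by simp) (by simp), ?_, w2, ?_, ?_, ?_, ?_⟩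
        · rw [e8] at u4
          change _ - pot D σ'' < b'
          omega
        · rw [← e7]; exact w1
        · rw [w3]
        · rw [f3] at u3
          rw [e6, f3] at w4
          exact i8.trans (u3.trans w4)
        · change pot D σ ≤ pot D σ''
          omega
        · change _ ≤ σ.tm + 5 + 50 * pot D σ''
          omega
    · right
      refine ⟨by simp [hf0], ?_⟩
      rw [i7] at hf0
      obtain ⟨y, hy1, hy2, hy3, hy4⟩ := (i2.search _ hym').1 hf0
      rw [← i7] at hy2
      rw [Runs.asg_iff]
      simp only [Store.reg_set_self, Store.reg_tick, Store.arr_tick, HE.val_get,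
        HE.val_add, HE.val_mul, HE.val_var, hy2]
      rw [f3] at hy3
      refine ⟨by simp, by omega, i2.of_eq rfl (by simp) (by simp), hy1, i8.trans hy3, hy4, ?_, ?_⟩
      · exact i9
      · change σ'.tm + 1 + 1 + _ ≤ σ.tm + 10 + 50 * pot D σ'
        omega

end

/-! ### Processing one path -/

/-- The vertex `x` is `a` or an ancestor of `a`. -/
def Above (m : ℕ) (par : ℕ → ℕ) (a x : ℕ) : Prop :=
  Relation.ReflTransGen (fun u v => u < m ∧ v = par u) a x

/-- The edge from `x` to its parent is on the path between `a` and `b`: exactly one of `a` and `b`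
is below the edge. -/
def Separates (m : ℕ) (par : ℕ → ℕ) (a b x : ℕ) : Prop := ¬ (Above m par a x ↔ Above m par b x)

section
variable {m : ℕ} {par : ℕ → ℕ} {mk : ℕ → Prop} {a b x y : ℕ}

theorem Above.le (hp : ∀ x < m, x < par x) (h : Above m par a x) : a ≤ x := by
  induction h with
  | refl => exact le_rfl
  | tail _ h ih =>
    obtain ⟨h1, rfl⟩ := h
    have := hp _ h1
    omega

theorem above_iff_of_ne (ha : a < m) (hne : x ≠ a) : Above m par a x ↔ Above m par (par a) x := by
  constructor
  · intro h
    rcases Relation.ReflTransGen.cases_head h with h | ⟨c, ⟨_, rfl⟩, h⟩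
    · exact absurd h.symm hne
    · exact h
  · exact fun h => Relation.ReflTransGen.head ⟨ha, rfl⟩ h

theorem Skip.above_iff (h : Skip m par mk a b) (hx : mk x) :
    Above m par a x ↔ Above m par b x := by
  induction h with
  | refl => rfl
  | tail _ h ih =>
    obtain ⟨h1, h2, rfl⟩ := h
    rw [ih, above_iff_of_ne h1]
    rintro rfl
    exact h2 hx

theorem separates_comm : Separates m par a b x ↔ Separates m par b a x := by
  unfold Separates; tauto

theorem not_separates_self : ¬ Separates m par a a x := fun h => h Iff.rfl

/-- The effect of moving the lower end `a` of the path to the nearest marked ancestor of its parent: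
the marked edges on the path remain the same, except for the edge at `a`. -/
theorem separates_move (hp : ∀ x < m, x < par x) (ha : a < m) (hab : a < b)
    (hs : Skip m par mk (par a) y) (hx : mk x ∨ x = a) :
    Separates m par y b x ↔ Separates m par a b x ∧ x ≠ a := by
  have h1 : ¬ Above m par b a := fun h => by have := h.le hp; omega
  have h2 : ¬ Above m par y a := fun h => by
    have := h.le hp
    have := hs.le hp
    have := hp a ha
    omega
  by_cases hxa : x = a
  · subst hxa
    simp [Separates, h1, h2]
  · have h3 := (above_iff_of_ne (par := par) ha hxa).trans
      (hs.above_iff (hx.resolve_right hxa))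
    simp [Separates, h3, hxa]

theorem separates_self (hp : ∀ x < m, x < par x) (hab : a < b) : Separates m par a b a := by
  intro h
  have := (h.1 Relation.ReflTransGen.refl).le hp
  omega

end

/-- The marked vertices: those for which the list of the edge to the parent still has room, and the
root. -/
def Open (D : Data) (L : ℕ → List ℕ) (x : ℕ) : Prop := x = D.n - 1 ∨ (L x).length < D.k

/-- The lists `L x` for the edges from `x` to its parent are in the output array. -/
def Written (D : Data) (eid out : ℕ → ℕ) (L : ℕ → List ℕ) : Prop :=
  ∀ x < D.n - 1, (L x).length ≤ D.k ∧ out (eid x * (D.k + 1)) = (L x).length ∧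
    ∀ t < (L x).length, out (eid x * (D.k + 1) + 1 + t) = (L x).getD t 0

/-- The invariant of the main loop when the lists found so far are given by `L`. -/
structure Progress (D : Data) (rk : ℕ → ℕ) (L : ℕ → List ℕ) (σ : Store) : Prop where
  rooted : Rooted D (σ.arr .pos) (σ.arr .par) (σ.arr .eid)
  finder : Finder D rk (Open D L) σ
  written : Written D (σ.arr .eid) (σ.arr .out) L

/-- The total length of the lists. -/
def total (D : Data) (L : ℕ → List ℕ) : ℕ := ∑ x ∈ Finset.range (D.n - 1), (L x).length

/-- Appending `i` to the list of the edge at `a`, and removing the mark of `a` if the list is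
full. -/
def visitP : HP :=
  .asg .o (.get .eid ♯.a * (♯.k + 1)) ;;
  .asg .h (.get .out ♯.o + 1) ;;
  .sto .out (♯.o + ♯.h) ♯.i ;;
  .sto .out ♯.o ♯.h ;;
  .ite (HE.equal ♯.h ♯.k)
    (.sto .mark (.get .cl ♯.a) (HE.xor' (.get .mark (.get .cl ♯.a)) (.get .pw ♯.a))) .skip

section
variable {D : Data} {c : Ctx} {σ : Store} {rk : ℕ → ℕ} {L : ℕ → List ℕ}

theorem Written.append {eid out : ℕ → ℕ} {a i : ℕ} (h : Written D eid out L) (ha : a < D.n - 1)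
    (hinj : ∀ x < D.n - 1, ∀ y < D.n - 1, eid x = eid y → x = y) (hl : (L a).length < D.k) :
    Written D eid
      (Function.update (Function.update out (eid a * (D.k + 1) + ((L a).length + 1)) i)
        (eid a * (D.k + 1)) ((L a).length + 1))
      (Function.update L a (L a ++ [i])) := by
  intro x hx
  obtain ⟨h1, h2, h3⟩ := h x hx
  by_cases hxa : x = a
  · subst hxa
    simp only [Function.update_self, List.length_append, List.length_singleton]
    refine ⟨hl, trivial, fun t ht => ?_⟩
    rw [Function.update_of_ne (by omega)]
    rcases Nat.lt_succ_iff_lt_or_eq.1 ht with h | rfl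
    · rw [Function.update_of_ne (by omega), h3 t h, List.getD_append _ _ _ _ h]
    · rw [show eid x * (D.k + 1) + 1 + (L x).length = eid x * (D.k + 1) + ((L x).length + 1) by ring,
        Function.update_self, List.getD_append_right _ _ _ _ le_rfl]
      simp
  · have hne : ∀ s ≤ D.k, ∀ t ≤ D.k, eid x * (D.k + 1) + s ≠ eid a * (D.k + 1) + t :=
      fun s hs t ht he => hxa (hinj x hx a ha (mul_add_inj (by omega) (by omega) he).1)
    rw [Function.update_of_ne hxa]
    refine ⟨h1, ?_, fun t ht => ?_⟩
    · rw [Function.update_of_ne (by simpa using hne 0 (by omega) 0 (by omega)),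
        Function.update_of_ne (by simpa using hne 0 (by omega) ((L a).length + 1) (by omega)), h2]
    · rw [Function.update_of_ne (by have := hne (1 + t) (by omega) 0 (by omega); omega),
        Function.update_of_ne
          (by have := hne (1 + t) (by omega) ((L a).length + 1) (by omega); omega), h3 t ht]

theorem total_append {a i : ℕ} (ha : a < D.n - 1) :
    total D (Function.update L a (L a ++ [i])) = total D L + 1 := by
  unfold total
  rw [← Finset.add_sum_erase _ _ (Finset.mem_range.2 ha),
    ← Finset.add_sum_erase _ (fun x => (L x).length) (Finset.mem_range.2 ha)]
  simp only [Function.update_self, List.length_append, List.length_singleton]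
  rw [Finset.sum_congr rfl fun x hx => by
    rw [Function.update_of_ne (Finset.ne_of_mem_erase hx)]]
  omega

/-- Changing the marks, if the bits of the marks follow and no vertex gets a mark. -/
theorem Finder.unmark {mk mk' : ℕ → Prop} {τ : Store} (hF : Finder D rk mk σ)
    (hmk : ∀ x, mk' x → mk x) (hroot : mk' (D.n - 1)) (hreg : τ.reg .b = σ.reg .b)
    (hT : τ.reg .T = σ.reg .T)
    (harr : ∀ a, a ≠ .mark → a ≠ .out → τ.arr a = σ.arr a) (hlt : ∀ x, τ.arr .mark x < σ.reg .T)
    (hbit : ∀ x ≤ D.n - 1, (τ.arr .mark (σ.arr .cl x)).testBit (rk x) = true ↔ mk' x) :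
    Finder D rk mk' τ := by
  have e : clusters D τ = clusters D σ := by
    simp only [clusters, harr .cl (by decide) (by decide)]
  obtain ⟨h1, h2, h3, h4, h5, h6, h7, h8, h9⟩ := hF
  constructor <;> (try simp only [e, hreg, hT, harr .par (by decide) (by decide),
    harr .cl (by decide) (by decide), harr .anc (by decide) (by decide),
    harr .pw (by decide) (by decide), harr .exit (by decide) (by decide),
    harr .vt (by decide) (by decide), harr .hb (by decide) (by decide),
    harr .lab (by decide) (by decide), harr .elem (by decide) (by decide),
    harr .size (by decide) (by decide), harr .top (by decide) (by decide)]) <;> try assumption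
  exact fun k hk hne => ⟨(h9 k hk hne).1, (h9 k hk hne).2.1, (h9 k hk hne).2.2.1,
    (h9 k hk hne).2.2.2.mono hmk⟩

theorem Rooted.of_eq {τ : Store} (h : Rooted D (σ.arr .pos) (σ.arr .par) (σ.arr .eid))
    (h1 : τ.arr .pos = σ.arr .pos) (h2 : τ.arr .par = σ.arr .par) (h3 : τ.arr .eid = σ.arr .eid) :
    Rooted D (τ.arr .pos) (τ.arr .par) (τ.arr .eid) := by
  rw [h1, h2, h3]; exact h

theorem visitP_spec (hc : Big D c) (hE : Env D σ) (hP : Progress D rk L σ) {a i : ℕ}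
    (ha : σ.reg .a = a) (ham : a < D.n - 1) (hl : (L a).length < D.k) (hi : σ.reg .i = i)
    (hip : i < D.p) :
    Runs c visitP σ fun σ' => Progress D rk (Function.update L a (L a ++ [i])) σ' ∧
      pot D σ' = pot D σ ∧ σ'.tm ≤ σ.tm + 6 := by
  have hX := hc.hX
  have hT := hP.finder.table.T_le
  have heid := hP.rooted.eid_lt a ham
  have hlo : σ.arr .eid a * (D.k + 1) + (D.k + 1) ≤ D.n * (D.k + 1) := by
    rw [← Nat.succ_mul]; exact Nat.mul_le_mul_right _ (by omega)
  obtain ⟨w1, w2, w3⟩ := hP.written a ham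
  have hW := hP.written.append (i := i) ham hP.rooted.eid_inj hl
  have hpw := hP.finder.micro.pw_eq a ham.le
  have hpl := hP.finder.micro.pw_lt a ham.le
  have hxor : σ.arr .mark (σ.arr .cl a) ^^^ σ.arr .pw a < σ.reg .T := by
    have h1 := hP.finder.mark_lt (σ.arr .cl a)
    rw [hP.finder.table.T_eq] at h1 hpl ⊢
    have h2 : 0 < 2 ^ rk a := by positivity
    exact Nat.xor_lt_two_pow h1 (by omega)
  set L' := Function.update L a (L a ++ [i]) with hL'
  have hopen : ∀ x, Open D L' x → Open D L x := by
    rintro x (h | h)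
    · exact Or.inl h
    · by_cases hx : x = a
      · subst hx; exact Or.inr hl
      · rw [hL', Function.update_of_ne hx] at h; exact Or.inr h
  have hopen' : ∀ x, Open D L' x ↔ Open D L x ∧ (x = a → (L a).length + 1 ≠ D.k) := by
    intro x
    by_cases hx : x = a
    · subst hx
      have : x ≠ D.n - 1 := ham.ne
      simp only [Open, hL', Function.update_self, List.length_append, List.length_singleton, this,
        false_or, forall_const]
      omega
    · simp [Open, hL', hx]
  rw [visitP]
  rw [Runs.seq_iff, Runs.asg_iff]
  simp only [HE.val_mul, HE.val_add, HE.val_get, HE.val_var, HE.val_one, ha, hE.k]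
  refine ⟨by simp, by omega, ?_⟩
  rw [Runs.seq_iff, Runs.asg_iff]
  simp only [HE.val_add, HE.val_get, HE.val_var, HE.val_one, Store.reg_set_self, Store.arr_set, w2]
  refine ⟨by simp [hc.lo]; omega, by omega, ?_⟩
  rw [Runs.seq_iff, Runs.sto_iff]
  simp only [HE.val_add, HE.val_var, Store.reg_set_self, Store.reg_set_of_ne, ne_eq, reduceCtorEq,
    not_false_eq_true, hi]
  refine ⟨by simp, trivial, fun _ => by rw [hc.lo]; omega, by omega, ?_⟩
  rw [Runs.seq_iff, Runs.sto_iff]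
  simp only [HE.val_var, Store.reg_put, Store.reg_set_self, Store.reg_set_of_ne, ne_eq,
    reduceCtorEq, not_false_eq_true]
  refine ⟨by simp, trivial, fun _ => by rw [hc.lo]; omega, by omega, ?_⟩
  rw [Runs.ite_iff]
  refine ⟨by simp, fun h => ?_, fun h => ?_⟩
  · have hk : (L a).length + 1 = D.k := by
      by_contra hcon
      exact h (by simp [hE.k, hcon])
    rw [Runs.sto_iff]
    simp only [HE.val_xor, HE.val_get, HE.val_var, Store.reg_tick, Store.arr_tick, Store.reg_put,
      Store.reg_set_of_ne, Store.arr_put_of_ne, Store.arr_set, ne_eq, reduceCtorEq,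
      not_false_eq_true, ha]
    refine ⟨by simp, trivial, by simp, by omega, ⟨?_, ?_, ?_⟩, ?_, by simp⟩
    · exact hP.rooted.of_eq (by simp) (by simp) (by simp)
    · refine hP.finder.unmark hopen (Or.inl rfl) (by simp) (by simp) (fun b h1 h2 => ?_) ?_ ?_
      · simp [h1, h2]
      · intro x
        simp only [Store.arr_put_self, Function.update_apply]
        split_ifs
        · exact hxor
        · simpa using hP.finder.mark_lt x
      · intro x hx
        rw [hopen', ← hP.finder.mark x hx]
        simp only [Store.arr_put_self, Function.update_apply]
        split_ifs with hcl
        · rw [← hcl, Nat.testBit_xor, hpw, Nat.testBit_two_pow]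
          by_cases hxa : x = a
          · subst hxa
            have h3 := (hP.finder.mark x hx).2 (Or.inr hl)
            simp [h3, hk]
          · have hrk : rk a ≠ rk x := by
              rcases Nat.lt_or_gt_of_ne hxa with h4 | h4
              · have := hP.finder.micro.rk_lt x a h4 ham.le hcl; omega
              · have := hP.finder.micro.rk_lt a x h4 hx hcl.symm; omega
            simp [hrk, hxa]
        · have hxa : x ≠ a := fun h => hcl (by rw [h])
          simp [hxa]
    · simpa using hW
    · simp [pot, clusters]
  · have hk : (L a).length + 1 ≠ D.k := by
      intro hcon
      simp [hE.k, hcon] at h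
    rw [Runs.skip_iff]
    refine ⟨⟨?_, ?_, ?_⟩, ?_, by simp⟩
    · exact hP.rooted.of_eq (by simp) (by simp) (by simp)
    · refine hP.finder.unmark hopen (Or.inl rfl) (by simp) (by simp) (fun b h1 h2 => ?_) ?_ ?_
      · simp [h2]
      · intro x
        simpa using hP.finder.mark_lt x
      · intro x hx
        rw [hopen', ← hP.finder.mark x hx]
        simp [hk]
    · simpa using hW
    · simp [pot, clusters]

/-- Writing a scalar other than the parameters of the search structure, or ticking the clock. -/
theorem Progress.of_eq {τ : Store} (h : Progress D rk L σ) (harr : τ.arr = σ.arr)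
    (hb : τ.reg .b = σ.reg .b) (hT : τ.reg .T = σ.reg .T) : Progress D rk L τ :=
  ⟨by rw [harr]; exact h.rooted, h.finder.of_eq harr hb hT, by rw [harr]; exact h.written⟩

theorem Progress.findP_spec (hD : D.Ok) (hc : Big D c) (hE : Env D σ) (hP : Progress D rk L σ)
    {x : ℕ} (hx : σ.reg .x = x) (hxm : x ≤ D.n - 1) :
    Runs c findP σ fun σ' => Progress D rk L σ' ∧ σ'.reg .x ≤ D.n - 1 ∧
      Skip (D.n - 1) (σ.arr .par) (Open D L) x (σ'.reg .x) ∧ Open D L (σ'.reg .x) ∧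
      pot D σ ≤ pot D σ' ∧ σ'.tm + 50 * pot D σ ≤ σ.tm + 10 + 50 * pot D σ' := by
  refine (KLightest.findP_spec hD hc hE hP.finder hx hxm).mono fun σ' hF h => ?_
  have f1 : σ'.arr .pos = σ.arr .pos := hF.arr .pos rfl
  have f2 : σ'.arr .par = σ.arr .par := hF.arr .par rfl
  have f3 : σ'.arr .eid = σ.arr .eid := hF.arr .eid rfl
  have f4 : σ'.arr .out = σ.arr .out := hF.arr .out rfl
  exact ⟨⟨hP.rooted.of_eq f1 f2 f3, h.1, by rw [f3, f4]; exact hP.written⟩, h.2⟩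

/-- Swapping `a` and `v` if `v` is smaller. -/
def orderP : HP :=
  .ite (HE.less ♯.v ♯.a) (.asg .s ♯.a ;; .asg .a ♯.v ;; .asg .v ♯.s) .skip

theorem orderP_spec (ha : σ.reg .a < c.X) (hv : σ.reg .v < c.X) (hne : σ.reg .a ≠ σ.reg .v) :
    Runs c orderP σ fun σ' => σ'.reg .a < σ'.reg .v ∧ σ'.arr = σ.arr ∧ σ'.tm ≤ σ.tm + 5 ∧
      ((σ'.reg .a = σ.reg .a ∧ σ'.reg .v = σ.reg .v) ∨
        (σ'.reg .a = σ.reg .v ∧ σ'.reg .v = σ.reg .a)) := by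
  rw [orderP, Runs.ite_iff]
  refine ⟨by simp, fun h => ?_, fun h => ?_⟩
  · have h' : σ.reg .v < σ.reg .a := by
      by_contra hcon
      exact h (by simp [hcon])
    simp only [Runs.seq_iff, Runs.asg_iff]
    simp [ha, hv, h']
  · have h' : ¬ σ.reg .v < σ.reg .a := by
      intro hcon
      simp [hcon] at h
    rw [Runs.skip_iff]
    simp
    omega

/-- Processing the path with index `i`: walking up from both ends over the marked edges. -/
def processP : HP :=
  .asg .x (.get .pos (.get .inp (3 + 2 * ♯.m + ♯.i))) ;; findP ;; .asg .a ♯.x ;;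
  .asg .x (.get .pos (.get .inp (3 + 2 * ♯.m + ♯.p + ♯.i))) ;; findP ;; .asg .v ♯.x ;;
  .loop (HE.xor' ♯.a ♯.v)
    (orderP ;; visitP ;; .asg .x (.get .par ♯.a) ;; findP ;; .asg .a ♯.x)

/-- The lists after the path with index `i` and ends `a` and `b` has been processed. -/
noncomputable def extend (D : Data) (par : ℕ → ℕ) (a b i : ℕ) (L : ℕ → List ℕ) (x : ℕ) : List ℕ :=
  open scoped Classical in
  if (L x).length < D.k ∧ Separates (D.n - 1) par a b x then L x ++ [i] else L x

/-- Only edges with room in their lists are visited, and each visit makes a list longer; so the time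
is constant apart from the potential and the total length of the lists. -/
theorem processP_spec (hD : D.Ok) (hc : Big D c) (hE : Env D σ) (hP : Progress D rk L σ) {i : ℕ}
    (hi : σ.reg .i = i) (hip : i < D.p) :
    Runs c processP σ fun σ' => ∃ L', Progress D rk L' σ' ∧
      (∀ x < D.n - 1, L' x =
        extend D (σ.arr .par) (σ.arr .pos (D.a i)) (σ.arr .pos (D.b i)) i L x) ∧
      σ'.tm + 50 * pot D σ + 50 * total D L ≤ σ.tm + 30 + 50 * pot D σ' + 50 * total D L' := by
  classical
  have hX := hc.hX
  have hn := hD.n_pos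
  set a0 := σ.arr .pos (D.a i) with ha0
  set b0 := σ.arr .pos (D.b i) with hb0
  have ha0n : a0 < D.n := hP.rooted.pos_lt _ (hD.a_lt i hip)
  have hb0n : b0 < D.n := hP.rooted.pos_lt _ (hD.b_lt i hip)
  have hpar : ∀ x < D.n - 1, x < σ.arr .par x := hP.rooted.par_gt
  have hEa := hE.a i hip
  have hEb := hE.b i hip
  rw [hE.m] at hEa
  rw [hE.m, hE.p] at hEb
  have envs : ∀ τ : Store, Frame processP σ τ → Env D τ := fun τ hF => hE.frame hF rfl
  rw [processP, Runs.seq_iff, Runs.asg_iff]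
  simp only [HE.val_get, HE.val_add, HE.val_mul, HE.val_ofNat, HE.val_var, hE.m, hi, hEa]
  refine ⟨by simp [hc.li, hE.m, hi]; omega, by omega, ?_⟩
  rw [Runs.seq_iff]
  have hE1 : Env D (σ.set .x a0) := envs _ ⟨fun v hv => by
    have : v ≠ .x := by rintro rfl; exact absurd hv (by decide)
    simp [this], fun a ha => rfl⟩
  refine Runs.mono ((hP.of_eq (τ := σ.set .x a0) rfl (by simp) (by simp)).findP_spec hD hc
    hE1 (x := a0) (by simp) (by omega))
    fun σ1 hF1 ⟨p1, p2, p3, p4, p5, p6⟩ => ?_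
  have f1 : σ1.reg .i = i := by simpa [hi] using hF1.reg .i rfl
  have f2 : σ1.reg .m = D.n - 1 := by simpa [hE.m] using hF1.reg .m rfl
  have f3 : σ1.reg .p = D.p := by simpa [hE.p] using hF1.reg .p rfl
  have f4 : σ1.arr .inp = σ.arr .inp := by simpa using hF1.arr .inp rfl
  have f5 : σ1.arr .pos = σ.arr .pos := by simpa using hF1.arr .pos rfl
  have f6 : σ1.arr .par = σ.arr .par := by simpa using hF1.arr .par rfl
  rw [Runs.seq_iff, Runs.asg_iff]
  refine ⟨by simp, by simp; omega, ?_⟩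
  rw [Runs.seq_iff, Runs.asg_iff]
  simp only [HE.val_get, HE.val_add, HE.val_mul, HE.val_ofNat, HE.val_var, Store.arr_set,
    Store.reg_set_of_ne, ne_eq, reduceCtorEq, not_false_eq_true, f1, f2, f3, f4, f5, hEb]
  refine ⟨by simp [hc.li, f1, f2, f3]; omega, by omega, ?_⟩
  rw [Runs.seq_iff]
  have hE2 : Env D ((σ1.set .a (σ1.reg .x)).set .x b0) := by
    refine Env.frame (P := processP) (hE1.frame hF1 rfl) ⟨fun v hv => ?_, fun _ _ => rfl⟩ rfl
    have h1 : v ≠ .x := by rintro rfl; exact absurd hv (by decide)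
    have h2 : v ≠ .a := by rintro rfl; exact absurd hv (by decide)
    simp [h1, h2]
  refine Runs.mono ((p1.of_eq (τ := (σ1.set .a (σ1.reg .x)).set .x b0) rfl (by simp)
    (by simp)).findP_spec hD hc hE2 (x := b0) (by simp) (by omega))
    fun σ2 hF2 ⟨q1, q2, q3, q4, q5, q6⟩ => ?_
  have g1 : σ2.reg .i = i := by simpa [f1] using hF2.reg .i rfl
  have g2 : σ2.reg .a = σ1.reg .x := by simpa using hF2.reg .a rfl
  have g6 : σ2.arr .par = σ.arr .par := by simpa [f6] using hF2.arr .par rfl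
  have e1 : pot D (σ.set .x a0) = pot D σ := rfl
  have e2 : pot D ((σ1.set .a (σ1.reg .x)).set .x b0) = pot D σ1 := rfl
  simp only [e1, e2, Store.tm_set, Store.arr_set, f6] at p3 p5 p6 q3 q5 q6
  rw [Runs.seq_iff, Runs.asg_iff]
  refine ⟨by simp, by simp; omega, ?_⟩
  simp only [HE.val_var]
  have hE3 : Env D (σ2.set .v (σ2.reg .x)) := by
    refine Env.frame (P := processP) (hE2.frame hF2 rfl) ⟨fun v hv => ?_, fun _ _ => rfl⟩ rfl
    have h1 : v ≠ .v := by rintro rfl; exact absurd hv (by decide)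
    simp [h1]
  -- The edges still to be visited are the marked ones on the path between the current ends; the
  -- edges with room that are on the whole path and not still to be visited have got their entry.
  refine Runs.while_rule (fun b' σ' => b' + (σ'.reg .a + σ'.reg .v) = 2 * (D.n - 1) ∧
    σ'.reg .a ≤ D.n - 1 ∧ σ'.reg .v ≤ D.n - 1 ∧ ∃ L', Progress D rk L' σ' ∧
      Open D L' (σ'.reg .a) ∧ Open D L' (σ'.reg .v) ∧
      (∀ x < D.n - 1, (L' x).length < D.k →
        Separates (D.n - 1) (σ.arr .par) (σ'.reg .a) (σ'.reg .v) x →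
        Separates (D.n - 1) (σ.arr .par) a0 b0 x) ∧
      (∀ x < D.n - 1, L' x = if ((L x).length < D.k ∧ Separates (D.n - 1) (σ.arr .par) a0 b0 x) ∧
        ¬ ((L' x).length < D.k ∧
          Separates (D.n - 1) (σ.arr .par) (σ'.reg .a) (σ'.reg .v) x) then L x ++ [i] else L x) ∧
      σ'.tm + 50 * pot D σ + 50 * total D L ≤ σ.tm + 29 + 50 * pot D σ' + 50 * total D L')
    (2 * (D.n - 1) - (σ1.reg .x + σ2.reg .x)) ?_ ?_
  · simp only [Store.reg_set_self, Store.reg_set_of_ne, ne_eq, reduceCtorEq, not_false_eq_true, g2]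
    have hsep : ∀ x < D.n - 1, (L x).length < D.k →
        (Separates (D.n - 1) (σ.arr .par) (σ1.reg .x) (σ2.reg .x) x ↔
          Separates (D.n - 1) (σ.arr .par) a0 b0 x) := by
      intro x _ hx
      unfold Separates
      rw [p3.above_iff (Or.inr hx), q3.above_iff (Or.inr hx)]
    refine ⟨by omega, p2, q2, L, q1.of_eq rfl (by simp) (by simp), p4, q4, ?_, ?_, ?_⟩
    · exact fun x hx h1 h2 => (hsep x hx h1).1 h2
    · intro x hx
      rw [if_neg]
      rintro ⟨⟨h1, h2⟩, h3⟩
      exact h3 ⟨h1, (hsep x hx h1).2 h2⟩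
    · change σ2.tm + 1 + _ + _ ≤ _ + 50 * pot D σ2 + _
      omega
  · rintro b' σ' hF ⟨i1, i2, i3, L', i4, i5, i6, i7, i8, i9⟩
    have k1 : σ'.reg .i = i := by simpa [g1] using hF.reg .i rfl
    have k2 : σ'.arr .par = σ.arr .par := by simpa [g6] using hF.arr .par rfl
    have hE4 : Env D σ' := hE3.frame hF rfl
    refine ⟨by simp, ?_⟩
    by_cases hne : σ'.reg .a = σ'.reg .v
    · right
      refine ⟨by simp [hne], L', i4.of_eq rfl rfl rfl, fun x hx => ?_, ?_⟩
      · rw [i8 x hx, hne]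
        simp only [not_separates_self, and_false, not_false_eq_true, and_true, extend]
      · change σ'.tm + 1 + _ + _ ≤ _ + 50 * pot D σ' + _
        omega
    · left
      refine ⟨by simpa [Nat.xor_eq_zero_iff] using hne, ?_⟩
      rw [Runs.seq_iff]
      refine Runs.mono (orderP_spec (σ := σ'.tick) (by simp; omega) (by simp; omega)
        (by simpa using hne)) fun σ3 hF3 ⟨o1, o2, o3, o4⟩ => ?_
      simp only [Store.reg_tick, Store.arr_tick, Store.tm_tick] at o2 o3 o4
      have l1 : σ3.reg .i = i := by simpa [k1] using hF3.reg .i rfl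
      have hE5 : Env D σ3 := Env.frame (σ := σ'.tick)
        ⟨hE4.n, hE4.p, hE4.k, hE4.m, hE4.e1, hE4.e2, hE4.a, hE4.b, hE4.wt⟩ hF3 rfl
      have hP3 : Progress D rk L' σ3 := i4.of_eq o2 (hF3.reg .b rfl) (hF3.reg .T rfl)
      have hpot3 : pot D σ3 = pot D σ' := by simp only [pot, clusters, o2]
      have hsum : σ3.reg .a + σ3.reg .v = σ'.reg .a + σ'.reg .v := by omega
      have hsep : ∀ x, Separates (D.n - 1) (σ.arr .par) (σ'.reg .a) (σ'.reg .v) x ↔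
          Separates (D.n - 1) (σ.arr .par) (σ3.reg .a) (σ3.reg .v) x := by
        intro x
        rcases o4 with ⟨h1, h2⟩ | ⟨h1, h2⟩ <;> rw [h1, h2]
        exact separates_comm
      have hop : Open D L' (σ3.reg .a) ∧ Open D L' (σ3.reg .v) := by
        rcases o4 with ⟨h1, h2⟩ | ⟨h1, h2⟩ <;> rw [h1, h2]
        · exact ⟨i5, i6⟩
        · exact ⟨i6, i5⟩
      have ham : σ3.reg .a < D.n - 1 := by omega
      have hvm : σ3.reg .v ≤ D.n - 1 := by omega
      have hlen : (L' (σ3.reg .a)).length < D.k := hop.1.resolve_left ham.ne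
      rw [Runs.seq_iff]
      refine Runs.mono (visitP_spec hc hE5 hP3 rfl ham hlen l1 hip)
        fun σ4 hF4 ⟨r1, r2, r3⟩ => ?_
      have m1 : σ4.reg .a = σ3.reg .a := hF4.reg .a rfl
      have m2 : σ4.reg .v = σ3.reg .v := hF4.reg .v rfl
      have m3 : σ4.arr .par = σ.arr .par := by rw [hF4.arr .par rfl, o2, k2]
      have hE6 : Env D σ4 := hE5.frame hF4 rfl
      set a := σ3.reg .a with ha
      have hpa := r1.rooted.par_lt a ham
      rw [m3] at hpa
      rw [Runs.seq_iff, Runs.asg_iff]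
      simp only [HE.val_get, HE.val_var, m1, m3]
      refine ⟨by simp, by omega, ?_⟩
      rw [Runs.seq_iff]
      have hE7 : Env D (σ4.set .x (σ.arr .par a)) := by
        refine Env.frame (P := processP) hE6 ⟨fun v hv => ?_, fun _ _ => rfl⟩ rfl
        have h1 : v ≠ .x := by rintro rfl; exact absurd hv (by decide)
        simp [h1]
      refine Runs.mono ((r1.of_eq (τ := σ4.set .x (σ.arr .par a)) rfl (by simp)
        (by simp)).findP_spec hD hc hE7 (x := σ.arr .par a) (by simp) (by omega))
        fun σ5 hF5 ⟨s1, s2, s3, s4, s5, s6⟩ => ?_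
      have n1 : σ5.reg .v = σ3.reg .v := by simpa [m2] using hF5.reg .v rfl
      have e3 : pot D (σ4.set .x (σ.arr .par a)) = pot D σ4 := rfl
      simp only [e3, Store.tm_set, Store.arr_set, m3] at s3 s5 s6
      set L'' := Function.update L' a (L' a ++ [i]) with hL''
      have htot : total D L'' = total D L' + 1 := total_append ham
      rw [Runs.asg_iff]
      simp only [HE.val_var]
      have hmove : ∀ x, Open D L'' x ∨ x = a →
          (Separates (D.n - 1) (σ.arr .par) (σ5.reg .x) (σ3.reg .v) x ↔
            Separates (D.n - 1) (σ.arr .par) a (σ3.reg .v) x ∧ x ≠ a) :=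
        fun x hx => separates_move hpar ham o1 s3 hx
      have hgt : a < σ5.reg .x := lt_of_lt_of_le (hpar a ham) (s3.le hpar)
      have hof : ∀ x, x ≠ a → L'' x = L' x := fun x hx => Function.update_of_ne hx _ _
      have hsa := separates_self hpar o1
      have hta := i7 a ham hlen ((hsep a).2 hsa)
      refine ⟨by simp, by omega, 2 * (D.n - 1) - (σ5.reg .x + σ3.reg .v), by omega, ?_⟩
      simp only [Store.reg_set_self, Store.reg_set_of_ne, ne_eq, reduceCtorEq, not_false_eq_true,
        n1]
      refine ⟨by omega, s2, hvm, L'', s1.of_eq rfl (by simp) (by simp), s4, ?_, ?_, ?_, ?_⟩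
      · rcases hop.2 with h | h
        · exact Or.inl h
        · exact Or.inr (by rw [hof _ o1.ne']; exact h)
      · intro x hx h1 h2
        obtain ⟨h3, h4⟩ := (hmove x (Or.inl (Or.inr h1))).1 h2
        rw [hof x h4] at h1
        exact i7 x hx h1 ((hsep x).2 h3)
      · intro x hx
        by_cases hxa : x = a
        · rw [hxa]
          have h1 : ¬ Separates (D.n - 1) (σ.arr .par) (σ5.reg .x) (σ3.reg .v) a :=
            fun h => ((hmove a (Or.inr rfl)).1 h).2 rfl
          have h2 := i8 a ham
          rw [if_neg fun h => h.2 ⟨hlen, (hsep a).2 hsa⟩] at h2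
          rw [if_pos ⟨⟨h2 ▸ hlen, hta⟩, fun h => h1 h.2⟩, hL'', Function.update_self, h2]
        · have h1 := i8 x hx
          rw [hof x hxa]
          have h2 : ((L' x).length < D.k ∧
                Separates (D.n - 1) (σ.arr .par) (σ5.reg .x) (σ3.reg .v) x) ↔
              ((L' x).length < D.k ∧
                Separates (D.n - 1) (σ.arr .par) (σ'.reg .a) (σ'.reg .v) x) := by
            refine and_congr_right fun h => ?_
            rw [hmove x (Or.inl (Or.inr (by rw [hof x hxa]; exact h))), hsep x]
            exact and_iff_left hxa
          simp only [h2]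
          exact h1
      · change σ5.tm + 1 + _ + _ ≤ _ + 50 * pot D σ5 + _
        omega

end

/-! ### Processing all paths in the order of their weights -/

/-- The paths of weight `w` among the first `i` paths. -/
def bucket (D : Data) (i w : ℕ) : List ℕ := (List.range i).filter fun j => D.wt j = w

/-- The paths of weight less than `w`, sorted by weight. -/
def order (D : Data) (w : ℕ) : List ℕ := (List.range w).flatMap (bucket D D.p)

/-- The lists of the edges after the paths in the list `l` have been processed. -/
noncomputable def lists (D : Data) (pos par : ℕ → ℕ) (l : List ℕ) (x : ℕ) : List ℕ :=
  open scoped Classical in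
  (l.filter fun i => Separates (D.n - 1) par (pos (D.a i)) (pos (D.b i)) x).take D.k

theorem bucket_succ (D : Data) (i w : ℕ) :
    bucket D (i + 1) w = if D.wt i = w then bucket D i w ++ [i] else bucket D i w := by
  unfold bucket
  rw [List.range_succ, List.filter_append]
  split_ifs with h <;> simp [h]

theorem length_bucket_le (D : Data) (i w : ℕ) : (bucket D i w).length ≤ i :=
  (List.length_filter_le _ _).trans (by simp)

theorem mem_bucket {D : Data} {i w j : ℕ} : j ∈ bucket D i w ↔ j < i ∧ D.wt j = w := by
  simp [bucket]

theorem order_succ (D : Data) (w : ℕ) : order D (w + 1) = order D w ++ bucket D D.p w := by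
  simp [order, List.range_succ, List.flatMap_append]

theorem mem_order {D : Data} {w j : ℕ} : j ∈ order D w ↔ j < D.p ∧ D.wt j < w := by
  simp only [order, List.mem_flatMap, List.mem_range, mem_bucket]
  constructor
  · rintro ⟨w', h1, h2, rfl⟩; exact ⟨h2, h1⟩
  · rintro ⟨h1, h2⟩; exact ⟨_, h2, h1, rfl⟩

theorem order_sorted (D : Data) (w : ℕ) :
    (order D w).Pairwise fun i j => i ≠ j ∧ D.wt i ≤ D.wt j := by
  induction w with
  | zero => simp [order]
  | succ w ih =>
    rw [order_succ, List.pairwise_append]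
    refine ⟨ih, ?_, fun i hi j hj => ?_⟩
    · have h1 : (bucket D D.p w).Nodup := List.Nodup.filter _ List.nodup_range
      exact h1.imp_of_mem fun hi hj h => ⟨h, by
        rw [(mem_bucket.1 hi).2, (mem_bucket.1 hj).2]⟩
    · have h1 := mem_order.1 hi
      have h2 := mem_bucket.1 hj
      refine ⟨?_, by omega⟩
      rintro rfl
      omega

theorem length_order_le (D : Data) (w : ℕ) : (order D w).length ≤ D.p := by
  have h1 : (order D w).Nodup := (order_sorted D w).imp fun h => h.1
  rw [← List.toFinset_card_of_nodup h1, ← Finset.card_range D.p]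
  refine Finset.card_le_card fun j hj => ?_
  rw [List.mem_toFinset, mem_order] at hj
  exact Finset.mem_range.2 hj.1

/-- Processing one more path at the end of the list. -/
theorem lists_append {D : Data} {pos par : ℕ → ℕ} {l : List ℕ} {L : ℕ → List ℕ} {i x : ℕ}
    (h : L x = lists D pos par l x) :
    extend D par (pos (D.a i)) (pos (D.b i)) i L x = lists D pos par (l ++ [i]) x := by
  classical
  unfold extend
  rw [h]
  unfold lists
  rw [List.filter_append, List.take_append]
  set f := l.filter fun i => Separates (D.n - 1) par (pos (D.a i)) (pos (D.b i)) x with hf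
  by_cases hs : Separates (D.n - 1) par (pos (D.a i)) (pos (D.b i)) x
  · by_cases hk : f.length < D.k
    · rw [if_pos ⟨by rw [List.length_take]; omega, hs⟩]
      congr 1
      rw [List.filter_singleton]
      obtain ⟨t, ht⟩ := Nat.exists_eq_add_of_lt hk
      simp [hs, ht, show f.length + t + 1 - f.length = t + 1 by omega]
    · rw [if_neg fun h => hk (by have := h.1; rw [List.length_take] at this; omega)]
      simp [show D.k - f.length = 0 by omega]
  · simp [hs]

/-- The paths are in the buckets of their weights. -/
def Bucketed (D : Data) (i : ℕ) (bcnt bkt : ℕ → ℕ) : Prop :=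
  ∀ w, bcnt w = (bucket D i w).length ∧
    ∀ t < (bucket D i w).length, bkt (w * D.p + t) = (bucket D i w).getD t 0

/-- Sorting the paths into buckets. At the end `mx` exceeds all weights. -/
def bucketP : HP :=
  .asg .mx 0 ;;
  .for .j .p (
    .asg .x (.get .inp (3 + 2 * ♯.m + 2 * ♯.p + ♯.j)) ;;
    .sto .bkt (♯.x * ♯.p + .get .bcnt ♯.x) ♯.j ;;
    .sto .bcnt ♯.x (.get .bcnt ♯.x + 1) ;;
    .ite (HE.less ♯.mx (♯.x + 1)) (.asg .mx (♯.x + 1)) .skip)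

/-- Processing the paths bucket by bucket. -/
def mainP : HP :=
  .for .w .mx (
    .asg .r (.get .bcnt ♯.w) ;;
    .for .l .r (
      .asg .i (.get .bkt (♯.w * ♯.p + ♯.l)) ;;
      processP))

theorem Bucketed.step {D : Data} {i : ℕ} {bcnt bkt : ℕ → ℕ} (h : Bucketed D i bcnt bkt)
    (hi : i < D.p) : Bucketed D (i + 1)
      (Function.update bcnt (D.wt i) ((bucket D i (D.wt i)).length + 1))
      (Function.update bkt (D.wt i * D.p + (bucket D i (D.wt i)).length) i) := by
  intro w
  obtain ⟨h1, h2⟩ := h w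
  have hl := length_bucket_le D i
  rw [bucket_succ]
  by_cases hw : D.wt i = w
  · subst hw
    rw [if_pos rfl, Function.update_self]
    refine ⟨by simp, fun t ht => ?_⟩
    rw [List.length_append, List.length_singleton] at ht
    rcases Nat.lt_succ_iff_lt_or_eq.1 ht with ht | rfl
    · rw [Function.update_of_ne (by omega), h2 t ht, List.getD_append _ _ _ _ ht]
    · rw [Function.update_self, List.getD_append_right _ _ _ _ le_rfl]
      simp
  · rw [if_neg hw, Function.update_of_ne (Ne.symm hw)]
    refine ⟨h1, fun t ht => ?_⟩
    have := hl w
    have := hl (D.wt i)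
    rw [Function.update_of_ne fun he => hw (mul_add_inj (by omega) (by omega) he).1.symm, h2 t ht]

section
variable {D : Data} {c : Ctx} {σ : Store} {rk : ℕ → ℕ}

theorem bucketP_spec (hD : D.Ok) (hc : Big D c) (hE : Env D σ)
    (hcnt : ∀ w, σ.arr .bcnt w = 0) :
    Runs c bucketP σ fun σ' => Bucketed D D.p (σ'.arr .bcnt) (σ'.arr .bkt) ∧
      (∀ i < D.p, D.wt i < σ'.reg .mx) ∧ σ'.reg .mx ≤ D.C + 1 ∧ σ'.tm ≤ σ.tm + 10 + 10 * D.p := by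
  have hX := hc.hX
  have hn := hD.n_pos
  rw [bucketP, Runs.seq_iff, Runs.asg_iff]
  refine ⟨by simp, by simp; omega, ?_⟩
  refine Runs.for_rule rfl rfl (by simp) D.p (by simpa using hE.p) (by omega) (fun i σ' =>
    Bucketed D i (σ'.arr .bcnt) (σ'.arr .bkt) ∧ (∀ j < i, D.wt j < σ'.reg .mx) ∧
    σ'.reg .mx ≤ D.C + 1 ∧ σ'.tm ≤ σ.tm + 3 + 8 * i) ?_ ?_ ?_
  · refine ⟨fun w => ⟨by simp [hcnt, bucket], by simp [bucket]⟩, by simp, by simp, by simp⟩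
  · rintro i σ' hi hF hr ⟨h1, h2, h3, h4⟩
    have f1 : σ'.reg .m = D.n - 1 := by simpa [hE.m] using hF.reg .m rfl
    have f2 : σ'.reg .p = D.p := by simpa [hE.p] using hF.reg .p rfl
    have f3 : σ'.arr .inp = σ.arr .inp := by simpa using hF.arr .inp rfl
    have hw := hE.wt i hi
    rw [hE.m, hE.p] at hw
    have hle := hD.wt_le i hi
    have hb := (h1 (D.wt i)).1
    have hl := length_bucket_le D i (D.wt i)
    have hs := h1.step hi
    rw [Runs.seq_iff, Runs.asg_iff]
    simp only [HE.val_get, HE.val_add, HE.val_mul, HE.val_ofNat, HE.val_var, Store.reg_tick,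
      Store.arr_tick, f1, f2, f3, hr, hw]
    refine ⟨by simp [hc.li, f1, f2, hr]; omega, by omega, ?_⟩
    rw [Runs.seq_iff, Runs.sto_iff]
    simp only [HE.val_get, HE.val_add, HE.val_mul, HE.val_var, Store.reg_set_self, Store.arr_set,
      Store.reg_set_of_ne, Store.reg_tick, Store.arr_tick, ne_eq, reduceCtorEq, not_false_eq_true,
      f2, hr, hb]
    refine ⟨by simp, trivial, by simp, by omega, ?_⟩
    rw [Runs.seq_iff, Runs.sto_iff]
    simp only [HE.val_get, HE.val_add, HE.val_one, HE.val_var, Store.reg_set_self, Store.arr_set,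
      Store.reg_put, Store.arr_put_of_ne, Store.arr_tick, ne_eq, reduceCtorEq, not_false_eq_true,
      hb]
    refine ⟨by simp, trivial, by simp, by omega, ?_⟩
    rw [Runs.ite_iff]
    refine ⟨by simp, fun h => ?_, fun h => ?_⟩
    · rw [Runs.asg_iff]
      simp only [HE.val_add, HE.val_one, HE.val_var, Store.reg_set_self, Store.arr_set,
        Store.reg_tick, Store.reg_put] at h ⊢
      refine ⟨by simp, by omega, by simpa using hs, fun j hj => ?_, by simp; omega, by simp; omega⟩
      have hlt : σ'.reg .mx < D.wt i + 1 := by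
        by_contra hcon
        exact h (by simp [hcon])
      rcases Nat.lt_succ_iff_lt_or_eq.1 hj with hj | rfl
      · have := h2 j hj
        simp
        omega
      · simp
    · rw [Runs.skip_iff]
      have hlt : D.wt i + 1 ≤ σ'.reg .mx := by
        by_contra hcon
        simp at h
        omega
      refine ⟨by simpa using hs, fun j hj => ?_, by simp; omega, by simp; omega⟩
      rcases Nat.lt_succ_iff_lt_or_eq.1 hj with hj | rfl
      · have := h2 j hj
        simp
        omega
      · simp
        omega
  · rintro σ' hF hr ⟨h1, h2, h3, h4⟩
    exact ⟨h1, h2, h3, by simp; omega⟩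

theorem mainP_spec (hD : D.Ok) (hc : Big D c) (hE : Env D σ)
    (hP : Progress D rk (fun _ => []) σ)
    (hB : Bucketed D D.p (σ.arr .bcnt) (σ.arr .bkt)) (hmx : σ.reg .mx ≤ D.C + 1) :
    Runs c mainP σ fun σ' => ∃ L, Progress D rk L σ' ∧
      (∀ x < D.n - 1,
        L x = lists D (σ.arr .pos) (σ.arr .par) (order D (σ.reg .mx)) x) ∧
      σ'.tm + 50 * pot D σ ≤
        σ.tm + 10 + 10 * σ.reg .mx + 40 * D.p + 50 * pot D σ' + 50 * total D L := by
  have hX := hc.hX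
  have hn := hD.n_pos
  set pos := σ.arr .pos with hpos
  set par := σ.arr .par with hpar
  rw [mainP]
  refine Runs.for_rule rfl rfl (by simp) (σ.reg .mx) rfl (by omega) (fun w σ' =>
    ∃ L, Progress D rk L σ' ∧ (∀ x < D.n - 1, L x = lists D pos par (order D w) x) ∧
      σ'.tm + 50 * pot D σ ≤
        σ.tm + 1 + 10 * w + 40 * (order D w).length + 50 * pot D σ' + 50 * total D L) ?_ ?_ ?_
  · refine ⟨_, hP.of_eq rfl (by simp) (by simp), fun x _ => by simp [order, lists], ?_⟩
    change σ.tm + 1 + 50 * pot D σ ≤ _ + 50 * pot D σ + _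
    omega
  · rintro w σ' hw hF hr ⟨L, h1, h2, h3⟩
    have f1 : σ'.arr .bcnt = σ.arr .bcnt := hF.arr .bcnt rfl
    have f2 : σ'.arr .bkt = σ.arr .bkt := hF.arr .bkt rfl
    have f3 : σ'.arr .pos = pos := hF.arr .pos rfl
    have f4 : σ'.arr .par = par := hF.arr .par rfl
    have f5 : σ'.reg .p = D.p := by rw [hF.reg .p rfl]; exact hE.p
    have hE1 : Env D σ' := hE.frame hF rfl
    obtain ⟨b1, b2⟩ := hB w
    have hl := length_bucket_le D D.p w
    rw [Runs.seq_iff, Runs.asg_iff]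
    simp only [HE.val_get, HE.val_var, Store.reg_tick, Store.arr_tick, f1, hr, b1]
    refine ⟨by simp, by omega, ?_⟩
    refine Runs.for_rule rfl rfl (by simp) (bucket D D.p w).length (by simp) (by omega)
      (fun l σ'' => ∃ L, Progress D rk L σ'' ∧
        (∀ x < D.n - 1, L x = lists D pos par (order D w ++ (bucket D D.p w).take l) x) ∧
        σ''.tm + 50 * pot D σ ≤ σ.tm + 7 + 10 * w + 40 * ((order D w).length + l) +
          50 * pot D σ'' + 50 * total D L) ?_ ?_ ?_
    · refine ⟨L, h1.of_eq rfl (by simp) (by simp), fun x hx => by simpa using h2 x hx, ?_⟩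
      change σ'.tm + 1 + 1 + 1 + 50 * pot D σ ≤ _ + 50 * pot D σ' + _
      omega
    · rintro l σ2 hl2 hF2 hr2 ⟨L2, i1, i2, i3⟩
      have g1 : σ2.reg .w = w := by simpa [hr] using hF2.reg .w rfl
      have g2 : σ2.reg .p = D.p := by simpa [f5] using hF2.reg .p rfl
      have g3 : σ2.arr .bkt = σ.arr .bkt := by simpa [f2] using hF2.arr .bkt rfl
      have g4 : σ2.arr .pos = pos := by simpa [f3] using hF2.arr .pos rfl
      have g5 : σ2.arr .par = par := by simpa [f4] using hF2.arr .par rfl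
      have hE2 : Env D σ2 := by
        refine Env.frame (P := mainP) hE1 ⟨fun v hv => ?_, fun a ha => ?_⟩ rfl
        · rw [hF2.reg v (by revert hv; cases v <;> decide)]
          have h1 : v ≠ .r := by rintro rfl; exact absurd hv (by decide)
          simp [h1]
        · rw [hF2.arr a (by revert ha; cases a <;> decide)]
          simp
      have hget := b2 l hl2
      rw [List.getD_eq_getElem _ _ hl2] at hget
      have hmem := List.getElem_mem hl2
      set i := (bucket D D.p w)[l] with hi
      have hip := (mem_bucket.1 hmem).1
      rw [Runs.seq_iff, Runs.asg_iff]
      simp only [HE.val_get, HE.val_add, HE.val_mul, HE.val_var, Store.reg_tick, Store.arr_tick,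
        g1, g2, g3, hr2, hget]
      refine ⟨by simp, by omega, ?_⟩
      have hE3 : Env D (σ2.tick.set .i i) := by
        refine Env.frame (P := mainP) hE2 ⟨fun v hv => ?_, fun _ _ => rfl⟩ rfl
        have h1 : v ≠ .i := by rintro rfl; exact absurd hv (by decide)
        simp [h1]
      refine Runs.mono (processP_spec hD hc hE3
        (i1.of_eq (τ := σ2.tick.set .i i) rfl (by simp) (by simp)) (i := i) (by simp) hip)
        fun σ3 hF3 ⟨L3, q1, q2, q3⟩ => ?_
      have e1 : pot D (σ2.tick.set .i i) = pot D σ2 := rfl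
      simp only [e1, Store.arr_set, Store.arr_tick, Store.tm_set, Store.tm_tick, g4, g5] at q2 q3
      refine ⟨L3, q1.of_eq rfl (by simp) (by simp), fun x hx => ?_, ?_⟩
      · rw [q2 x hx, lists_append (i2 x hx), List.append_assoc, hi,
          ← List.take_succ_eq_append_getElem hl2]
      · change σ3.tm + 1 + _ ≤ _ + 50 * pot D σ3 + _
        omega
    · rintro σ2 hF2 hr2 ⟨L2, i1, i2, i3⟩
      rw [List.take_length, ← order_succ] at i2
      refine ⟨L2, i1.of_eq rfl (by simp) (by simp), i2, ?_⟩
      rw [order_succ, List.length_append]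
      change σ2.tm + 1 + 1 + _ ≤ _ + 50 * pot D σ2 + _
      omega
  · rintro σ' hF hr ⟨L, h1, h2, h3⟩
    refine ⟨L, h1.of_eq rfl rfl rfl, h2, ?_⟩
    have := length_order_le D (σ.reg .mx)
    change σ'.tm + 1 + _ ≤ _ + 50 * pot D σ' + _
    omega

end

/-! ### The whole program -/

/-- Reading the parameters. -/
def setupP : HP :=
  .asg .n (.get .inp 0) ;; .asg .p (.get .inp 1) ;; .asg .k (.get .inp 2) ;; .asg .m (♯.n - 1)

/-- Everything before the main loop. -/
def prepareP : HP :=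
  setupP ;; bucketP ;; rootP ;; tableP ;; groupP ;; clusterP

/-- The algorithm. -/
def solveP : HP := prepareP ;; mainP

/-- The initial state for the data `D`. -/
structure Start (D : Data) (σ : Store) : Prop where
  n : σ.arr .inp 0 = D.n
  p : σ.arr .inp 1 = D.p
  k : σ.arr .inp 2 = D.k
  e1 : ∀ j < D.n - 1, σ.arr .inp (3 + j) = D.e1 j
  e2 : ∀ j < D.n - 1, σ.arr .inp (3 + (D.n - 1) + j) = D.e2 j
  a : ∀ i < D.p, σ.arr .inp (3 + 2 * (D.n - 1) + i) = D.a i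
  b : ∀ i < D.p, σ.arr .inp (3 + 2 * (D.n - 1) + D.p + i) = D.b i
  wt : ∀ i < D.p, σ.arr .inp (3 + 2 * (D.n - 1) + 2 * D.p + i) = D.wt i
  arr : ∀ a, a ≠ .inp → ∀ i, σ.arr a i = 0
  tm : σ.tm = 0

section
variable {D : Data} {c : Ctx} {σ : Store}

theorem setupP_spec (hD : D.Ok) (hc : Big D c) (hS : Start D σ) :
    Runs c setupP σ fun σ' => Env D σ' ∧ σ'.tm ≤ 4 := by
  have hX := hc.hX
  have hn := hD.n_pos
  have hk : D.k + 1 ≤ D.n * (D.k + 1) := Nat.le_mul_of_pos_left _ hn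
  rw [setupP, Runs.seq_iff, Runs.asg_iff]
  simp only [HE.val_get, HE.val_zero, hS.n]
  refine ⟨by simp [hc.li], by omega, ?_⟩
  rw [Runs.seq_iff, Runs.asg_iff]
  simp only [HE.val_get, HE.val_one, Store.arr_set, hS.p]
  refine ⟨by simp [hc.li]; omega, by omega, ?_⟩
  rw [Runs.seq_iff, Runs.asg_iff]
  simp only [HE.val_get, HE.val_ofNat, Store.arr_set, hS.k]
  refine ⟨by simp [hc.li]; omega, by omega, ?_⟩
  rw [Runs.asg_iff]
  refine ⟨by simp; omega, by simp; omega, ⟨?_, ?_, ?_, ?_, ?_, ?_, ?_, ?_, ?_⟩, by simp [hS.tm]⟩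
  · simp
  · simp
  · simp
  · simp
  · simpa using hS.e1
  · simpa using hS.e2
  · simpa using hS.a
  · simpa using hS.b
  · simpa using hS.wt

theorem Table.b_le {n b T : ℕ} {hb : ℕ → ℕ} (h : Table n b T hb) : b ≤ 4 * n := by
  have h1 : 2 * b < 2 ^ (2 * b) := Nat.lt_two_pow_self
  have h2 := h.T_eq
  have h3 := h.T_le
  omega

/-- Before the first merge, with all vertices marked. -/
theorem Fresh.finder (hD : D.Ok) {rk : ℕ → ℕ} {mk : ℕ → Prop} (hmk : ∀ x, mk x)
    (hM : Micro (D.n - 1) (σ.reg .T) (σ.arr .par) (σ.arr .cl) (σ.arr .anc) (σ.arr .pw)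
      (σ.arr .exit) (σ.arr .vt) rk)
    (hT : Table D.n (σ.reg .b) (σ.reg .T) (σ.arr .hb))
    (hF : Fresh (D.n - 1) (σ.arr .cl) rk (σ.arr .mark) (σ.arr .lab) (σ.arr .elem) (σ.arr .size)
      (σ.arr .top))
    (h1 : ∀ x, σ.arr .mark x < σ.reg .T) (h2 : ∀ x ≤ D.n - 1, σ.arr .anc x < σ.reg .T)
    (h3 : ∀ x ≤ D.n - 1, σ.arr .cl x ≤ D.n - 1) : Finder D rk mk σ := by
  have hn := hD.n_pos
  have hlab : ∀ k ∈ clusters D σ, σ.arr .lab k = k ∧ σ.arr .elem (k * D.n) = k ∧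
      σ.arr .size k = 1 ∧ σ.arr .top k = k := by
    intro k hk
    obtain ⟨x, hx, rfl⟩ := Finset.mem_image.1 hk
    have hx' : x ≤ D.n - 1 := by simp at hx; omega
    have he := hF.elem_eq x hx'
    rw [Nat.sub_add_cancel hn] at he
    exact ⟨hF.lab_eq x hx', he, hF.size_eq x hx', hF.top_eq x hx'⟩
  refine ⟨hM, hT, h2, h3, h1, fun x hx => iff_of_true (hF.mark_bit x hx) (hmk x), hmk _,
    ⟨?_, ?_, ?_, ?_⟩, ?_⟩
  · intro k hk
    rwa [(hlab k hk).1]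
  · intro g hg
    rw [(hlab g hg).2.2.1, show ((clusters D σ).filter fun c => σ.arr .lab c = g) = {g} from ?_]
    · rfl
    · ext k
      simp only [Finset.mem_filter, Finset.mem_singleton]
      constructor
      · rintro ⟨h4, h5⟩
        rw [← h5, (hlab k h4).1]
      · rintro rfl
        exact ⟨hg, (hlab k hg).1⟩
  · intro g hg t ht
    rw [(hlab g hg).2.2.1] at ht
    have : t = 0 := by omega
    subst this
    rw [add_zero, (hlab g hg).2.1]
    exact ⟨hg, (hlab g hg).1⟩
  · intro k hk
    refine ⟨0, ?_, ?_⟩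
    · rw [(hlab k hk).1, (hlab k hk).2.2.1]
      omega
    · rw [(hlab k hk).1, add_zero, (hlab k hk).2.1]
  · intro k hk hne
    rw [(hlab k hk).1, (hlab k hk).2.2.2, (hlab k hk).1]
    exact ⟨hk, hne, rfl, Relation.ReflTransGen.refl⟩

theorem prepareP_spec (hD : D.Ok) (hc : Big D c) (hS : Start D σ) :
    Runs c prepareP σ fun σ' => Env D σ' ∧ (∃ rk, Progress D rk (fun _ => []) σ') ∧
      Bucketed D D.p (σ'.arr .bcnt) (σ'.arr .bkt) ∧ (∀ i < D.p, D.wt i < σ'.reg .mx) ∧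
      σ'.reg .mx ≤ D.C + 1 ∧ σ'.reg .b * (clusters D σ').card ≤ D.n + σ'.reg .b ∧
      σ'.tm ≤ 14 + 10 * D.p + 200 * D.n := by
  have hn := hD.n_pos
  rw [prepareP, Runs.seq_iff]
  refine (setupP_spec hD hc hS).mono fun σ0 hF0 ⟨hE0, ht0⟩ => ?_
  have z0 : ∀ a, a ≠ .inp → ∀ i, σ0.arr a i = 0 := fun a ha i => by
    rw [hF0.arr a (by cases a <;> rfl)]; exact hS.arr a ha i
  rw [Runs.seq_iff]
  refine (bucketP_spec hD hc hE0 (z0 _ (by decide))).mono fun σ1 hF1 ⟨b1, b2, b3, ht1⟩ => ?_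
  have hE1 := hE0.frame hF1 rfl
  rw [Runs.seq_iff]
  refine (rootP_spec hD hc hE1 (fun v => by rw [hF1.arr .deg rfl]; exact z0 _ (by decide) v)
    (fun v => by rw [hF1.arr .es rfl]; exact z0 _ (by decide) v)).mono
    fun σ2 hF2 ⟨hR2, ht2⟩ => ?_
  have hE2 := hE1.frame hF2 rfl
  rw [Runs.seq_iff]
  refine (tableP_spec hD hc hE2).mono fun σ3 hF3 ⟨hT3, ht3⟩ => ?_
  have hE3 := hE2.frame hF3 rfl
  have hR3 : Rooted D (σ3.arr .pos) (σ3.arr .par) (σ3.arr .eid) := by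
    rw [hF3.arr .pos rfl, hF3.arr .par rfl, hF3.arr .eid rfl]; exact hR2
  rw [Runs.seq_iff]
  refine (groupP_spec hD hc hE3 hR3 hT3.b_pos hT3.b_le
    (fun v => by
      rw [hF3.arr .acc rfl, hF2.arr .acc rfl, hF1.arr .acc rfl]; exact z0 _ (by decide) v)
    (fun v => by
      rw [hF3.arr .closed rfl, hF2.arr .closed rfl, hF1.arr .closed rfl]
      exact z0 _ (by decide) v)).mono fun σ4 hF4 ⟨hG4, ht4⟩ => ?_
  have hE4 := hE3.frame hF4 rfl
  have hR4 : Rooted D (σ4.arr .pos) (σ4.arr .par) (σ4.arr .eid) := by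
    rw [hF4.arr .pos rfl, hF4.arr .par rfl, hF4.arr .eid rfl]; exact hR3
  have hT4 : Table D.n (σ4.reg .b) (σ4.reg .T) (σ4.arr .hb) := by
    rw [hF4.arr .hb rfl, hF4.reg .b rfl, hF4.reg .T rfl]; exact hT3
  refine (clusterP_spec hD hc hE4 hR4 hT4 hG4
    (fun v => by
      rw [hF4.arr .mark rfl, hF3.arr .mark rfl, hF2.arr .mark rfl, hF1.arr .mark rfl]
      exact z0 _ (by decide) v)
    (fun v => by
      rw [hF4.arr .nxt rfl, hF3.arr .nxt rfl, hF2.arr .nxt rfl, hF1.arr .nxt rfl]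
      exact z0 _ (by decide) v)).mono fun σ5 hF5 ⟨rk, m1, m2, m3, m4, m5, m6, ht5⟩ => ?_
  have hR5 : Rooted D (σ5.arr .pos) (σ5.arr .par) (σ5.arr .eid) := by
    rw [hF5.arr .pos rfl, hF5.arr .par rfl, hF5.arr .eid rfl]; exact hR4
  have hT5 : Table D.n (σ5.reg .b) (σ5.reg .T) (σ5.arr .hb) := by
    rw [hF5.arr .hb rfl, hF5.reg .b rfl, hF5.reg .T rfl]; exact hT4
  have hmx : σ5.reg .mx = σ1.reg .mx := by
    rw [hF5.reg .mx rfl, hF4.reg .mx rfl, hF3.reg .mx rfl, hF2.reg .mx rfl]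
  have hz : σ5.arr .out = fun _ => 0 := by
    rw [hF5.arr .out rfl, hF4.arr .out rfl, hF3.arr .out rfl, hF2.arr .out rfl, hF1.arr .out rfl]
    exact funext (z0 _ (by decide))
  refine ⟨hE4.frame hF5 rfl, ⟨rk, hR5, ?_, ?_⟩, ?_, by rw [hmx]; exact b2, by rw [hmx]; exact b3,
    m6, by omega⟩
  · exact m2.finder hD (fun x => Or.inr hD.k_pos) m1 hT5 m3 m4 m5
  · intro x _
    simp [hz]
  · rw [hF5.arr .bcnt rfl, hF4.arr .bcnt rfl, hF3.arr .bcnt rfl, hF2.arr .bcnt rfl,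
      hF5.arr .bkt rfl, hF4.arr .bkt rfl, hF3.arr .bkt rfl, hF2.arr .bkt rfl]
    exact b1

/-- There are `O(n / b)` clusters, so all merges together take linear time. -/
theorem pot_le {b T : ℕ} {hb : ℕ → ℕ} (hT : Table D.n b T hb)
    (hsub : clusters D σ ⊆ Finset.range D.n) (h : b * (clusters D σ).card ≤ D.n + b) :
    pot D σ ≤ 10 * D.n := by
  have h1 : pot D σ ≤ _ := potential_le (clusters D σ) (σ.arr .lab)
  have h2 : (clusters D σ).card ≤ D.n := by simpa using Finset.card_le_card hsub
  have h3 : Nat.log 2 (clusters D σ).card ≤ 2 * b := by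
    refine (Nat.log_mono_right h2).trans (Nat.le_of_lt (Nat.log_lt_of_lt_pow' ?_ ?_))
    · have := hT.b_pos; omega
    · rw [← hT.T_eq]; exact hT.lt_T
  have h4 : (clusters D σ).card * Nat.log 2 (clusters D σ).card ≤
      (clusters D σ).card * (2 * b) := Nat.mul_le_mul_left _ h3
  have h5 : (clusters D σ).card * (2 * b) = 2 * (b * (clusters D σ).card) := by ring
  have h6 := hT.b_le
  omega

/-- The time bound adds up the preparation, `O(n + p)`, the passage through the buckets, `O(C)`, the
paths, `O(p)`, the merges, `O(n)`, and the entries of the lists, at most `(n - 1) k`. -/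
theorem solveP_spec (hD : D.Ok) (hc : Big D c) (hS : Start D σ) :
    Runs c solveP σ fun σ' => ∃ (pos par eid : ℕ → ℕ) (L : ℕ → List ℕ) (mx : ℕ),
      Rooted D pos par eid ∧ Written D eid (σ'.arr .out) L ∧ (∀ i < D.p, D.wt i < mx) ∧
      (∀ x < D.n - 1, L x = lists D pos par (order D mx) x) ∧
      σ'.tm ≤ 2000 * (D.n * D.k + D.p + D.C) := by
  have hn := hD.n_pos
  rw [solveP, Runs.seq_iff]
  refine (prepareP_spec hD hc hS).mono fun σ1 _ ⟨hE, ⟨rk, hP⟩, hB, hmx, hmx', hcard, htm⟩ => ?_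
  refine (mainP_spec hD hc hE hP hB hmx').mono fun σ2 hF2 ⟨L, p1, p2, p3⟩ => ?_
  refine ⟨σ1.arr .pos, σ1.arr .par, σ1.arr .eid, L, σ1.reg .mx, hP.rooted, ?_, hmx, p2, ?_⟩
  · have := p1.written
    rwa [hF2.arr .eid rfl] at this
  · have hcl : clusters D σ2 = clusters D σ1 := by simp only [clusters, hF2.arr .cl rfl]
    have h1 : pot D σ2 ≤ 10 * D.n :=
      pot_le hP.finder.table (hcl ▸ hP.finder.subset hD) (hcl ▸ hcard)
    have h2 : total D L ≤ (D.n - 1) * D.k := by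
      have := Finset.sum_le_card_nsmul (Finset.range (D.n - 1)) (fun x => (L x).length) D.k
        fun x hx => (p1.written x (Finset.mem_range.1 hx)).1
      simpa [total] using this
    have h3 : (D.n - 1) * D.k ≤ D.n * D.k := Nat.mul_le_mul_right _ (by omega)
    have h4 : D.n ≤ D.n * D.k := Nat.le_mul_of_pos_right _ hD.k_pos
    omega

end

/-! ### Paths in the tree and the rooted tree -/

/-- A function on `Fin N` extended by `0`. -/
def extendZero {N : ℕ} (f : Fin N → ℕ) (j : ℕ) : ℕ := if h : j < N then f ⟨j, h⟩ else 0

theorem extendZero_apply {N : ℕ} (f : Fin N → ℕ) (j : Fin N) : extendZero f j = f j := by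
  simp [extendZero]

theorem getD_ofFn {N : ℕ} (f : Fin N → ℕ) (j : ℕ) : (List.ofFn f).getD j 0 = extendZero f j := by
  unfold extendZero
  split_ifs with h
  · rw [List.getD_eq_getElem _ _ (by simpa using h), List.getElem_ofFn]
  · rw [List.getD_eq_default _ _ (by simpa using h)]

/-- The data of an instance with weights at most `C`. -/
def dataOf (I : TreePathInput) (C : ℕ) : Data where
  n := I.n
  p := I.p
  k := I.k
  C := C
  e1 := extendZero fun j => (I.edge j).1
  e2 := extendZero fun j => (I.edge j).2
  a := extendZero fun i => (I.ends i).1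
  b := extendZero fun i => (I.ends i).2
  wt := extendZero I.weight

section
variable {I : TreePathInput} {C : ℕ}

theorem exists_edge_of_adj {u v : Fin I.n} (h : I.tree.Adj u v) :
    ∃ j : Fin (I.n - 1), I.edgeSym j = s(u, v) := by
  rw [TreePathInput.tree, SimpleGraph.fromEdgeSet_adj] at h
  exact h.1

theorem dataOf_e1 (j : Fin (I.n - 1)) : (dataOf I C).e1 j = (I.edge j).1 :=
  extendZero_apply (fun j => ((I.edge j).1 : ℕ)) j

theorem dataOf_e2 (j : Fin (I.n - 1)) : (dataOf I C).e2 j = (I.edge j).2 :=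
  extendZero_apply (fun j => ((I.edge j).2 : ℕ)) j

theorem dataOf_a (i : Fin I.p) : (dataOf I C).a i = (I.ends i).1 :=
  extendZero_apply (fun i => ((I.ends i).1 : ℕ)) i

theorem dataOf_b (i : Fin I.p) : (dataOf I C).b i = (I.ends i).2 :=
  extendZero_apply (fun i => ((I.ends i).2 : ℕ)) i

theorem dataOf_wt (i : Fin I.p) : (dataOf I C).wt i = I.weight i := extendZero_apply I.weight i

theorem dataOf_ok (hT : I.tree.IsTree) (hk : 1 ≤ I.k) (hC : ∀ i, I.weight i ≤ C) :
    (dataOf I C).Ok := by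
  have hn : 1 ≤ I.n := by
    obtain ⟨x⟩ := hT.connected.nonempty
    have := x.2
    omega
  have hlt : ∀ {N M : ℕ} (f : Fin N → Fin M) (j : ℕ), j < N →
      extendZero (fun j => (f j : ℕ)) j < M := fun f j hj => by
    simp [extendZero, hj]
  refine ⟨hn, hk, fun j hj => hlt (fun j => (I.edge j).1) j hj,
    fun j hj => hlt (fun j => (I.edge j).2) j hj, fun j hj => hlt (fun j => (I.ends j).1) j hj,
    fun j hj => hlt (fun j => (I.ends j).2) j hj, fun i hi => ?_, ⟨?_, ?_, ?_⟩⟩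
  · have hi' : i < I.p := hi
    simpa [dataOf, extendZero, hi'] using hC ⟨i, hi'⟩
  · change (Finset.range I.n).card = (Finset.range (I.n - 1)).card + 1
    simp
    omega
  · intro j hj
    rw [Finset.mem_range] at hj
    exact ⟨Finset.mem_range.2 (hlt (fun j => (I.edge j).1) j hj),
      Finset.mem_range.2 (hlt (fun j => (I.edge j).2) j hj)⟩
  · intro S hS hne hSR
    obtain ⟨u, hu⟩ := hne
    obtain ⟨v, hv, hvS⟩ : ∃ v ∈ Finset.range I.n, v ∉ S := by
      by_contra hcon
      push Not at hcon
      exact hSR (Finset.Subset.antisymm hS hcon)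
    obtain ⟨q⟩ := hT.connected.preconnected ⟨u, Finset.mem_range.1 (hS hu)⟩
      ⟨v, Finset.mem_range.1 hv⟩
    obtain ⟨d, -, h1, h2⟩ := q.exists_boundary_dart {x | (x : ℕ) ∈ S} hu hvS
    obtain ⟨j, hj⟩ := exists_edge_of_adj d.adj
    refine ⟨j, Finset.mem_range.2 j.2, ?_⟩
    rw [dataOf_e1, dataOf_e2]
    rw [TreePathInput.edgeSym, Sym2.eq_iff] at hj
    rcases hj with ⟨h3, h4⟩ | ⟨h3, h4⟩ <;> rw [h3, h4]
    · exact Or.inl ⟨h1, h2⟩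
    · exact Or.inr ⟨h1, h2⟩

section rooted
variable {pos par eid : ℕ → ℕ} (hR : Rooted (dataOf I C) pos par eid)
include hR

theorem Rooted.exists_eid (j : ℕ) (hj : j < I.n - 1) : ∃ x < I.n - 1, eid x = j := by
  have h : Finset.image eid (Finset.range (I.n - 1)) = Finset.range (I.n - 1) := by
    refine Finset.eq_of_subset_of_card_le (fun y hy => ?_) ?_
    · obtain ⟨x, hx, rfl⟩ := Finset.mem_image.1 hy
      exact Finset.mem_range.2 (hR.eid_lt x (Finset.mem_range.1 hx))
    · rw [Finset.card_image_of_injOn]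
      intro x hx y hy he
      exact hR.eid_inj x (Finset.mem_range.1 (Finset.mem_coe.1 hx)) y
        (Finset.mem_range.1 (Finset.mem_coe.1 hy)) he
  obtain ⟨x, hx, he⟩ := Finset.mem_image.1 (h ▸ Finset.mem_range.2 hj)
  exact ⟨x, Finset.mem_range.1 hx, he⟩

/-- The positions of the ends of the edge at `x`. -/
theorem Rooted.edgeSym_eq {x : ℕ} {j : Fin (I.n - 1)} (hx : x < I.n - 1) (hj : eid x = j)
    {u v : Fin I.n} (h : I.edgeSym j = s(u, v)) :
    (pos u = x ∧ pos v = par x) ∨ (pos v = x ∧ pos u = par x) := by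
  have h1 := hR.edge x hx
  rw [hj, dataOf_e1, dataOf_e2] at h1
  rw [TreePathInput.edgeSym, Sym2.eq_iff] at h
  rcases h with ⟨h3, h4⟩ | ⟨h3, h4⟩ <;> rw [h3, h4] at h1
  · exact h1
  · exact h1.symm

/-- A trail crosses the edge at `x` if and only if the edge separates the ends of the trail. -/
theorem Rooted.mem_edges_iff {x : ℕ} {j : Fin (I.n - 1)} (hx : x < I.n - 1) (hj : eid x = j)
    {u v : Fin I.n} (q : I.tree.Walk u v) (hq : q.IsTrail) :
    I.edgeSym j ∈ q.edges ↔ Separates (I.n - 1) par (pos u) (pos v) x := by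
  have hgt : ∀ x < I.n - 1, x < par x := hR.par_gt
  induction q with
  | nil => simp [Separates]
  | @cons u u' v h q ih =>
    rw [SimpleGraph.Walk.isTrail_cons] at hq
    have ih := ih hq.1
    obtain ⟨j', hj'⟩ := exists_edge_of_adj h
    obtain ⟨y, hy, hyj⟩ := hR.exists_eid j' j'.2
    have h1 := hR.edgeSym_eq hy hyj hj'
    rw [SimpleGraph.Walk.edges_cons, List.mem_cons]
    by_cases hxy : x = y
    · subst hxy
      have hjj : j = j' := Fin.ext (hj.symm.trans hyj)
      subst hjj
      rw [hj'] at ih ⊢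
      have h2 : ¬ Separates (I.n - 1) par (pos u') (pos v) x := fun h => hq.2 (ih.2 h)
      have h3 : ¬ Above (I.n - 1) par (par x) x := fun h => by
        have := h.le hgt
        have := hgt x hx
        omega
      have h4 : Above (I.n - 1) par x x := Relation.ReflTransGen.refl
      simp only [true_or, true_iff]
      unfold Separates at h2 ⊢
      rcases h1 with ⟨h5, h6⟩ | ⟨h5, h6⟩ <;> simp only [h5, h6] at h2 ⊢
      · exact fun h => h3 ((not_not.1 h2).2 (h.1 h4))
      · exact fun h => h3 (h.2 ((not_not.1 h2).1 h4))
    · have h2 : I.edgeSym j ≠ s(u, u') := by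
        intro he
        have h3 := hR.edgeSym_eq hx hj he
        have h4 := hgt x hx
        have h5 := hgt y hy
        omega
      have h3 : Above (I.n - 1) par (pos u) x ↔ Above (I.n - 1) par (pos u') x := by
        rcases h1 with ⟨h5, h6⟩ | ⟨h5, h6⟩ <;> rw [h5, h6]
        · exact above_iff_of_ne hy hxy
        · exact (above_iff_of_ne hy hxy).symm
      rw [or_iff_right h2]
      refine ih.trans ?_
      unfold Separates
      rw [h3]

theorem Rooted.pathContains_iff (hT : I.tree.IsTree) {x : ℕ} {j : Fin (I.n - 1)}
    (hx : x < I.n - 1) (hj : eid x = j) (i : Fin I.p) : I.PathContains i j ↔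
      Separates (I.n - 1) par (pos ((dataOf I C).a i)) (pos ((dataOf I C).b i)) x := by
  rw [dataOf_a, dataOf_b]
  constructor
  · rintro ⟨q, hq, he⟩
    exact (hR.mem_edges_iff hx hj q hq.isTrail).1 he
  · intro h
    obtain ⟨q, hq⟩ := hT.connected.exists_isPath (I.ends i).1 (I.ends i).2
    exact ⟨q, hq, (hR.mem_edges_iff hx hj q hq.isTrail).2 h⟩

/-- The first `k` paths over an edge, in the order of their weights, are an answer. -/
theorem Rooted.isAnswer (hT : I.tree.IsTree) {x mx : ℕ} {j : Fin (I.n - 1)}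
    (hx : x < I.n - 1) (hj : eid x = j) (hmx : ∀ i < I.p, (dataOf I C).wt i < mx) :
    I.IsAnswer j (lists (dataOf I C) pos par (order (dataOf I C) mx) x) := by
  classical
  set D := dataOf I C with hD
  set F := (order D mx).filter fun i => Separates (I.n - 1) par (pos (D.a i)) (pos (D.b i)) x
    with hF
  have hL : lists D pos par (order D mx) x = F.take I.k := by
    unfold lists
    rw [hF]
    rfl
  have hmem : ∀ i : Fin I.p, (i : ℕ) ∈ F ↔ I.PathContains i j := by
    intro i
    rw [hR.pathContains_iff hT hx hj i, hF, List.mem_filter, mem_order, decide_eq_true_iff]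
    exact ⟨fun h => h.2, fun h => ⟨⟨i.2, hmx i i.2⟩, h⟩⟩
  have hmem' : ∀ r ∈ F, ∃ i : Fin I.p, (i : ℕ) = r ∧ I.PathContains i j := by
    intro r hr
    have h1 := (mem_order.1 (List.mem_filter.1 hr).1).1
    exact ⟨⟨r, h1⟩, rfl, (hmem ⟨r, h1⟩).1 hr⟩
  have hsort : F.Pairwise fun i j => i ≠ j ∧ D.wt i ≤ D.wt j := (order_sorted D mx).filter _
  have hnd : F.Nodup := hsort.imp fun h => h.1
  rw [hL]
  refine ⟨hnd.sublist (List.take_sublist _ _), fun r hr => hmem' r (List.mem_of_mem_take hr),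
    ?_, fun i i' hi hi' hn => ?_⟩
  · rw [List.length_take, ← List.toFinset_card_of_nodup hnd, ← Set.ncard_coe_finset,
      ← Set.ncard_image_of_injective _ Fin.val_injective]
    congr 2
    ext r
    simp only [List.coe_toFinset, Set.mem_ofPred_eq, Set.mem_image]
    constructor
    · intro hr
      obtain ⟨i, h1, h2⟩ := hmem' r hr
      exact ⟨i, h2, h1⟩
    · rintro ⟨i, h1, rfl⟩
      exact (hmem i).2 h1
  · have h1 := (hmem i').2 hi'
    rw [← List.take_append_drop I.k F, List.mem_append] at h1
    rw [← List.take_append_drop I.k F, List.pairwise_append] at hsort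
    have h2 := (hsort.2.2 _ hi _ (h1.resolve_left hn)).2
    rwa [hD, dataOf_wt, dataOf_wt] at h2

end rooted

/-! ### The machine -/

/-- The initial state of the structured program. -/
def startOf (I : TreePathInput) : Store where
  reg := fun _ => 0
  arr := fun a i => if a = .inp then I.encode.getD i 0 else 0
  tm := 0

/-- The entries of the encoding by position. -/
theorem encode_getD : ∀ i, I.encode.getD i 0 =
    if i < 3 then [I.n, I.p, I.k].getD i 0
    else if i < 3 + (I.n - 1) then extendZero (fun j => ((I.edge j).1 : ℕ)) (i - 3)
    else if i < 3 + 2 * (I.n - 1) then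
      extendZero (fun j => ((I.edge j).2 : ℕ)) (i - (3 + (I.n - 1)))
    else if i < 3 + 2 * (I.n - 1) + I.p then
      extendZero (fun i => ((I.ends i).1 : ℕ)) (i - (3 + 2 * (I.n - 1)))
    else if i < 3 + 2 * (I.n - 1) + 2 * I.p then
      extendZero (fun i => ((I.ends i).2 : ℕ)) (i - (3 + 2 * (I.n - 1) + I.p))
    else extendZero I.weight (i - (3 + 2 * (I.n - 1) + 2 * I.p)) := by
  intro i
  unfold TreePathInput.encode
  split_ifs with h1 h2 h3 h4 h5
  · rw [List.getD_append _ _ _ _ (by simp; omega), List.getD_append _ _ _ _ (by simp; omega),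
      List.getD_append _ _ _ _ (by simp; omega), List.getD_append _ _ _ _ (by simp; omega),
      List.getD_append _ _ _ _ (by simp; omega)]
  · rw [List.getD_append _ _ _ _ (by simp; omega), List.getD_append _ _ _ _ (by simp; omega),
      List.getD_append _ _ _ _ (by simp; omega), List.getD_append _ _ _ _ (by simp; omega),
      List.getD_append_right _ _ _ _ (by simp; omega), getD_ofFn]
    congr 1
  · rw [List.getD_append _ _ _ _ (by simp; omega), List.getD_append _ _ _ _ (by simp; omega),
      List.getD_append _ _ _ _ (by simp; omega), List.getD_append_right _ _ _ _ (by simp; omega),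
      getD_ofFn]
    congr 1
    simp
    omega
  · rw [List.getD_append _ _ _ _ (by simp; omega), List.getD_append _ _ _ _ (by simp; omega),
      List.getD_append_right _ _ _ _ (by simp; omega), getD_ofFn]
    congr 1
    simp
    omega
  · rw [List.getD_append _ _ _ _ (by simp; omega), List.getD_append_right _ _ _ _ (by simp; omega),
      getD_ofFn]
    congr 1
    simp
    omega
  · rw [List.getD_append_right _ _ _ _ (by simp; omega), getD_ofFn]
    congr 1
    simp
    omega

theorem startOf_inp (i : ℕ) : (startOf I).arr .inp i = I.encode.getD i 0 := rfl

theorem startOf_start : Start (dataOf I C) (startOf I) := by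
  refine ⟨?_, ?_, ?_, fun j hj => ?_, fun j hj => ?_, fun i hi => ?_, fun i hi => ?_, fun i hi => ?_,
    fun a ha i => ?_, rfl⟩
  · rfl
  · rfl
  · rfl
  · replace hj : j < I.n - 1 := hj
    simp only [startOf_inp, encode_getD, dataOf]
    rw [if_neg (by omega), if_pos (by omega)]
    congr 1; omega
  · replace hj : j < I.n - 1 := hj
    simp only [startOf_inp, encode_getD, dataOf]
    rw [if_neg (by omega), if_neg (by omega), if_pos (by omega)]
    congr 1; omega
  · replace hi : i < I.p := hi
    simp only [startOf_inp, encode_getD, dataOf]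
    rw [if_neg (by omega), if_neg (by omega), if_neg (by omega), if_pos (by omega)]
    congr 1; omega
  · replace hi : i < I.p := hi
    simp only [startOf_inp, encode_getD, dataOf]
    rw [if_neg (by omega), if_neg (by omega), if_neg (by omega), if_neg (by omega),
      if_pos (by omega)]
    congr 1; omega
  · replace hi : i < I.p := hi
    simp only [startOf_inp, encode_getD, dataOf]
    rw [if_neg (by omega), if_neg (by omega), if_neg (by omega), if_neg (by omega),
      if_neg (by omega)]
    congr 1; omega
  · simp [startOf, ha]

theorem encode_lt {X : ℕ} (h0 : 0 < X) (h1 : I.n < X) (h2 : I.p < X) (h3 : I.k < X)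
    (h4 : ∀ i, I.weight i < X) (i : ℕ) : I.encode.getD i 0 < X := by
  have key : ∀ {N : ℕ} (f : Fin N → ℕ) (j : ℕ), (∀ i, f i < X) → extendZero f j < X := by
    intro N f j hf
    unfold extendZero
    split_ifs
    · exact hf _
    · exact h0
  rw [encode_getD]
  split_ifs with h
  · interval_cases i <;> assumption
  · exact key _ _ fun j => (I.edge j).1.2.trans h1
  · exact key _ _ fun j => (I.edge j).2.2.trans h1
  · exact key _ _ fun j => (I.ends j).1.2.trans h1
  · exact key _ _ fun j => (I.ends j).2.2.trans h1
  · exact key _ _ h4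

theorem encode_length : I.encode.length = 3 + 2 * (I.n - 1) + 3 * I.p := by
  simp [TreePathInput.encode]
  omega

end

/-- The machine program: the addresses of the output and of the working arrays are computed, and
then the compiled algorithm is run. -/
def machine : WordRAM.Prog :=
  .seq (.assign 0 (.op .add (.lit 1) (.op .add (.op .mul (.lit 2) (.load (.lit 0)))
      (.op .mul (.lit 3) (.load (.lit 1))))))
    (.seq (.assign 1 (.op .add (.reg 0) (.op .mul (.load (.lit 0))
      (.op .add (.load (.lit 2)) (.lit 1))))) solveP.comp)

section
variable {I : TreePathInput} {C w X : ℕ}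

/-- The parameters of the run on an instance. All kept values will be below `X`. -/
def ctxOf (I : TreePathInput) (X : ℕ) : Ctx where
  X := X
  li := 3 + 2 * (I.n - 1) + 3 * I.p
  lo := I.n * (I.k + 1)

/-- The start address of the output, which is at least the length `3 + 2 (n - 1) + 3 p` of the
input. -/
def outStart (I : TreePathInput) : ℕ := 1 + (2 * I.n + 3 * I.p)

/-- The machine state after the computation of the addresses. -/
def laidOut (w : ℕ) (I : TreePathInput) : WordRAM.State where
  reg := Function.update (Function.update (fun _ => 0) 0 (outStart I)) 1
    (outStart I + I.n * (I.k + 1))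
  mem := (WordRAM.initState w I.encode).mem

theorem exec_assign {r x : ℕ} {e : WordRAM.Expr} {s : WordRAM.State} (h : e.eval w s = x) :
    WordRAM.Exec w (.assign r e) s ⟨Function.update s.reg r x, s.mem⟩ (e.cost + 1) :=
  h ▸ .assign r e s

/-- The two address computations take `12` and `10` steps. -/
theorem exec_machine {s : WordRAM.State} {t : ℕ} (h1 : 8 ≤ 2 ^ w)
    (h2 : outStart I + I.n * (I.k + 1) < 2 ^ w) (hn : 1 ≤ I.n)
    (h : WordRAM.Exec w solveP.comp (laidOut w I) s t) :
    WordRAM.Exec w machine (WordRAM.initState w I.encode) s (12 + (10 + t)) := by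
  have hk : I.k + 1 ≤ I.n * (I.k + 1) := Nat.le_mul_of_pos_left _ hn
  unfold outStart at h2
  have m0 : (WordRAM.initState w I.encode).mem 0 = I.n :=
    Nat.mod_eq_of_lt (show I.n < 2 ^ w by omega)
  have m1 : (WordRAM.initState w I.encode).mem 1 = I.p :=
    Nat.mod_eq_of_lt (show I.p < 2 ^ w by omega)
  have m2 : (WordRAM.initState w I.encode).mem 2 = I.k :=
    Nat.mod_eq_of_lt (show I.k < 2 ^ w by omega)
  have l0 : 0 % 2 ^ w = 0 := Nat.zero_mod _
  have l1 : 1 % 2 ^ w = 1 := Nat.mod_eq_of_lt (by omega)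
  have l2 : 2 % 2 ^ w = 2 := Nat.mod_eq_of_lt (by omega)
  have l3 : 3 % 2 ^ w = 3 := Nat.mod_eq_of_lt (by omega)
  refine .seq (exec_assign (x := outStart I) ?_)
    (.seq (exec_assign (x := outStart I + I.n * (I.k + 1)) ?_) h)
  · simp only [WordRAM.Expr.eval, WordRAM.Op.apply, l0, l1, l2, l3, m0, m1]
    rw [Nat.mod_eq_of_lt (show 2 * I.n < 2 ^ w by omega),
      Nat.mod_eq_of_lt (show 3 * I.p < 2 ^ w by omega),
      Nat.mod_eq_of_lt (show 2 * I.n + 3 * I.p < 2 ^ w by omega),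
      Nat.mod_eq_of_lt (show 1 + (2 * I.n + 3 * I.p) < 2 ^ w by omega)]
    rfl
  · simp only [WordRAM.Expr.eval, WordRAM.Op.apply, l0, l1, l2, m0, m2, Function.update_self]
    rw [Nat.mod_eq_of_lt (show I.k + 1 < 2 ^ w by omega),
      Nat.mod_eq_of_lt (show I.n * (I.k + 1) < 2 ^ w by omega)]
    exact Nat.mod_eq_of_lt (by unfold outStart; omega)

end

end KLightest

open KLightest in
theorem mainTheorem5 :
    ∃ (P : WordRAM.Prog) (a c : ℕ),
      ∀ (I : TreePathInput) (C : ℕ), I.tree.IsTree → 1 ≤ I.k → (∀ i, I.weight i ≤ C) →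
      ∀ w : ℕ, a * (Nat.log 2 (I.n * I.k + I.p + C) + 1) ≤ w →
        ∃ (s : WordRAM.State) (t : ℕ),
          WordRAM.Exec w P (WordRAM.initState w I.encode) s t ∧
          t ≤ c * (I.n * I.k + I.p + C) ∧
          I.blockStart s (I.n - 1) ≤ 2 ^ w ∧
          ∀ j : Fin (I.n - 1), I.IsAnswer j (I.output s j) := by
  refine ⟨machine, 11 * (solveP.size + 1), 100 + 2000 * solveP.cost, ?_⟩
  intro I C hT hk hC w hw
  have hD := dataOf_ok (C := C) hT hk hC
  have hn : 1 ≤ I.n := hD.n_pos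
  set S := I.n * I.k + I.p + C with hS
  set X := 300 * (S * S) with hX
  have hnk : I.n ≤ I.n * I.k := Nat.le_mul_of_pos_right _ hk
  have hkn : I.k ≤ I.n * I.k := Nat.le_mul_of_pos_left _ hn
  have hnk1 : I.n * (I.k + 1) = I.n * I.k + I.n := by ring
  have hnn : I.n * I.n ≤ S * S := Nat.mul_le_mul (by omega) (by omega)
  have hSS : S ≤ S * S := Nat.le_mul_of_pos_left _ (by omega)
  -- `X = O(S ^ 2)` bounds all kept values, and `X ^ solveP.size` those of all expressions of the
  -- program; `11` bits for each bit of `S` are enough for `X`, since `300 < 2 ^ 9`.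
  have hXw : X < 2 ^ (11 * (Nat.log 2 S + 1)) := by
    have h1 : S < 2 ^ (Nat.log 2 S + 1) := Nat.lt_pow_succ_log_self (by omega) S
    have h2 : S * S < 2 ^ (Nat.log 2 S + 1) * 2 ^ (Nat.log 2 S + 1) := Nat.mul_lt_mul'' h1 h1
    have h3 : 300 ≤ 2 ^ (9 * (Nat.log 2 S + 1)) :=
      le_trans (by norm_num : 300 ≤ 2 ^ 9) (Nat.pow_le_pow_right (by omega) (by omega))
    calc X < 300 * (2 ^ (Nat.log 2 S + 1) * 2 ^ (Nat.log 2 S + 1)) := by omega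
      _ ≤ 2 ^ (9 * (Nat.log 2 S + 1)) * (2 ^ (Nat.log 2 S + 1) * 2 ^ (Nat.log 2 S + 1)) :=
        Nat.mul_le_mul_right _ h3
      _ = 2 ^ (11 * (Nat.log 2 S + 1)) := by rw [← pow_add, ← pow_add]; congr 1; ring
  have hsize : X ^ solveP.size < 2 ^ w := by
    calc X ^ solveP.size ≤ (2 ^ (11 * (Nat.log 2 S + 1))) ^ solveP.size :=
          Nat.pow_le_pow_left hXw.le _
      _ = 2 ^ (11 * (Nat.log 2 S + 1) * solveP.size) := (pow_mul _ _ _).symm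
      _ < 2 ^ w := by
        refine Nat.pow_lt_pow_right (by omega) (lt_of_lt_of_le ?_ hw)
        rw [show 11 * (solveP.size + 1) * (Nat.log 2 S + 1) =
          11 * (Nat.log 2 S + 1) * solveP.size + 11 * (Nat.log 2 S + 1) by ring]
        omega
  have hXw' : X ≤ 2 ^ w := hXw.le.trans (Nat.pow_le_pow_right (by omega)
    (le_trans (by nlinarith [Nat.zero_le (solveP.size * (Nat.log 2 S + 1))]) hw))
  have hL : Layout (ctxOf I X) (outStart I) (outStart I + I.n * (I.k + 1)) :=
    ⟨show 64 ≤ X by omega, show 3 + 2 * (I.n - 1) + 3 * I.p ≤ 1 + (2 * I.n + 3 * I.p) by omega,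
      le_rfl, show 1 + (2 * I.n + 3 * I.p) + I.n * (I.k + 1) < X by omega⟩
  have hbig : Big (dataOf I C) (ctxOf I X) :=
    ⟨rfl, rfl, show 100 + 100 * I.n + I.n * I.n + I.p + C + I.n * (I.k + 1) ≤ X by omega⟩
  have henc : ∀ i, I.encode.getD i 0 < X := encode_lt (by omega) (by omega) (by omega) (by omega)
    fun i => by have := hC i; omega
  have hrep : Rep (ctxOf I X) (outStart I) (outStart I + I.n * (I.k + 1)) (startOf I)
      (laidOut w I) := by
    have hmem : ∀ i, (laidOut w I).mem i = I.encode.getD i 0 := fun i =>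
      Nat.mod_eq_of_lt (lt_of_lt_of_le (henc i) hXw')
    have hout : ∀ i, outStart I ≤ i → I.encode.getD i 0 = 0 := fun i hi =>
      List.getD_eq_default _ _ (by rw [encode_length]; unfold outStart at hi; omega)
    refine ⟨by simp [laidOut], by simp [laidOut], fun _ => by simp [laidOut, startOf],
      fun i _ => hmem i, fun i _ => ?_, fun a h1 h2 i => ?_, fun _ => ?_, fun a i => ?_⟩
    · rw [hmem, hout _ (by omega)]; rfl
    · rw [hmem, hout _ (by omega)]; simp [startOf, h1]
    · change 0 < X
      omega
    · simp only [startOf]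
      split_ifs
      · exact henc i
      · change 0 < X
        omega
  obtain ⟨σ, hrun, pos, par, eid, L, mx, hR, hW, hmx, hlists, htm⟩ :=
    solveP_spec hD hbig (startOf_start (I := I) (C := C))
  obtain ⟨s, t, hexec, hrep', ht⟩ := hrun.sim hL _ hrep le_rfl hsize
  refine ⟨s, 12 + (10 + t), exec_machine (by omega) (lt_of_lt_of_le hL.hBX hXw') hn hexec, ?_, ?_,
    fun j => ?_⟩
  · have h1 : solveP.cost * σ.tm ≤ solveP.cost * (2000 * S) := Nat.mul_le_mul_left _ htm
    have h2 : (100 + 2000 * solveP.cost) * S = 100 * S + solveP.cost * (2000 * S) := by ring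
    omega
  · have h1 : (I.n - 1) * (I.k + 1) ≤ I.n * (I.k + 1) := Nat.mul_le_mul_right _ (by omega)
    have h2 := hL.hBX
    change _ < X at h2
    rw [TreePathInput.blockStart, hrep'.reg0]
    omega
  · obtain ⟨x, hx, hj⟩ := hR.exists_eid j j.2
    obtain ⟨w1, w2, w3⟩ := hW x hx
    rw [hj] at w2 w3
    change (L x).length ≤ I.k at w1
    have hlo : (j : ℕ) * (I.k + 1) + (I.k + 1) ≤ I.n * (I.k + 1) := by
      rw [← Nat.succ_mul]; exact Nat.mul_le_mul_right _ (by have := j.2; omega)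
    have hlen : s.mem (I.blockStart s j) = (L x).length := by
      rw [TreePathInput.blockStart, hrep'.reg0]
      exact (hrep'.out _ (show _ < I.n * (I.k + 1) by omega)).trans w2
    have hout : I.output s j = L x := by
      refine List.ext_getElem (by simp [TreePathInput.output, hlen]) fun t h1 h2 => ?_
      simp only [TreePathInput.output, List.getElem_map, List.getElem_range]
      rw [TreePathInput.blockStart, hrep'.reg0, ← List.getD_eq_getElem _ 0 h2, ← w3 t h2,
        add_assoc, add_assoc, ← add_assoc (_ * _)]
      exact hrep'.out _ (show _ < I.n * (I.k + 1) by omega)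
    rw [hout, hlists x hx]
    exact hR.isAnswer hT hx hj hmx
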